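/- **Weak convergence for the Curie–Weiss–Potts model.** Let $q>2$ be an integer, $\Lambda=\{\theta^1,\dots,\theta^q\}$ a set of $q$ letters, $\Sigma_q=\Lambda^{\mathbb N}$ with the product topology, $\sigma$ the shift map on $\Sigma_q$, $\rho$ the uniform probability on $\Lambda$ and $\mathbb P=\rho^{\otimes\mathbb N}$. For a word $\omega=\omega_0\cdots\omega_{n-1}$ put $$H_n(\omega)=-\frac1{2n}\sum_{i,j=0}^{n-1}\mathbf 1_{\omega_j=\omega_i},$$ and let $\mu_{n,\beta}$ be the probability measure on $\Sigma_q$ given by $$\mu_{n,\beta}(d\omega)=\frac{e^{-\beta H_n(\omega_0\cdots\omega_{n-1})}}{Z_{n,\beta}}\,\mathbb P(d\omega),\qquad Z_{n,\beta}=\frac1{q^n}\sum_{|\omega'|=n}e^{-\beta H_n(\omega')}.$$ For $1\le k\le q$ and $b\in\mathbb R$ let $\widetilde\mu^k_b$ be the dynamical Gibbs measure for $b\,\mathbf 1_{[\theta^k]}$, that is, the unique equilibrium state: the unique $\sigma$-invariant probability measure $\mu$ on $\Sigma_q$ which maximizes $h_\mu+b\,\mu([\theta^k])$, where $h_\mu$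 is the Kolmogorov–Sinai entropy of $\mu$ and $[\theta^k]=\{x\in\Sigma_q: x_0=\theta^k\}$ (it exists and is unique). Let $$\beta_c=\frac{2(q-1)\log(q-1)}{q-2}.$$ For $0<\beta<\beta_c$ set $s_\beta=0$, and for $\beta\ge\beta_c$ let $s_\beta$ be the largest real solution (which exists) of $$s=\frac{e^{\beta s}-1}{e^{\beta s}+q-1}.$$ Then, as $n\to+\infty$, the measures $\mu_{n,\beta}$ converge weakly to $$\begin{cases}\rho^{\otimes\mathbb N}&\text{if }0<\beta<\beta_c,\\[4pt] \dfrac1q\displaystyle\sum_{k=1}^q\widetilde\mu^k_{\beta s_\beta}&\text{if }\beta>\beta_c,\\[8pt] \dfrac{A\,\widetilde\mu^1_0+B\displaystyle\sum_{k=1}^q\widetilde\mu^k_{\beta_c s_{\beta_c}}}{A+qB}&\text{if }\beta=\beta_c,\end{cases}$$ where $A=\left(1-\frac{\beta_c}{q(q-1)}\right)^{\frac{q-2}2}$ and $B=\left(1-\frac{\beta_c}{q}\right)^{\frac{q-2}2}$. -/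

import Mathlib

open MeasureTheory Filter Topology
open scoped ENNReal

noncomputable section

namespace CWP

/-! ### Entropy, pressure and equilibrium states of a measurable dynamical system -/

/-- Shannon entropy `-∑ μ(Cᵢ) log μ(Cᵢ)` of the finite partition of `X` into the level sets
`Cᵢ = {f = i}` of a labelling `f`. -/
def partitionEntropy {X ι : Type*} [MeasurableSpace X] [Fintype ι]
    (μ : Measure X) (f : X → ι) : ℝ :=
  ∑ i, Real.negMulLog (μ.real (f ⁻¹' {i}))

/-- The labelling of the joint partition `⋁_{j<n} T^{-j} ξ`, where `ξ` is the partition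
labelled by `f`. -/
def itinerary {X ι : Type*} (T : X → X) (f : X → ι) (n : ℕ) : X → (Fin n → ι) :=
  fun x j => f (T^[j] x)

/-- Entropy `h_μ(T, ξ) = lim (1/n) H_μ(⋁_{j<n} T^{-j} ξ)` of `T` relative to a finite partition.
For `T`-invariant `μ` the sequence converges by subadditivity, so the upper limit is the limit. -/
def entropyRate {X ι : Type*} [MeasurableSpace X] [Fintype ι]
    (μ : Measure X) (T : X → X) (f : X → ι) : ℝ≥0∞ :=
  limsup (fun n : ℕ => ENNReal.ofReal (partitionEntropy μ (itinerary T f n) / n)) atTop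

/-- Kolmogorov–Sinai entropy: the supremum of the entropies relative to all finite measurable
partitions. -/
def ksEntropy {X : Type*} [MeasurableSpace X] (μ : Measure X) (T : X → X) : ℝ≥0∞ :=
  ⨆ (m : ℕ) (f : X → Fin m) (_ : Measurable f), entropyRate μ T f

/-- Free energy `h_μ + ∫ ψ dμ`. -/
def freeEnergy {X : Type*} [MeasurableSpace X] (T : X → X) (ψ : X → ℝ) (μ : Measure X) : EReal :=
  (ksEntropy μ T : EReal) + ((∫ x, ψ x ∂μ : ℝ) : EReal)

/-- `T`-invariant probability measures. -/
def IsInvariantProb {X : Type*} [MeasurableSpace X] (T : X → X) (μ : Measure X) : Prop :=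
  IsProbabilityMeasure μ ∧ MeasurePreserving T μ μ

/-- Pressure: the supremum of the free energy over the invariant probability measures. -/
def pressure {X : Type*} [MeasurableSpace X] (T : X → X) (ψ : X → ℝ) : EReal :=
  ⨆ (μ : Measure X) (_ : IsInvariantProb T μ), freeEnergy T ψ μ

/-- Equilibrium states: invariant probability measures at which the pressure is attained. -/
def IsEquilibriumState {X : Type*} [MeasurableSpace X] (T : X → X) (ψ : X → ℝ)
    (μ : Measure X) : Prop :=
  IsInvariantProb T μ ∧ freeEnergy T ψ μ = pressure T ψ

/-- `μ` is the dynamical Gibbs measure of `ψ`: the unique equilibrium state. -/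
def IsDynamicalGibbs {X : Type*} [MeasurableSpace X] (T : X → X) (ψ : X → ℝ)
    (μ : Measure X) : Prop :=
  IsEquilibriumState T ψ μ ∧ ∀ ν : Measure X, IsEquilibriumState T ψ ν → ν = μ

/-- Weak convergence of a sequence of Borel probability measures. -/
def WeaklyConverges {X : Type*} [TopologicalSpace X] [MeasurableSpace X] [OpensMeasurableSpace X]
    (P : ℕ → Measure X) (Q : Measure X) : Prop :=
  ∃ (P' : ℕ → ProbabilityMeasure X) (Q' : ProbabilityMeasure X),
    (∀ n, (P' n : Measure X) = P n) ∧ (Q' : Measure X) = Q ∧ Tendsto P' atTop (𝓝 Q')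

/-! ### The full shift and the Curie–Weiss–Potts model -/

/-- One-sided full shift space over an alphabet of `q` letters (product topology and product
σ-algebra). -/
abbrev Shift (q : ℕ) : Type := ℕ → Fin q

/-- The shift map. -/
def shift {q : ℕ} (x : Shift q) : Shift q := fun n => x (n + 1)

/-- The potential `b · 1_{[θ^k]}`. -/
def potential {q : ℕ} (k : Fin q) (b : ℝ) : Shift q → ℝ :=
  fun x => if x 0 = k then b else 0

/-- Curie–Weiss–Potts Hamiltonian of a word of length `n`. -/
def hamiltonian {q n : ℕ} (w : Fin n → Fin q) : ℝ :=
  -(1 / (2 * (n : ℝ))) * ∑ i, ∑ j, if w j = w i then (1 : ℝ) else 0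

/-- The uniform Bernoulli measure `ρ^{⊗ℕ}`. -/
def uniformBernoulli (q : ℕ) : Measure (Shift q) :=
  Measure.infinitePi fun _ : ℕ => ProbabilityTheory.uniformOn (Set.univ : Set (Fin q))

/-- Normalization factor `Z_{n,β}`. -/
def partitionFunction (q n : ℕ) (β : ℝ) : ℝ :=
  (1 / (q : ℝ) ^ n) * ∑ w : Fin n → Fin q, Real.exp (-β * hamiltonian w)

/-- The probabilistic Gibbs measure `μ_{n,β}`. -/
def gibbs (q n : ℕ) (β : ℝ) : Measure (Shift q) :=
  (uniformBernoulli q).withDensity fun x =>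
    ENNReal.ofReal
      (Real.exp (-β * hamiltonian (fun i : Fin n => x i)) / partitionFunction q n β)

/-- The critical inverse temperature `β_c`. -/
def betaC (q : ℕ) : ℝ := 2 * ((q : ℝ) - 1) * Real.log ((q : ℝ) - 1) / ((q : ℝ) - 2)

/-- Real solutions of `s = (e^{βs} - 1) / (e^{βs} + q - 1)`. -/
def meanFieldRoots (q : ℕ) (β : ℝ) : Set ℝ :=
  {s | s = (Real.exp (β * s) - 1) / (Real.exp (β * s) + (q : ℝ) - 1)}

/-- `s_β`: zero below `β_c`, and the largest root from `β_c` on. -/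
def sBeta (q : ℕ) (β : ℝ) : ℝ :=
  if β < betaC q then 0 else sSup (meanFieldRoots q β)

/-- The weight `A`. -/
def weightA (q : ℕ) : ℝ := (1 - betaC q / ((q : ℝ) * ((q : ℝ) - 1))) ^ (((q : ℝ) - 2) / 2)

/-- The weight `B`. -/
def weightB (q : ℕ) : ℝ := (1 - betaC q / (q : ℝ)) ^ (((q : ℝ) - 2) / 2)

end CWP

end

noncomputable section

namespace CWP

/-! ### Finite entropy inequalities -/

section FiniteEntropy

variable {ι : Type*} [Fintype ι] {p Q : ι → ℝ}

/-! The limits. Up to an additive constant, the potential `b · 1_{[θ^k]}` is the logarithm of the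
letter weights `gibbsWeight k b`. The Gibbs inequality against the corresponding product weights on
words of length `n`, together with `ksEntropy_le_div` (entropy is at most block entropy per letter),
bounds the free energy of every invariant measure by `log (e^b + q - 1)`. Equality forces every
block law to be a product, so the unique equilibrium state is Bernoulli
(`isDynamicalGibbs_bernoulli`). Weak convergence on the shift reduces to convergence of word
probabilities.

The Gibbs measures. The Hamiltonian is a quadratic form in the letter counts, so a Gaussian
(Hubbard–Stratonovich) linearization introduces a field `y` in `ℝ^q`, given which the first `n`
letters are independent with law `softmax β y`. A word probability is therefore a ratio of integrals
against `exp (-n G)` with `G = mfEnergy β` (`gibbs_word_eq_integral`). Laplace's method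
(`tendsto_laplace`) concentrates these integrals on the global minimizers of `G`, each weighted by
the inverse square root of its Hessian determinant (`weaklyConverges_gibbs`).

The minimizers. A critical point satisfies `y = softmax β y`, so all points `(y i, log (y i))` lie
on one line. Strict concavity of `log` and the second order condition leave at most one exceptional
coordinate (`exists_orderPoint_of_minimizer`), hence one order parameter `s` with `gap q β s = 0`.
The function `gap` is concave and then convex, and it is a positive multiple of the derivative of
the free energy `rayFree` along the ray. At `β_c` the values at `s = 0` and `s = 2 * inflection q`
tie. As `rayFree` is affine in `β` with slope decreasing in `s²`, the uniform point wins below `β_c`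
and the ordered points win above.

The weights. By symmetry the ordered points all have the same Hessian determinant, which gives
`1/q`. At `β_c`, `det_hessian_orderPoint` evaluated at the uniform and ordered points produces `A`
and `B`. -/

lemma negMulLog_add_mul_log_eq {x y : ℝ} (h : y = 0 → x = 0) :
    Real.negMulLog x + x * Real.log y = y - x - y * InformationTheory.klFun (x / y) := by
  rcases eq_or_ne y 0 with rfl | hy
  · simp [h rfl]
  · rcases eq_or_ne x 0 with rfl | hx
    · simp [InformationTheory.klFun]
    · rw [InformationTheory.klFun_apply, Real.log_div hx hy, Real.negMulLog]
      field_simp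
      ring

/-- The Gibbs inequality for finite families. -/
lemma sum_negMulLog_le (hp : ∀ i, 0 ≤ p i) (hQ : ∀ i, 0 ≤ Q i) (hpQ : ∀ i, Q i = 0 → p i = 0)
    (hsum : ∑ i, Q i ≤ ∑ i, p i) :
    ∑ i, Real.negMulLog (p i) ≤ ∑ i, p i * -Real.log (Q i) := by
  have key : ∑ i, (Real.negMulLog (p i) + p i * Real.log (Q i)) ≤ ∑ i, (Q i - p i) := by
    refine Finset.sum_le_sum fun i _ => ?_
    rw [negMulLog_add_mul_log_eq (hpQ i)]
    have := mul_nonneg (hQ i) (InformationTheory.klFun_nonneg (div_nonneg (hp i) (hQ i)))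
    linarith
  rw [Finset.sum_add_distrib, Finset.sum_sub_distrib] at key
  simp only [mul_neg, Finset.sum_neg_distrib]
  linarith

/-- The equality case of the Gibbs inequality. -/
lemma eq_of_sum_negMulLog_ge (hp : ∀ i, 0 ≤ p i) (hQ : ∀ i, 0 < Q i)
    (hsum : ∑ i, Q i ≤ ∑ i, p i)
    (h : ∑ i, p i * -Real.log (Q i) ≤ ∑ i, Real.negMulLog (p i)) : p = Q := by
  have hnn : ∀ i, 0 ≤ Q i * InformationTheory.klFun (p i / Q i) := fun i =>
    mul_nonneg (hQ i).le (InformationTheory.klFun_nonneg (div_nonneg (hp i) (hQ i).le))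
  have key : ∑ i, (Real.negMulLog (p i) + p i * Real.log (Q i))
      = ∑ i, (Q i - p i - Q i * InformationTheory.klFun (p i / Q i)) :=
    Finset.sum_congr rfl fun i _ => negMulLog_add_mul_log_eq fun h0 => absurd h0 (hQ i).ne'
  rw [Finset.sum_add_distrib, Finset.sum_sub_distrib, Finset.sum_sub_distrib] at key
  simp only [mul_neg, Finset.sum_neg_distrib] at h
  have hz : ∑ i, Q i * InformationTheory.klFun (p i / Q i) = 0 :=
    le_antisymm (by linarith) (Finset.sum_nonneg fun i _ => hnn i)
  rw [Finset.sum_eq_zero_iff_of_nonneg fun i _ => hnn i] at hz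
  funext i
  have h1 := (mul_eq_zero.1 (hz i (Finset.mem_univ i))).resolve_left (hQ i).ne'
  rw [InformationTheory.klFun_eq_zero_iff (div_nonneg (hp i) (hQ i).le)] at h1
  rwa [div_eq_one_iff_eq (hQ i).ne'] at h1

end FiniteEntropy

/-! ### Entropy of finite measurable labellings -/

section PartitionEntropy

variable {X ι κ : Type*} [MeasurableSpace X] [Fintype ι] [MeasurableSpace ι]
  [MeasurableSingletonClass ι] [Fintype κ] [MeasurableSpace κ] [MeasurableSingletonClass κ]
  {μ : Measure X} [IsProbabilityMeasure μ]

lemma integral_comp_label {f : X → ι} (hf : Measurable f) (c : ι → ℝ) :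
    ∫ x, c (f x) ∂μ = ∑ i, μ.real (f ⁻¹' {i}) * c i := by
  have : IsProbabilityMeasure (μ.map f) := Measure.isProbabilityMeasure_map hf.aemeasurable
  rw [← integral_map (φ := f) hf.aemeasurable (measurable_of_finite c).aestronglyMeasurable,
    integral_fintype (Integrable.of_finite)]
  refine Finset.sum_congr rfl fun i _ => ?_
  rw [map_measureReal_apply hf (measurableSet_singleton i), smul_eq_mul]

lemma integrable_comp_label {f : X → ι} (hf : Measurable f) (c : ι → ℝ) :
    Integrable (fun x => c (f x)) μ := by
  have : IsProbabilityMeasure (μ.map f) := Measure.isProbabilityMeasure_map hf.aemeasurable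
  exact (integrable_map_measure (measurable_of_finite c).aestronglyMeasurable
    hf.aemeasurable).1 Integrable.of_finite

lemma sum_measureReal_label {f : X → ι} (hf : Measurable f) :
    ∑ i, μ.real (f ⁻¹' {i}) = 1 := by
  simpa using (integral_comp_label (μ := μ) hf fun _ => 1).symm

lemma partitionEntropy_eq_integral {f : X → ι} (hf : Measurable f) :
    partitionEntropy μ f = ∫ x, -Real.log (μ.real (f ⁻¹' {f x})) ∂μ := by
  rw [integral_comp_label (c := fun i => -Real.log (μ.real (f ⁻¹' {i}))) hf]
  exact Finset.sum_congr rfl fun i _ => by simp [Real.negMulLog]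

/-- Entropy is bounded by any cross entropy. -/
lemma partitionEntropy_le_integral {f : X → ι} (hf : Measurable f) {Q : ι → ℝ}
    (hQ : ∀ i, 0 ≤ Q i) (hfQ : ∀ i, Q i = 0 → μ.real (f ⁻¹' {i}) = 0) (hsum : ∑ i, Q i ≤ 1) :
    partitionEntropy μ f ≤ ∫ x, -Real.log (Q (f x)) ∂μ := by
  rw [integral_comp_label (c := fun i => -Real.log (Q i)) hf]
  exact sum_negMulLog_le (fun _ => measureReal_nonneg) hQ hfQ
    (hsum.trans_eq (sum_measureReal_label hf).symm)

/-- Each cell of `g` lies in a cell of the coarser labelling, which has larger mass and so a smaller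
`-log`; averaging over the cells of `g` gives the bound. -/
lemma partitionEntropy_le_of_factor {g : X → κ} (hg : Measurable g)
    (φ : κ → ι) :
    partitionEntropy μ (fun x => φ (g x)) ≤ partitionEntropy μ g := by
  have hf : Measurable fun x => φ (g x) := (measurable_of_finite φ).comp hg
  rw [partitionEntropy_eq_integral hf,
    integral_comp_label (f := g)
      (c := fun k => -Real.log (μ.real ((fun x => φ (g x)) ⁻¹' {φ k}))) hg]
  refine Finset.sum_le_sum fun k _ => ?_
  rcases (measureReal_nonneg (μ := μ) (s := g ⁻¹' {k})).eq_or_lt with h0 | h0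
  · simp [← h0]
  · rw [Real.negMulLog, neg_mul, mul_neg, neg_le_neg_iff]
    refine mul_le_mul_of_nonneg_left (Real.log_le_log h0 (measureReal_mono ?_)) h0.le
    rintro x rfl
    simp

/-- There are only finitely many null cells. This is what permits splitting the logarithm of a
product of cell masses almost everywhere. -/
lemma measureReal_label_pos_ae {X ι : Type*} [MeasurableSpace X] [Finite ι] (μ : Measure X)
    [IsProbabilityMeasure μ] (f : X → ι) :
    ∀ᵐ x ∂μ, 0 < μ.real (f ⁻¹' {f x}) := by
  have hset : {x | ¬ 0 < μ.real (f ⁻¹' {f x})} =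
      ⋃ i ∈ {i | μ.real (f ⁻¹' {i}) = 0}, f ⁻¹' {i} := by
    ext x
    simp only [not_lt, Set.mem_ofPred_eq, Set.mem_iUnion, Set.mem_preimage, Set.mem_singleton_iff,
      exists_prop, exists_eq_right']
    exact ⟨fun h => le_antisymm h measureReal_nonneg, le_of_eq⟩
  rw [ae_iff, hset, measure_biUnion_null_iff (Set.to_countable _)]
  intro i hi
  exact (measureReal_eq_zero_iff).1 hi

end PartitionEntropy

/-! ### Words of the full shift -/

section Words

variable {q : ℕ}

/-- The first `n` letters of a sequence. -/
def word (n : ℕ) (x : Shift q) : Fin n → Fin q := fun i => x i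

lemma measurable_word (n : ℕ) : Measurable (word (q := q) n) :=
  measurable_pi_lambda _ fun _ => measurable_pi_apply _

lemma measurable_shift : Measurable (shift (q := q)) :=
  measurable_pi_lambda _ fun _ => measurable_pi_apply _

lemma shift_iterate_apply (j i : ℕ) (x : Shift q) : shift^[j] x i = x (i + j) := by
  induction j generalizing x with
  | zero => rfl
  | succ j ih => rw [Function.iterate_succ_apply, ih]; simp [shift, add_assoc]

lemma itinerary_eval_zero (n : ℕ) : itinerary shift (fun x : Shift q => x 0) n = word n := by
  funext x j
  simp [itinerary, word, shift_iterate_apply]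

/-- A finite set of coordinates sits inside an initial segment, and over a finite alphabet every set
of words is measurable. -/
lemma mem_measurableCylinders_iff {s : Set (Shift q)} :
    s ∈ measurableCylinders (fun _ : ℕ => Fin q) ↔ ∃ m S, s = word m ⁻¹' S := by
  rw [mem_measurableCylinders]
  constructor
  · rintro ⟨t, S, -, rfl⟩
    obtain ⟨m, hm⟩ : ∃ m, ∀ i ∈ t, i < m := ⟨t.sup id + 1, fun i hi =>
      Nat.lt_succ_of_le (Finset.le_sup (f := id) hi)⟩
    refine ⟨m, {u | (fun i : t => u ⟨i, hm i i.2⟩) ∈ S}, ?_⟩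
    ext x
    rfl
  · rintro ⟨m, S, rfl⟩
    refine ⟨Finset.range m, {v | (fun i : Fin m => v ⟨i, by simp⟩) ∈ S},
      Set.toFinite _ |>.measurableSet, ?_⟩
    ext x
    rfl

lemma measure_preimage_word (μ : Measure (Shift q)) (m : ℕ) (S : Set (Fin m → Fin q)) :
    μ (word m ⁻¹' S) = ∑ u ∈ S.toFinite.toFinset, μ (word m ⁻¹' {u}) := by
  rw [← Measure.map_apply (measurable_word m) S.toFinite.measurableSet]
  conv_lhs => rw [← S.toFinite.coe_toFinset, ← sum_measure_singleton]
  exact Finset.sum_congr rfl fun u _ =>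
    Measure.map_apply (measurable_word m) (measurableSet_singleton u)

/-- A probability measure on the full shift is determined by its word frequencies. -/
lemma ext_of_word {μ ν : Measure (Shift q)} [IsProbabilityMeasure μ] [IsProbabilityMeasure ν]
    (h : ∀ m u, μ (word m ⁻¹' {u}) = ν (word m ⁻¹' {u})) : μ = ν := by
  refine ext_of_generate_finite _ (generateFrom_measurableCylinders (α := fun _ : ℕ => Fin q)).symm
    (isPiSystem_measurableCylinders) ?_ (by simp)
  intro s hs
  obtain ⟨m, S, rfl⟩ := mem_measurableCylinders_iff.1 hs
  rw [measure_preimage_word, measure_preimage_word]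
  exact Finset.sum_congr rfl fun u _ => h m u

/-- Finite measurable labellings are approximated by labellings that depend on finitely many
letters. -/
lemma exists_word_approx (μ : Measure (Shift q)) [IsProbabilityMeasure μ] {M : ℕ} [NeZero M]
    {f : Shift q → Fin M} (hf : Measurable f) {δ : ℝ} (hδ : 0 < δ) :
    ∃ m, ∃ g : (Fin m → Fin q) → Fin M, μ.real {x | f x ≠ g (word m x)} < δ := by
  have hM : (0 : ℝ) < M := by exact_mod_cast Nat.pos_of_ne_zero (NeZero.ne M)
  have hdense := Measure.MeasureDense.of_generateFrom_isSetAlgebra_finite μ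
    isSetAlgebra_measurableCylinders
    (generateFrom_measurableCylinders (α := fun _ : ℕ => Fin q)).symm
  have hex : ∀ i : Fin M, ∃ m, ∃ S : Set (Fin m → Fin q),
      μ.real (symmDiff (f ⁻¹' {i}) (word m ⁻¹' S)) < δ / M := by
    intro i
    obtain ⟨t, ht, hlt⟩ := hdense.approx (f ⁻¹' {i}) (hf (measurableSet_singleton i))
      (measure_ne_top _ _) (δ / M) (by positivity)
    obtain ⟨m, S, rfl⟩ := mem_measurableCylinders_iff.1 ht
    exact ⟨m, S, (ENNReal.toReal_lt_of_lt_ofReal hlt)⟩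
  choose m S hS using hex
  set N := Finset.univ.sup m with hN
  have hmN : ∀ i, m i ≤ N := fun i => Finset.le_sup (Finset.mem_univ i)
  let good : (Fin N → Fin q) → Fin M → Prop := fun u i =>
    (fun j : Fin (m i) => u (Fin.castLE (hmN i) j)) ∈ S i
  classical
  let g : (Fin N → Fin q) → Fin M := fun u => if h : ∃ i, good u i then h.choose else 0
  refine ⟨N, g, ?_⟩
  have hsub : {x | f x ≠ g (word N x)} ⊆
      ⋃ i ∈ (Finset.univ : Finset (Fin M)), symmDiff (f ⁻¹' {i}) (word (m i) ⁻¹' (S i)) := by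
    intro x hx
    by_contra hcon
    simp only [Set.mem_iUnion, Finset.mem_univ, exists_const, not_exists] at hcon
    -- Off all the symmetric differences exactly one index is good, so the arbitrary choice made in
    -- `g` must return `f x`.
    have hiff : ∀ i, good (word N x) i ↔ f x = i := by
      intro i
      have h1 := hcon i
      have h2 : good (word N x) i ↔ x ∈ word (m i) ⁻¹' (S i) := Iff.rfl
      have h3 : f x = i ↔ x ∈ f ⁻¹' {i} := Iff.rfl
      rw [Set.mem_symmDiff] at h1
      rw [h2, h3]
      tauto
    have hexi : ∃ i, good (word N x) i := ⟨f x, (hiff _).2 rfl⟩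
    refine hx ?_
    simp only [g, dif_pos hexi]
    exact (hiff _).1 hexi.choose_spec
  have hne : (Finset.univ : Finset (Fin M)).Nonempty := Finset.univ_nonempty
  calc μ.real {x | f x ≠ g (word N x)}
      ≤ μ.real (⋃ i ∈ (Finset.univ : Finset (Fin M)),
          symmDiff (f ⁻¹' {i}) (word (m i) ⁻¹' (S i))) :=
        measureReal_mono hsub (measure_ne_top _ _)
    _ ≤ ∑ i, μ.real (symmDiff (f ⁻¹' {i}) (word (m i) ⁻¹' (S i))) :=
        measureReal_biUnion_finset_le _ _
    _ < ∑ _i : Fin M, δ / M := Finset.sum_lt_sum_of_nonempty hne fun i _ => hS i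
    _ = δ := by simp; field_simp

end Words

/-! ### Entropy of invariant measures of the full shift -/

section ShiftEntropy

variable {q : ℕ} {μ : Measure (Shift q)}

lemma integral_comp_shift_iterate (hμ : MeasurePreserving shift μ μ) (j : ℕ) {F : Shift q → ℝ}
    (hF : Measurable F) : ∫ x, F (shift^[j] x) ∂μ = ∫ x, F x ∂μ := by
  have h := (hμ.iterate j).map_eq
  conv_rhs => rw [← h]
  rw [integral_map (hμ.iterate j).measurable.aemeasurable hF.aestronglyMeasurable]

variable [IsProbabilityMeasure μ]

/-- The entropy of a refined labelling is controlled by the entropy of words and a code. -/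
lemma partitionEntropy_itinerary_le (hμ : MeasurePreserving shift μ μ) {M m : ℕ}
    {f : Shift q → Fin M} (hf : Measurable f) {κ : (Fin m → Fin q) → Fin M → ℝ}
    (hκ : ∀ u i, 0 < κ u i) (hκ1 : ∀ u, ∑ i, κ u i ≤ 1) (n : ℕ) :
    partitionEntropy μ (itinerary shift f n) ≤ partitionEntropy μ (word (q := q) (n + m)) +
      n * ∫ x, -Real.log (κ (word m x) (f x)) ∂μ := by
  have hit : ∀ j, Measurable (shift^[j] : Shift q → Shift q) := fun j => measurable_shift.iterate j
  have hitin : Measurable (itinerary shift f n) :=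
    measurable_pi_lambda _ fun j => hf.comp (hit j)
  let J : Shift q → (Fin n → Fin M) × (Fin (n + m) → Fin q) :=
    fun x => (itinerary shift f n x, word (n + m) x)
  have hJ : Measurable J := hitin.prodMk (measurable_word _)
  let sub : (Fin (n + m) → Fin q) → Fin n → Fin m → Fin q :=
    fun u j i => u ⟨i + j, by omega⟩
  let P : (Fin (n + m) → Fin q) → ℝ := fun u => μ.real (word (n + m) ⁻¹' {u})
  -- Reference weights for the cross entropy: the true law of the word times the code probability of
  -- each label given its window. Length `n + m` ensures that all windows of length `m` starting at
  -- `j < n` are visible.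
  let Q : (Fin n → Fin M) × (Fin (n + m) → Fin q) → ℝ :=
    fun wu => P wu.2 * ∏ j, κ (sub wu.2 j) (wu.1 j)
  have hP : ∀ u, 0 ≤ P u := fun u => measureReal_nonneg
  have hQsum : ∑ wu, Q wu ≤ 1 := by
    rw [Fintype.sum_prod_type_right]
    calc ∑ u, ∑ w : Fin n → Fin M, P u * ∏ j, κ (sub u j) (w j)
        = ∑ u, P u * ∏ j, ∑ i, κ (sub u j) i := by
          refine Finset.sum_congr rfl fun u _ => ?_
          rw [← Finset.mul_sum, Finset.prod_univ_sum, Fintype.piFinset_univ]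
      _ ≤ ∑ u, P u * 1 := by
          refine Finset.sum_le_sum fun u _ => mul_le_mul_of_nonneg_left ?_ (hP u)
          exact Finset.prod_le_one (fun j _ => Finset.sum_nonneg fun i _ => (hκ _ _).le)
            fun j _ => hκ1 _
      _ = 1 := by simpa using sum_measureReal_label (μ := μ) (measurable_word (n + m))
  have hJQ : ∀ wu, Q wu = 0 → μ.real (J ⁻¹' {wu}) = 0 := by
    rintro ⟨w, u⟩ h
    have hu : P u = 0 := (mul_eq_zero.1 h).resolve_right
      (Finset.prod_pos fun j _ => hκ _ _).ne'
    refine le_antisymm (le_trans (measureReal_mono ?_) hu.le) measureReal_nonneg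
    intro x hx
    exact congrArg Prod.snd hx
  have hlog : (fun x => -Real.log (Q (J x))) =ᵐ[μ] fun x => -Real.log (P (word (n + m) x)) +
      ∑ j : Fin n, -Real.log (κ (word m (shift^[j] x)) (f (shift^[j] x))) := by
    filter_upwards [measureReal_label_pos_ae μ (word (n + m))] with x hx
    have hsub : ∀ j : Fin n, sub (word (n + m) x) j = word m (shift^[j] x) := by
      intro j
      funext i
      simp [sub, word, shift_iterate_apply]
    simp only [Q, J, hsub]
    rw [Real.log_mul hx.ne' (Finset.prod_pos fun j _ => hκ _ _).ne',
      Real.log_prod fun j _ => (hκ _ _).ne', neg_add, Finset.sum_neg_distrib]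
    rfl
  have hF : Measurable fun x : Shift q => -Real.log (κ (word m x) (f x)) :=
    (measurable_of_finite fun z : (Fin m → Fin q) × Fin M => -Real.log (κ z.1 z.2)).comp
      ((measurable_word m).prodMk hf)
  have hFint : ∀ j : ℕ,
      Integrable (fun x => -Real.log (κ (word m (shift^[j] x)) (f (shift^[j] x)))) μ := fun j =>
    integrable_comp_label (f := fun x => (word m (shift^[j] x), f (shift^[j] x)))
      (((measurable_word m).comp (hit j)).prodMk (hf.comp (hit j)))
      fun z : (Fin m → Fin q) × Fin M => -Real.log (κ z.1 z.2)
  calc partitionEntropy μ (itinerary shift f n)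
      ≤ partitionEntropy μ J := partitionEntropy_le_of_factor hJ Prod.fst
    _ ≤ ∫ x, -Real.log (Q (J x)) ∂μ := partitionEntropy_le_integral hJ
        (fun wu => mul_nonneg (hP _) (Finset.prod_nonneg fun j _ => (hκ _ _).le)) hJQ hQsum
    _ = _ := by
      rw [integral_congr_ae hlog, integral_add
        (integrable_comp_label (measurable_word _) fun u => -Real.log (P u))
        (integrable_finsetSum _ fun j _ => hFint (j : Fin n)),
        integral_finsetSum _ fun j _ => hFint (j : Fin n),
        partitionEntropy_eq_integral (measurable_word _)]
      simp [integral_comp_shift_iterate hμ _ hF, P]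

/-- The entropy of a block of length `a + b` is at most its cross entropy against the product of the
laws of its two pieces; by invariance that cross entropy is the sum of the two block entropies. -/
lemma subadditive_partitionEntropy_word (hμ : MeasurePreserving shift μ μ) :
    Subadditive fun n => partitionEntropy μ (word (q := q) n) := by
  intro a b
  let Pa : (Fin a → Fin q) → ℝ := fun u => μ.real (word a ⁻¹' {u})
  let Pb : (Fin b → Fin q) → ℝ := fun u => μ.real (word b ⁻¹' {u})
  have hita : Measurable (shift^[a] : Shift q → Shift q) := measurable_shift.iterate a
  have hPb : ∀ u, μ.real ((fun x => word b (shift^[a] x)) ⁻¹' {u}) = Pb u := fun u => by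
    have := (hμ.iterate a).measureReal_preimage
      ((measurable_word b) (measurableSet_singleton u)).nullMeasurableSet
    exact this
  let Q : (Fin (a + b) → Fin q) → ℝ :=
    fun u => Pa (fun i => u (Fin.castAdd b i)) * Pb (fun i => u (Fin.natAdd a i))
  have hwa : ∀ x : Shift q, (fun i => word (a + b) x (Fin.castAdd b i)) = word a x := fun x => rfl
  have hwb : ∀ x : Shift q, (fun i => word (a + b) x (Fin.natAdd a i)) = word b (shift^[a] x) := by
    intro x
    funext i
    simp [word, shift_iterate_apply, add_comm]
  have hQsum : ∑ u, Q u ≤ 1 := by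
    rw [← (Fin.appendEquiv a b).sum_comp, Fintype.sum_prod_type]
    simp only [Q, Fin.appendEquiv, Equiv.coe_fn_mk, Fin.append_left, Fin.append_right]
    rw [← Finset.sum_mul_sum, sum_measureReal_label (measurable_word a),
      sum_measureReal_label (measurable_word b), one_mul]
  have hQ0 : ∀ u, Q u = 0 → μ.real (word (a + b) ⁻¹' {u}) = 0 := by
    intro u hu
    refine le_antisymm ?_ measureReal_nonneg
    rcases mul_eq_zero.1 hu with h | h
    · refine le_trans (measureReal_mono ?_) h.le
      rintro x rfl
      rfl
    · rw [← hPb] at h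
      refine le_trans (measureReal_mono ?_) h.le
      rintro x rfl
      exact (hwb x).symm
  have hlog : (fun x => -Real.log (Q (word (a + b) x))) =ᵐ[μ] fun x =>
      -Real.log (Pa (word a x)) + -Real.log (Pb (word b (shift^[a] x))) := by
    filter_upwards [measureReal_label_pos_ae μ (word a),
      measureReal_label_pos_ae μ fun x => word b (shift^[a] x)] with x hx hy
    rw [hPb] at hy
    simp only [Q, hwa, hwb]
    rw [Real.log_mul hx.ne' hy.ne', neg_add]
  calc partitionEntropy μ (word (q := q) (a + b))
      ≤ ∫ x, -Real.log (Q (word (a + b) x)) ∂μ :=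
        partitionEntropy_le_integral (measurable_word _)
          (fun u => mul_nonneg measureReal_nonneg measureReal_nonneg) hQ0 hQsum
    _ = partitionEntropy μ (word a) + partitionEntropy μ (word b) := by
      have hFb : Measurable fun x : Shift q => -Real.log (Pb (word b x)) :=
        (measurable_of_finite fun z : (Fin b → Fin q) => -Real.log (Pb z)).comp (measurable_word b)
      rw [integral_congr_ae hlog, integral_add
        (integrable_comp_label (measurable_word _) fun u => -Real.log (Pa u))
        (integrable_comp_label (f := fun x => word b (shift^[a] x)) ((measurable_word b).comp hita)
          fun u => -Real.log (Pb u)),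
        integral_comp_shift_iterate hμ a hFb,
        partitionEntropy_eq_integral (measurable_word a),
        partitionEntropy_eq_integral (measurable_word b)]

lemma partitionEntropy_nonneg {X ι : Type*} [MeasurableSpace X] [Fintype ι]
    (μ : Measure X) [IsProbabilityMeasure μ] (f : X → ι) : 0 ≤ partitionEntropy μ f :=
  Finset.sum_nonneg fun _ _ => Real.negMulLog_nonneg measureReal_nonneg measureReal_le_one

end ShiftEntropy

/-! ### Reduction of Kolmogorov–Sinai entropy to block entropies -/

section KSEntropy

variable {q : ℕ} {μ : Measure (Shift q)} [IsProbabilityMeasure μ]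

/-- Every finite labelling can be coded from words at arbitrarily small cost. -/
lemma exists_code (μ : Measure (Shift q)) [IsProbabilityMeasure μ] {M : ℕ} {f : Shift q → Fin M}
    (hf : Measurable f) {ε : ℝ} (hε : 0 < ε) :
    ∃ m, ∃ κ : (Fin m → Fin q) → Fin M → ℝ, (∀ u i, 0 < κ u i) ∧ (∀ u, ∑ i, κ u i ≤ 1) ∧
      ∫ x, -Real.log (κ (word m x) (f x)) ∂μ ≤ ε := by
  obtain ⟨x₀⟩ : Nonempty (Shift q) := nonempty_of_isProbabilityMeasure μ
  have hM0 : 0 < M := (f x₀).pos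
  have : NeZero M := ⟨hM0.ne'⟩
  have hM : (1 : ℝ) ≤ M := by exact_mod_cast hM0
  -- Chosen so that a correct guess costs exactly `-log (1 - e) = ε / 2`. A wrong guess costs `-log
  -- (e / M)`, and the approximation below makes its probability small enough that it adds at most
  -- another `ε / 2`.
  set e : ℝ := 1 - Real.exp (-(ε / 2)) with he
  have hexp : Real.exp (-(ε / 2)) < 1 := by rw [Real.exp_lt_one_iff]; linarith
  have he0 : 0 < e := by linarith
  have he1 : e < 1 := by have := Real.exp_pos (-(ε / 2)); linarith
  have hlog1 : -Real.log (1 - e) = ε / 2 := by rw [he]; simp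
  have heM : e / M < 1 := by
    rw [div_lt_one (by linarith)]
    linarith
  have heM0 : 0 < e / M := by positivity
  have hl : 0 < -Real.log (e / M) := by linarith [Real.log_neg heM0 heM]
  obtain ⟨m, g, hg⟩ := exists_word_approx μ hf (δ := ε / 2 / -Real.log (e / M)) (by positivity)
  classical
  refine ⟨m, fun u i => if i = g u then 1 - e else e / M, ?_, ?_, ?_⟩
  · intro u i
    dsimp only
    split_ifs
    · linarith
    · exact heM0
  · intro u
    calc ∑ i, (if i = g u then 1 - e else e / M)
        ≤ ∑ i, ((if i = g u then 1 - e else 0) + e / M) := by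
          refine Finset.sum_le_sum fun i _ => ?_
          split_ifs <;> linarith
      _ = 1 := by
          rw [Finset.sum_add_distrib]
          simp
          field_simp
          ring
  · have hms : MeasurableSet {x | f x ≠ g (word m x)} :=
      (measurableSet_eq_fun hf ((measurable_of_finite g).comp (measurable_word m))).compl
    have hle : ∀ x, -Real.log (if f x = g (word m x) then 1 - e else e / M) ≤
        ε / 2 + {x | f x ≠ g (word m x)}.indicator (fun _ => -Real.log (e / M)) x := by
      intro x
      by_cases hx : f x = g (word m x)
      · simp [hx, ← hlog1]
      · simp [hx]
        linarith
    calc ∫ x, -Real.log (if f x = g (word m x) then 1 - e else e / M) ∂μ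
        ≤ ∫ x, (ε / 2 + {x | f x ≠ g (word m x)}.indicator (fun _ => -Real.log (e / M)) x) ∂μ := by
          refine integral_mono (integrable_comp_label (f := fun x => (f x, word m x))
            (hf.prodMk (measurable_word m))
            fun z => -Real.log (if z.1 = g z.2 then 1 - e else e / M)) ?_ hle
          exact (integrable_const _).add ((integrable_const _).indicator hms)
      _ = ε / 2 + μ.real {x | f x ≠ g (word m x)} * -Real.log (e / M) := by
          rw [integral_add (integrable_const _) ((integrable_const _).indicator hms),
            integral_indicator_const _ hms]
          simp
      _ ≤ ε / 2 + ε / 2 := by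
          gcongr
          exact ((lt_div_iff₀ hl).1 hg).le
      _ = ε := by ring

/-- Kolmogorov–Sinai entropy of the full shift is bounded by block entropies. -/
lemma ksEntropy_le_div (hμ : MeasurePreserving shift μ μ) {N : ℕ} (hN : N ≠ 0) :
    ksEntropy μ shift ≤ ENNReal.ofReal (partitionEntropy μ (word (q := q) N) / N) := by
  have hsub := subadditive_partitionEntropy_word hμ
  have hbdd : BddBelow (Set.range fun n : ℕ => partitionEntropy μ (word (q := q) n) / n) :=
    ⟨0, by rintro _ ⟨n, rfl⟩; exact div_nonneg (partitionEntropy_nonneg μ _) (Nat.cast_nonneg n)⟩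
  have hL := hsub.lim_le_div hbdd hN
  refine iSup_le fun M => iSup_le fun f => iSup_le fun hf => ?_
  refine le_trans ?_ (ENNReal.ofReal_le_ofReal hL)
  -- The code adds `ε` per symbol and lengthens the word by a fixed `m`, which disappears in the
  -- limit because `(n + m) / n → 1`. Letting `ε → 0` bounds every labelling by the limiting block
  -- entropy per letter.
  have hstep : ∀ ε : ℝ, 0 < ε → entropyRate μ shift f ≤ ENNReal.ofReal (hsub.lim + ε) := by
    intro ε hε
    obtain ⟨m, κ, hκ, hκ1, hc⟩ := exists_code μ hf hε
    have hlim : Tendsto (fun n : ℕ => partitionEntropy μ (word (q := q) (n + m)) / n + ε) atTop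
        (𝓝 (hsub.lim + ε)) := by
      have h1 := (hsub.tendsto_lim hbdd).comp (tendsto_add_atTop_nat m)
      have h2 : Tendsto (fun n : ℕ => ((n + m : ℕ) : ℝ) / n) atTop (𝓝 1) := by
        have : Tendsto (fun n : ℕ => 1 + (m : ℝ) / n) atTop (𝓝 (1 + 0)) :=
          tendsto_const_nhds.add (tendsto_const_div_atTop_nhds_zero_nat _)
        rw [add_zero] at this
        refine this.congr' ?_
        filter_upwards [eventually_ne_atTop 0] with n hn
        have : (n : ℝ) ≠ 0 := by exact_mod_cast hn
        push_cast
        field_simp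
      have h3 := (h1.mul h2).add_const ε
      rw [mul_one] at h3
      refine h3.congr' ?_
      filter_upwards [eventually_ne_atTop 0] with n hn
      have h4 : ((n + m : ℕ) : ℝ) ≠ 0 := by
        have : n + m ≠ 0 := by omega
        exact_mod_cast this
      simp only [Function.comp]
      field_simp
    have hlim' := (ENNReal.continuous_ofReal.tendsto (hsub.lim + ε)).comp hlim
    rw [← hlim'.limsup_eq]
    refine limsup_le_limsup ?_
    filter_upwards [eventually_ne_atTop 0] with n hn
    have hn0 : (0 : ℝ) < n := by exact_mod_cast Nat.pos_of_ne_zero hn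
    refine ENNReal.ofReal_le_ofReal ?_
    have h := partitionEntropy_itinerary_le hμ hf hκ hκ1 n
    rw [div_le_iff₀ hn0, add_mul, div_mul_cancel₀ _ hn0.ne']
    nlinarith
  have htend : Tendsto (fun ε : ℝ => ENNReal.ofReal (hsub.lim + ε)) (𝓝[>] 0)
      (𝓝 (ENNReal.ofReal hsub.lim)) := by
    have : Tendsto (fun ε : ℝ => hsub.lim + ε) (𝓝[>] 0) (𝓝 (hsub.lim + 0)) :=
      (tendsto_const_nhds.add tendsto_id).mono_left nhdsWithin_le_nhds
    rw [add_zero] at this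
    exact (ENNReal.continuous_ofReal.tendsto _).comp this
  exact ge_of_tendsto htend (eventually_nhdsWithin_of_forall hstep)

end KSEntropy

/-! ### Bernoulli measures -/

section Bernoulli

variable {q : ℕ} {p : Fin q → ℝ}

/-- The measure on letters with weights `p`. -/
def letterMeasure (p : Fin q → ℝ) : Measure (Fin q) :=
  ∑ i, ENNReal.ofReal (p i) • Measure.dirac i

lemma letterMeasure_singleton (p : Fin q → ℝ) (i : Fin q) :
    letterMeasure p {i} = ENNReal.ofReal (p i) := by
  rw [letterMeasure, Measure.finsetSum_apply]
  rw [Finset.sum_eq_single i]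
  · simp
  · intro j _ hj
    simp [hj]
  · simp

lemma isProbabilityMeasure_letterMeasure (hp : ∀ i, 0 ≤ p i) (hp1 : ∑ i, p i = 1) :
    IsProbabilityMeasure (letterMeasure p) := by
  constructor
  rw [letterMeasure, Measure.finsetSum_apply]
  simp only [Measure.smul_apply, measure_univ, smul_eq_mul, mul_one]
  rw [← ENNReal.ofReal_sum_of_nonneg fun i _ => hp i, hp1, ENNReal.ofReal_one]

/-- The Bernoulli measure on the full shift with letter weights `p`. -/
def bernoulli (p : Fin q → ℝ) : Measure (Shift q) :=
  Measure.infinitePi fun _ : ℕ => letterMeasure p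

lemma isProbabilityMeasure_bernoulli (hp : ∀ i, 0 ≤ p i) (hp1 : ∑ i, p i = 1) :
    IsProbabilityMeasure (bernoulli p) := by
  have := isProbabilityMeasure_letterMeasure hp hp1
  unfold bernoulli
  infer_instance

lemma bernoulli_word (hp : ∀ i, 0 ≤ p i) (hp1 : ∑ i, p i = 1) (m : ℕ) (u : Fin m → Fin q) :
    bernoulli p (word m ⁻¹' {u}) = ENNReal.ofReal (∏ i, p (u i)) := by
  have := isProbabilityMeasure_letterMeasure hp hp1
  have hset : word m ⁻¹' {u} =
      Set.pi (Finset.range m : Set ℕ) fun j => if h : j < m then {u ⟨j, h⟩} else Set.univ := by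
    ext x
    simp only [Set.mem_preimage, Set.mem_singleton_iff, Set.mem_pi, Finset.coe_range, Set.mem_Iio]
    constructor
    · rintro rfl j hj
      simp [hj, word]
    · intro h
      funext i
      have := h i i.2
      simpa [word] using this
  rw [hset, bernoulli, Measure.infinitePi_pi _ fun j _ => Set.toFinite _ |>.measurableSet,
    ENNReal.ofReal_prod_of_nonneg fun i _ => hp _, Finset.prod_range]
  refine Finset.prod_congr rfl fun i _ => ?_
  simp [letterMeasure_singleton]

lemma measurePreserving_shift_bernoulli (hp : ∀ i, 0 ≤ p i) (hp1 : ∑ i, p i = 1) :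
    MeasurePreserving shift (bernoulli p) (bernoulli p) := by
  have := isProbabilityMeasure_letterMeasure hp hp1
  refine ⟨measurable_shift, ?_⟩
  refine Measure.eq_infinitePi _ fun s t ht => ?_
  rw [Measure.map_apply measurable_shift (MeasurableSet.pi s.countable_toSet fun i _ => ht i)]
  have hset : shift ⁻¹' Set.pi (s : Set ℕ) t =
      Set.pi (s.map ⟨Nat.succ, Nat.succ_injective⟩ : Finset ℕ) fun j => t (j - 1) := by
    ext x
    simp [shift]
  rw [hset, bernoulli, Measure.infinitePi_pi _ fun j _ => ht _, Finset.prod_map]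
  simp

lemma uniformBernoulli_eq (hq : 0 < q) :
    uniformBernoulli q = bernoulli fun _ : Fin q => 1 / (q : ℝ) := by
  rw [uniformBernoulli, bernoulli]
  congr 1
  funext _
  refine Measure.ext_of_singleton fun i => ?_
  rw [letterMeasure_singleton, ProbabilityTheory.uniformOn_univ]
  simp [ENNReal.ofReal_inv_of_pos (show (0 : ℝ) < q by exact_mod_cast hq)]

end Bernoulli

/-! ### Equilibrium states -/

section Equilibrium

variable {q : ℕ}

lemma integral_log_prod_word {μ : Measure (Shift q)} [IsProbabilityMeasure μ]
    (hμ : MeasurePreserving shift μ μ) {p : Fin q → ℝ} (hp : ∀ i, 0 < p i) (n : ℕ) :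
    ∫ x, -Real.log (∏ i, p (word n x i)) ∂μ = n * ∫ x, -Real.log (p (x 0)) ∂μ := by
  have hF : Measurable fun x : Shift q => -Real.log (p (x 0)) :=
    (measurable_of_finite fun a => -Real.log (p a)).comp (measurable_pi_apply 0)
  have hpt : ∀ x : Shift q, -Real.log (∏ i, p (word n x i)) =
      ∑ i : Fin n, -Real.log (p (shift^[i] x 0)) := by
    intro x
    rw [Real.log_prod fun i _ => (hp _).ne', Finset.sum_neg_distrib]
    simp [word, shift_iterate_apply]
  simp_rw [hpt]
  rw [integral_finsetSum]
  · simp [fun i => integral_comp_shift_iterate hμ i hF]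
  · intro i _
    refine integrable_comp_label (f := fun x : Shift q => shift^[(i : ℕ)] x 0) ?_
      fun a => -Real.log (p a)
    exact (measurable_pi_apply 0).comp (measurable_shift.iterate _)

/-- The letter weights of the equilibrium state of `b · 1_{[θ^k]}`. -/
def gibbsWeight (k : Fin q) (b : ℝ) : Fin q → ℝ :=
  fun i => (if i = k then Real.exp b else 1) / (Real.exp b + q - 1)

lemma gibbsWeight_denom_pos (k : Fin q) (b : ℝ) : 0 < Real.exp b + q - 1 := by
  have h1 : (1 : ℝ) ≤ q := by exact_mod_cast k.pos
  linarith [Real.exp_pos b]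

lemma gibbsWeight_pos (k : Fin q) (b : ℝ) (i : Fin q) : 0 < gibbsWeight k b i := by
  refine div_pos ?_ (gibbsWeight_denom_pos k b)
  split_ifs <;> positivity

lemma sum_gibbsWeight (k : Fin q) (b : ℝ) : ∑ i, gibbsWeight k b i = 1 := by
  have h : ∑ i : Fin q, (if i = k then Real.exp b else 1) = Real.exp b + q - 1 := by
    have h1 : ∀ i : Fin q, (if i = k then Real.exp b else 1) =
        (if i = k then Real.exp b - 1 else 0) + 1 := by
      intro i; split_ifs <;> ring
    simp_rw [h1]
    rw [Finset.sum_add_distrib]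
    simp
    ring
  simp_rw [gibbsWeight]
  rw [← Finset.sum_div, h, div_self (gibbsWeight_denom_pos k b).ne']

/-- The reason for this choice of weights: the potential is their logarithm plus a constant, and
that constant turns out to be the pressure. -/
lemma neg_log_gibbsWeight (k : Fin q) (b : ℝ) (x : Shift q) :
    -Real.log (gibbsWeight k b (x 0)) = Real.log (Real.exp b + q - 1) - potential k b x := by
  rw [gibbsWeight, Real.log_div _ (gibbsWeight_denom_pos k b).ne', potential]
  · split_ifs <;> simp
  · split_ifs <;> positivity

lemma integrable_potential (μ : Measure (Shift q)) [IsProbabilityMeasure μ] (k : Fin q) (b : ℝ) :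
    Integrable (potential k b) μ :=
  integrable_comp_label (f := fun x : Shift q => x 0) (measurable_pi_apply 0)
    fun a => if a = k then b else 0

lemma integral_neg_log_gibbsWeight (μ : Measure (Shift q)) [IsProbabilityMeasure μ] (k : Fin q)
    (b : ℝ) : ∫ x, -Real.log (gibbsWeight k b (x 0)) ∂μ =
      Real.log (Real.exp b + q - 1) - ∫ x, potential k b x ∂μ := by
  simp_rw [neg_log_gibbsWeight]
  rw [integral_sub (integrable_const _) (integrable_potential μ k b)]
  simp

lemma sum_prod_word (p : Fin q → ℝ) (hp1 : ∑ i, p i = 1) (n : ℕ) :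
    ∑ u : Fin n → Fin q, ∏ i, p (u i) = 1 := by
  have := (Finset.prod_univ_sum (fun _ : Fin n => (Finset.univ : Finset (Fin q)))
    fun _ a => p a).symm
  rw [Fintype.piFinset_univ] at this
  rw [this]
  simp [hp1]

/-- Cross entropy against the product weights; by invariance its value is `n` times a one-letter
integral. -/
lemma partitionEntropy_word_le {μ : Measure (Shift q)} [IsProbabilityMeasure μ]
    (hμ : MeasurePreserving shift μ μ) (k : Fin q) (b : ℝ) (n : ℕ) :
    partitionEntropy μ (word (q := q) n) ≤
      n * (Real.log (Real.exp b + q - 1) - ∫ x, potential k b x ∂μ) := by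
  rw [← integral_neg_log_gibbsWeight, ← integral_log_prod_word hμ (gibbsWeight_pos k b)]
  exact partitionEntropy_le_integral (Q := fun u => ∏ i, gibbsWeight k b (u i)) (measurable_word n)
    (fun u => Finset.prod_nonneg fun i _ => (gibbsWeight_pos k b _).le)
    (fun u h => absurd h (Finset.prod_pos fun i _ => gibbsWeight_pos k b _).ne')
    (sum_prod_word _ (sum_gibbsWeight k b) n).le

lemma freeEnergy_le_of_ksEntropy_le {X : Type*} [MeasurableSpace X] {T : X → X} {ψ : X → ℝ}
    {μ : Measure X} {c : ℝ} (hc : 0 ≤ c) (h : ksEntropy μ T ≤ ENNReal.ofReal c) :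
    freeEnergy T ψ μ ≤ ((c + ∫ x, ψ x ∂μ : ℝ) : EReal) := by
  rw [freeEnergy, EReal.coe_add]
  refine add_le_add_left ?_ _
  have h2 := EReal.coe_ennreal_le_coe_ennreal_iff.2 h
  rwa [EReal.coe_ennreal_ofReal, max_eq_left hc] at h2

lemma freeEnergy_le {μ : Measure (Shift q)} (hμ : IsInvariantProb shift μ) (k : Fin q) (b : ℝ) :
    freeEnergy shift (potential k b) μ ≤ (Real.log (Real.exp b + q - 1) : ℝ) := by
  have := hμ.1
  have h1 := ksEntropy_le_div hμ.2 one_ne_zero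
  have h2 := partitionEntropy_word_le hμ.2 k b 1
  have h3 := partitionEntropy_nonneg μ (word (q := q) 1)
  have h := freeEnergy_le_of_ksEntropy_le (ψ := potential k b) (by positivity) h1
  refine h.trans (EReal.coe_le_coe_iff.2 ?_)
  simp only [Nat.cast_one, div_one, one_mul] at h2 ⊢
  linarith

lemma isInvariantProb_bernoulli {p : Fin q → ℝ} (hp : ∀ i, 0 ≤ p i) (hp1 : ∑ i, p i = 1) :
    IsInvariantProb shift (bernoulli p) :=
  ⟨isProbabilityMeasure_bernoulli hp hp1, measurePreserving_shift_bernoulli hp hp1⟩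

lemma isInvariantProb_bernoulli_gibbsWeight (k : Fin q) (b : ℝ) :
    IsInvariantProb shift (bernoulli (gibbsWeight k b)) :=
  isInvariantProb_bernoulli (fun i => (gibbsWeight_pos k b i).le) (sum_gibbsWeight k b)

/-- For the Bernoulli measure the cross entropy bound is an equality at every block length, and the
time-zero labelling already realizes this rate as a lower bound for the Kolmogorov–Sinai entropy. -/
lemma freeEnergy_bernoulli (k : Fin q) (b : ℝ) :
    freeEnergy shift (potential k b) (bernoulli (gibbsWeight k b)) =
      (Real.log (Real.exp b + q - 1) : ℝ) := by
  have hinv := isInvariantProb_bernoulli_gibbsWeight k b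
  have := hinv.1
  refine le_antisymm (freeEnergy_le hinv k b) ?_
  set μ := bernoulli (gibbsWeight k b) with hμdef
  set h := Real.log (Real.exp b + q - 1) - ∫ x, potential k b x ∂μ with hh
  have hw : ∀ n u, μ.real (word n ⁻¹' {u}) = ∏ i, gibbsWeight k b (u i) := by
    intro n u
    rw [measureReal_def, hμdef, bernoulli_word (fun i => (gibbsWeight_pos k b i).le)
      (sum_gibbsWeight k b), ENNReal.toReal_ofReal]
    exact Finset.prod_nonneg fun i _ => (gibbsWeight_pos k b _).le
  have hH : ∀ n, partitionEntropy μ (word (q := q) n) = n * h := by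
    intro n
    rw [partitionEntropy_eq_integral (measurable_word n), hh, ← integral_neg_log_gibbsWeight,
      ← integral_log_prod_word hinv.2 (gibbsWeight_pos k b)]
    simp_rw [hw]
  have hrate : entropyRate μ shift (fun x : Shift q => x 0) = ENNReal.ofReal h := by
    rw [entropyRate]
    refine Tendsto.limsup_eq (tendsto_const_nhds.congr' ?_)
    filter_upwards [eventually_ne_atTop 0] with n hn
    have hn0 : (n : ℝ) ≠ 0 := by exact_mod_cast hn
    rw [itinerary_eval_zero, hH, mul_div_cancel_left₀ _ hn0]
  have hks : ENNReal.ofReal h ≤ ksEntropy μ shift := by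
    rw [← hrate]
    exact le_iSup_of_le q (le_iSup_of_le (fun x : Shift q => x 0)
      (le_iSup_of_le (measurable_pi_apply 0) le_rfl))
  have h0 : 0 ≤ h := by
    have := partitionEntropy_nonneg μ (word (q := q) 1)
    rw [hH] at this
    simpa using this
  have h2 := EReal.coe_ennreal_le_coe_ennreal_iff.2 hks
  rw [EReal.coe_ennreal_ofReal, max_eq_left h0] at h2
  calc ((Real.log (Real.exp b + q - 1) : ℝ) : EReal)
      = (h : EReal) + ((∫ x, potential k b x ∂μ : ℝ) : EReal) := by
        rw [← EReal.coe_add, hh, sub_add_cancel]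
    _ ≤ _ := add_le_add_left h2 _

lemma pressure_potential (k : Fin q) (b : ℝ) :
    pressure shift (potential k b) = (Real.log (Real.exp b + q - 1) : ℝ) := by
  refine le_antisymm (iSup_le fun μ => iSup_le fun hμ => freeEnergy_le hμ k b) ?_
  rw [← freeEnergy_bernoulli k b]
  exact le_iSup_of_le _ (le_iSup_of_le (isInvariantProb_bernoulli_gibbsWeight k b) le_rfl)

/-- The unique equilibrium state of `b · 1_{[θ^k]}` is a Bernoulli measure. -/
theorem isDynamicalGibbs_bernoulli (k : Fin q) (b : ℝ) :
    IsDynamicalGibbs shift (potential k b) (bernoulli (gibbsWeight k b)) := by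
  refine ⟨⟨isInvariantProb_bernoulli_gibbsWeight k b, ?_⟩, ?_⟩
  · rw [freeEnergy_bernoulli, pressure_potential]
  rintro ν ⟨hν, hfree⟩
  have := hν.1
  have := (isInvariantProb_bernoulli_gibbsWeight k b).1
  rw [pressure_potential] at hfree
  refine ext_of_word fun n u => ?_
  have hprod : ∀ u : Fin n → Fin q, 0 < ∏ i, gibbsWeight k b (u i) := fun u =>
    Finset.prod_pos fun i _ => gibbsWeight_pos k b _
  rw [bernoulli_word (fun i => (gibbsWeight_pos k b i).le) (sum_gibbsWeight k b)]
  rcases Nat.eq_zero_or_pos n with rfl | hn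
  · have : word 0 ⁻¹' {u} = (Set.univ : Set (Shift q)) := by
      ext x
      simpa using Subsingleton.elim _ _
    simp [this]
  have hn0 : (0 : ℝ) < n := by exact_mod_cast hn
  have hle := freeEnergy_le_of_ksEntropy_le (ψ := potential k b)
    (div_nonneg (partitionEntropy_nonneg ν (word (q := q) n)) hn0.le)
    (ksEntropy_le_div hν.2 hn.ne')
  rw [hfree, EReal.coe_le_coe_iff] at hle
  -- Attaining the pressure reverses the block entropy bound at each length `n`, so the equality
  -- case of the Gibbs inequality identifies the law of words of length `n`.
  have hge : n * (Real.log (Real.exp b + q - 1) - ∫ x, potential k b x ∂ν) ≤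
      partitionEntropy ν (word (q := q) n) := by
    rw [mul_comm, ← le_div_iff₀ hn0]
    linarith
  rw [← integral_neg_log_gibbsWeight, ← integral_log_prod_word hν.2 (gibbsWeight_pos k b),
    integral_comp_label (f := word n)
      (c := fun u => -Real.log (∏ i, gibbsWeight k b (u i))) (measurable_word n)] at hge
  have heq := eq_of_sum_negMulLog_ge (p := fun u => ν.real (word n ⁻¹' {u}))
    (fun _ => measureReal_nonneg) hprod
    ((sum_prod_word _ (sum_gibbsWeight k b) n).le.trans_eq
      (sum_measureReal_label (measurable_word n)).symm) hge
  rw [← congrFun heq u, measureReal_def, ENNReal.ofReal_toReal (measure_ne_top _ _)]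

end Equilibrium

/-! ### The mean-field energy -/

section MeanField

open Asymptotics

variable {q : ℕ} {β : ℝ} {y : Fin q → ℝ}

/-- The function `∑ᵢ e^{β yᵢ}`. -/
def expSum (β : ℝ) (y : Fin q → ℝ) : ℝ := ∑ i, Real.exp (β * y i)

/-- The mean-field energy `β|y|²/2 - log ∑ᵢ e^{β yᵢ}`. -/
def mfEnergy (β : ℝ) (y : Fin q → ℝ) : ℝ := β / 2 * ∑ i, y i ^ 2 - Real.log (expSum β y)

/-- Global minimizers of the mean-field energy. -/
def IsMinimizer (β : ℝ) (y : Fin q → ℝ) : Prop := ∀ z : Fin q → ℝ, mfEnergy β y ≤ mfEnergy β z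

/-- The softmax weights `e^{β yᵢ} / ∑ⱼ e^{β yⱼ}`. -/
def softmax (β : ℝ) (y : Fin q → ℝ) (i : Fin q) : ℝ := Real.exp (β * y i) / expSum β y

lemma expSum_pos [NeZero q] (β : ℝ) (y : Fin q → ℝ) : 0 < expSum β y :=
  Finset.sum_pos (fun _ _ => Real.exp_pos _) Finset.univ_nonempty

lemma softmax_pos [NeZero q] (β : ℝ) (y : Fin q → ℝ) (i : Fin q) : 0 < softmax β y i :=
  div_pos (Real.exp_pos _) (expSum_pos β y)

lemma sum_softmax [NeZero q] (β : ℝ) (y : Fin q → ℝ) : ∑ i, softmax β y i = 1 := by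
  simp_rw [softmax]
  rw [← Finset.sum_div]
  exact div_self (expSum_pos β y).ne'

lemma log_softmax [NeZero q] (β : ℝ) (y : Fin q → ℝ) (i : Fin q) :
    Real.log (softmax β y i) = β * y i - Real.log (expSum β y) := by
  rw [softmax, Real.log_div (Real.exp_pos _).ne' (expSum_pos β y).ne', Real.log_exp]

lemma continuous_expSum (β : ℝ) : Continuous (expSum (q := q) β) := by
  unfold expSum
  fun_prop

lemma continuous_softmax [NeZero q] (β : ℝ) (i : Fin q) :
    Continuous fun y : Fin q → ℝ => softmax β y i :=
  Continuous.div (by fun_prop) (continuous_expSum β) fun y => (expSum_pos β y).ne'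

lemma continuous_mfEnergy [NeZero q] (β : ℝ) : Continuous (mfEnergy (q := q) β) := by
  unfold mfEnergy
  exact (by fun_prop : Continuous fun y : Fin q → ℝ => β / 2 * ∑ i, y i ^ 2).sub
    ((continuous_expSum β).log fun y => (expSum_pos β y).ne')

lemma norm_sq_le_sum_sq (y : Fin q → ℝ) : ‖y‖ ^ 2 ≤ ∑ i, y i ^ 2 := by
  have h : ‖y‖ ≤ √(∑ i, y i ^ 2) := by
    refine (pi_norm_le_iff_of_nonneg (Real.sqrt_nonneg _)).2 fun i => ?_
    refine Real.le_sqrt_of_sq_le ?_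
    rw [Real.norm_eq_abs, sq_abs]
    exact Finset.single_le_sum (f := fun i => y i ^ 2) (fun i _ => sq_nonneg _) (Finset.mem_univ i)
  calc ‖y‖ ^ 2 ≤ √(∑ i, y i ^ 2) ^ 2 := by gcongr
    _ = _ := Real.sq_sqrt (Finset.sum_nonneg fun i _ => sq_nonneg _)

/-- The logarithm of the exponential sum grows at most linearly, and `‖y‖ ≤ ‖y‖² / 4 + 1` lets half
of the quadratic term absorb it. This yields both coercivity and integrability of `exp (-t G)`. -/
lemma mfEnergy_ge [NeZero q] (hβ : 0 ≤ β) (y : Fin q → ℝ) :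
    β / 4 * ∑ i, y i ^ 2 - β - Real.log q ≤ mfEnergy β y := by
  have hq : (0 : ℝ) < q := by exact_mod_cast Nat.pos_of_ne_zero (NeZero.ne q)
  have h1 : expSum β y ≤ q * Real.exp (β * ‖y‖) := by
    calc expSum β y ≤ ∑ _i : Fin q, Real.exp (β * ‖y‖) := by
          refine Finset.sum_le_sum fun i _ => Real.exp_le_exp.2 ?_
          exact mul_le_mul_of_nonneg_left ((le_abs_self _).trans (norm_le_pi_norm y i)) hβ
      _ = _ := by simp
  have h2 : Real.log (expSum β y) ≤ Real.log q + β * ‖y‖ := by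
    calc Real.log (expSum β y) ≤ Real.log (q * Real.exp (β * ‖y‖)) :=
          Real.log_le_log (expSum_pos β y) h1
      _ = _ := by rw [Real.log_mul hq.ne' (Real.exp_pos _).ne', Real.log_exp]
  have h3 := norm_sq_le_sum_sq y
  have h4 : β * ‖y‖ ≤ β / 4 * ∑ i, y i ^ 2 + β := by
    nlinarith [mul_nonneg hβ (sq_nonneg (‖y‖ / 2 - 1)), mul_le_mul_of_nonneg_left h3 hβ]
  rw [mfEnergy]
  linarith

lemma tendsto_mfEnergy_cocompact [NeZero q] (hβ : 0 < β) :
    Tendsto (mfEnergy (q := q) β) (cocompact _) atTop := by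
  have h1 : Tendsto (fun y : Fin q → ℝ => β / 4 * ‖y‖ ^ 2 + (-β - Real.log q)) (cocompact _)
      atTop := by
    refine tendsto_atTop_add_const_right _ _ (Tendsto.const_mul_atTop (by positivity) ?_)
    exact (tendsto_pow_atTop two_ne_zero).comp (tendsto_norm_cocompact_atTop)
  refine tendsto_atTop_mono (fun y => ?_) h1
  have := mfEnergy_ge hβ.le y
  have := mul_le_mul_of_nonneg_left (norm_sq_le_sum_sq y) (by positivity : 0 ≤ β / 4)
  linarith

lemma exists_minimizer [NeZero q] (hβ : 0 < β) :
    ∃ y : Fin q → ℝ, IsMinimizer β y :=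
  (continuous_mfEnergy β).exists_forall_le (tendsto_mfEnergy_cocompact hβ)

lemma hasDerivAt_mfEnergy_line [NeZero q] (β : ℝ) (y z : Fin q → ℝ) :
    HasDerivAt (fun t : ℝ => mfEnergy β (y + t • z)) (β * ∑ i, (y i - softmax β y i) * z i) 0 := by
  have hlin : ∀ i, HasDerivAt (fun t : ℝ => y i + t * z i) (z i) 0 := fun i => by
    simpa using ((hasDerivAt_id (0 : ℝ)).mul_const (z i)).const_add (y i)
  have h1 : HasDerivAt (fun t : ℝ => ∑ i, (y i + t * z i) ^ 2) (∑ i, 2 * y i * z i) 0 := by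
    refine HasDerivAt.fun_sum fun i _ => ?_
    simpa using (hlin i).fun_pow 2
  have h2 : HasDerivAt (fun t : ℝ => ∑ i, Real.exp (β * (y i + t * z i)))
      (∑ i, Real.exp (β * y i) * (β * z i)) 0 := by
    refine HasDerivAt.fun_sum fun i _ => ?_
    simpa using ((hlin i).const_mul β).exp
  have h3 := (h1.const_mul (β / 2)).sub (h2.log (by
    simpa [expSum] using (expSum_pos β y).ne'))
  have heq : β / 2 * ∑ i, 2 * y i * z i - (∑ i, Real.exp (β * y i) * (β * z i)) /
      (∑ i, Real.exp (β * (y i + 0 * z i))) = β * ∑ i, (y i - softmax β y i) * z i := by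
    simp only [zero_mul, add_zero, softmax, expSum]
    rw [Finset.mul_sum, Finset.mul_sum, Finset.sum_div, ← Finset.sum_sub_distrib]
    refine Finset.sum_congr rfl fun i _ => ?_
    ring
  rw [heq] at h3
  exact h3

lemma eq_softmax_of_minimizer [NeZero q] (hβ : 0 < β) (hy : IsMinimizer β y)
    (i : Fin q) : softmax β y i = y i := by
  have h := hasDerivAt_mfEnergy_line β y (Pi.single i 1)
  have hmin : IsLocalMin (fun t : ℝ => mfEnergy β (y + t • (Pi.single i 1 : Fin q → ℝ))) 0 :=
    Eventually.of_forall fun t => by simpa using hy _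
  have h0 := hmin.hasDerivAt_eq_zero h
  simp only [Pi.single_apply, mul_ite, mul_one, mul_zero, Finset.sum_ite_eq', Finset.mem_univ,
    if_true] at h0
  have := (mul_eq_zero.1 h0).resolve_left hβ.ne'
  linarith

/-- The Hessian matrix of the mean-field energy at a critical point. -/
def hessian (β : ℝ) (p : Fin q → ℝ) : Matrix (Fin q) (Fin q) ℝ :=
  Matrix.diagonal (fun i => β - β ^ 2 * p i) + Matrix.vecMulVec (fun i => β ^ 2 * p i) p

open Matrix in
-- When `p` sums to one, the bracket is the variance of `z` under `p`, that is, the second order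
-- term of a cumulant generating function.
lemma dotProduct_hessian_mulVec (β : ℝ) (p z : Fin q → ℝ) :
    z ⬝ᵥ (hessian β p *ᵥ z) =
      β * ∑ i, z i ^ 2 - β ^ 2 * (∑ i, p i * z i ^ 2 - (∑ i, p i * z i) ^ 2) := by
  rw [hessian, Matrix.add_mulVec, dotProduct_add, Matrix.vecMulVec_mulVec]
  simp only [dotProduct, mulVec_diagonal, Pi.smul_apply, MulOpposite.smul_eq_mul_unop,
    MulOpposite.unop_op]
  have h1 : ∑ i, z i * ((β - β ^ 2 * p i) * z i) =
      β * ∑ i, z i ^ 2 - β ^ 2 * ∑ i, p i * z i ^ 2 := by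
    rw [Finset.mul_sum, Finset.mul_sum, ← Finset.sum_sub_distrib]
    exact Finset.sum_congr rfl fun i _ => by ring
  have h2 : ∑ i, z i * (β ^ 2 * p i * ∑ j, p j * z j) = β ^ 2 * (∑ i, p i * z i) ^ 2 := by
    rw [sq (∑ i, p i * z i), Finset.sum_mul, Finset.mul_sum]
    exact Finset.sum_congr rfl fun i _ => by ring
  rw [h1, h2]
  ring

lemma exp_sub_quadratic_isLittleO :
    (fun x : ℝ => Real.exp x - 1 - x - x ^ 2 / 2) =o[𝓝 0] fun x => x ^ 2 := by
  have h := Real.exp_sub_sum_range_succ_isLittleO_pow 2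
  refine h.congr_left fun x => ?_
  simp [Finset.sum_range_succ]
  ring

lemma log_one_add_sub_quadratic_isLittleO :
    (fun x : ℝ => Real.log (1 + x) - x + x ^ 2 / 2) =o[𝓝 0] fun x => x ^ 2 := by
  have hO : (fun x : ℝ => Real.log (1 + x) - x + x ^ 2 / 2) =O[𝓝 0] fun x => x ^ 3 := by
    refine IsBigO.of_bound 2 ?_
    have hev : ∀ᶠ x : ℝ in 𝓝 0, |x| < 1 / 2 := by
      have := Metric.ball_mem_nhds (0 : ℝ) (by norm_num : (0 : ℝ) < 1 / 2)
      filter_upwards [this] with x hx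
      simpa using hx
    filter_upwards [hev] with x hx
    have h := Real.abs_log_sub_add_sum_range_le (x := -x) (by rw [abs_neg]; linarith) 2
    simp only [Finset.sum_range_succ, Finset.sum_range_zero, abs_neg, sub_neg_eq_add] at h
    have he : Real.log (1 + x) - x + x ^ 2 / 2 =
        0 + (-x) ^ (0 + 1) / ((0 : ℕ) + 1) + (-x) ^ (1 + 1) / ((1 : ℕ) + 1) + Real.log (1 + x) := by
      push_cast
      ring
    rw [Real.norm_eq_abs, he]
    refine h.trans ?_
    rw [Real.norm_eq_abs, abs_pow, div_le_iff₀ (by linarith)]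
    have := mul_nonneg (pow_nonneg (abs_nonneg x) 3) (by linarith : 0 ≤ 1 - 2 * |x|)
    norm_num
    linarith
  refine hO.trans_isLittleO ?_
  exact isLittleO_pow_pow (by norm_num)

lemma eval_isBigO (i : Fin q) : (fun z : Fin q → ℝ => z i) =O[𝓝 0] fun z => z :=
  IsBigO.of_bound 1 (Eventually.of_forall fun z => by simpa using norm_le_pi_norm z i)

/-- Second order expansion of the cumulant generating function of `p`. -/
lemma log_sum_mul_exp_isLittleO (β : ℝ) {p : Fin q → ℝ} (hp1 : ∑ i, p i = 1) :
    (fun z : Fin q → ℝ => Real.log (∑ i, p i * Real.exp (β * z i)) - β * ∑ i, p i * z i -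
      β ^ 2 / 2 * (∑ i, p i * z i ^ 2 - (∑ i, p i * z i) ^ 2)) =o[𝓝 0] fun z => ‖z‖ ^ 2 := by
  set v : (Fin q → ℝ) → ℝ := fun z => β * ∑ i, p i * z i with hv
  set w : (Fin q → ℝ) → ℝ := fun z => β ^ 2 / 2 * ∑ i, p i * z i ^ 2 with hw
  set u : (Fin q → ℝ) → ℝ := fun z => ∑ i, p i * (Real.exp (β * z i) - 1) with hu
  have hzi : ∀ i, (fun z : Fin q → ℝ => β * z i) =O[𝓝 0] fun z => ‖z‖ := fun i =>
    ((eval_isBigO i).norm_right).const_mul_left β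
  have hcont : ∀ i, Tendsto (fun z : Fin q → ℝ => β * z i) (𝓝 0) (𝓝 0) := fun i => by
    have : Continuous fun z : Fin q → ℝ => β * z i := by fun_prop
    simpa using this.tendsto 0
  have h1 : (fun z => u z - v z - w z) =o[𝓝 0] fun z => ‖z‖ ^ 2 := by
    have : (fun z => u z - v z - w z) = fun z : Fin q → ℝ =>
        ∑ i, p i * (Real.exp (β * z i) - 1 - β * z i - (β * z i) ^ 2 / 2) := by
      funext z
      simp only [hu, hv, hw]
      rw [Finset.mul_sum, Finset.mul_sum, ← Finset.sum_sub_distrib, ← Finset.sum_sub_distrib]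
      exact Finset.sum_congr rfl fun i _ => by ring
    rw [this]
    refine IsLittleO.fun_sum fun i _ => IsLittleO.const_mul_left ?_ _
    exact (exp_sub_quadratic_isLittleO.comp_tendsto (hcont i)).trans_isBigO ((hzi i).pow 2)
  have hvO : v =O[𝓝 0] fun z => ‖z‖ :=
    (IsBigO.fun_sum fun i _ => (((eval_isBigO i).norm_right).const_mul_left (p i))).const_mul_left β
  have hwO : w =O[𝓝 0] fun z => ‖z‖ ^ 2 :=
    (IsBigO.fun_sum fun i _ => (((eval_isBigO i).norm_right.pow 2).const_mul_left (p i))).const_mul_left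
      _
  have hsq : (fun z : Fin q → ℝ => ‖z‖ ^ 2) =o[𝓝 0] fun z => ‖z‖ := by
    have : Tendsto (fun z : Fin q → ℝ => ‖z‖) (𝓝 0) (𝓝 0) := by
      simpa using (continuous_norm.tendsto (0 : Fin q → ℝ))
    exact (isLittleO_pow_id (𝕜 := ℝ) (one_lt_two)).comp_tendsto this
  have huvO : (fun z => u z - v z) =O[𝓝 0] fun z => ‖z‖ ^ 2 := by
    have := h1.isBigO.add hwO
    refine this.congr_left fun z => by ring
  have huO : u =O[𝓝 0] fun z => ‖z‖ := by
    have := (huvO.trans hsq.isBigO).add hvO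
    refine this.congr_left fun z => by ring
  -- Factor as `(u - v) (u + v)`: the first factor is of second order, the second of first order.
  -- Hence `u²` may be replaced by the square of its linear part.
  have h2 : (fun z => u z ^ 2 - v z ^ 2) =o[𝓝 0] fun z => ‖z‖ ^ 2 := by
    have := (huvO.trans_isLittleO hsq).mul_isBigO (huO.add hvO)
    refine this.congr (fun z => by ring) fun z => by ring
  have hu0 : Tendsto u (𝓝 0) (𝓝 0) := by
    have : Continuous u := by simp only [hu]; fun_prop
    simpa [hu] using this.tendsto 0
  have h3 : (fun z => Real.log (1 + u z) - u z + u z ^ 2 / 2) =o[𝓝 0] fun z => ‖z‖ ^ 2 :=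
    (log_one_add_sub_quadratic_isLittleO.comp_tendsto hu0).trans_isBigO (huO.pow 2)
  have h4 := (h3.add h1).sub (h2.const_mul_left (1 / 2))
  refine h4.congr_left fun z => ?_
  have h5 : ∑ i, p i * Real.exp (β * z i) = 1 + u z := by
    simp only [hu, mul_sub, Finset.sum_sub_distrib, mul_one, hp1]
    ring
  rw [h5]
  simp only [hv, hw]
  ring

/-- The ratio of the exponential sums at `y + z` and `y` is the moment generating function of the
softmax weights, which reduces the Taylor expansion of the energy to that of a cumulant generating
function. -/
lemma mfEnergy_add_sub [NeZero q] (β : ℝ) (y z : Fin q → ℝ) :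
    mfEnergy β (y + z) - mfEnergy β y = β * ∑ i, y i * z i + β / 2 * ∑ i, z i ^ 2 -
      Real.log (∑ i, softmax β y i * Real.exp (β * z i)) := by
  have hE := expSum_pos β y
  have hE' := expSum_pos β (y + z)
  have h1 : ∑ i, softmax β y i * Real.exp (β * z i) = expSum β (y + z) / expSum β y := by
    rw [expSum, Finset.sum_div]
    refine Finset.sum_congr rfl fun i _ => ?_
    rw [softmax, Pi.add_apply, mul_add, Real.exp_add]
    ring
  have h2 : ∑ i, (y + z) i ^ 2 = ∑ i, y i ^ 2 + 2 * ∑ i, y i * z i + ∑ i, z i ^ 2 := by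
    rw [Finset.mul_sum, ← Finset.sum_add_distrib, ← Finset.sum_add_distrib]
    exact Finset.sum_congr rfl fun i _ => by simp only [Pi.add_apply]; ring
  rw [h1, Real.log_div hE'.ne' hE.ne', mfEnergy, mfEnergy, h2]
  ring

open Matrix in
/-- Second order expansion of the mean-field energy at a critical point. -/
lemma mfEnergy_taylor [NeZero q] (hy : ∀ i, softmax β y i = y i) :
    (fun z : Fin q → ℝ => mfEnergy β (y + z) - mfEnergy β y - (z ⬝ᵥ (hessian β y *ᵥ z)) / 2)
      =o[𝓝 0] fun z => ‖z‖ ^ 2 := by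
  have hy1 : ∑ i, y i = 1 := by
    rw [← sum_softmax β y]
    exact Finset.sum_congr rfl fun i _ => (hy i).symm
  have h := (log_sum_mul_exp_isLittleO β hy1).neg_left
  refine h.congr_left fun z => ?_
  rw [mfEnergy_add_sub, dotProduct_hessian_mulVec]
  simp_rw [hy]
  ring

open Matrix in
lemma hessian_nonneg_of_minimizer [NeZero q] (hβ : 0 < β)
    (hy : IsMinimizer β y) (z : Fin q → ℝ) :
    0 ≤ z ⬝ᵥ (hessian β y *ᵥ z) := by
  by_contra! hneg
  set Q := z ⬝ᵥ (hessian β y *ᵥ z) with hQ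
  have hz : 0 < ‖z‖ := by
    rw [norm_pos_iff]
    rintro rfl
    simp [hQ] at hneg
  have ht := mfEnergy_taylor (eq_softmax_of_minimizer hβ hy)
  have hline : Tendsto (fun t : ℝ => t • z) (𝓝 0) (𝓝 0) := by
    have : Continuous fun t : ℝ => t • z := by fun_prop
    simpa using this.tendsto 0
  -- With this tolerance the Taylor error at `t • z` is at most `-Q t² / 4`, half the size of the
  -- main term `Q t² / 2`, so the energy would drop strictly below its minimum.
  have hb := (ht.comp_tendsto hline).bound (c := -Q / (4 * ‖z‖ ^ 2)) (by
    apply div_pos <;> first | linarith | positivity)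
  have hb' := (hb.filter_mono (nhdsWithin_le_nhds (s := Set.Ioi 0))).and self_mem_nhdsWithin
  obtain ⟨t, ht1, ht0⟩ := hb'.exists
  have ht0 : 0 < t := ht0
  simp only [Function.comp, Matrix.mulVec_smul, smul_dotProduct, dotProduct_smul, ← hQ,
    smul_eq_mul, norm_smul, Real.norm_eq_abs] at ht1
  have h1 := hy (y + t • z)
  have h2 := le_abs_self (mfEnergy β (y + t • z) - mfEnergy β y - t * (t * Q) / 2)
  have h3 : -Q / (4 * ‖z‖ ^ 2) * |(|t| * ‖z‖) ^ 2| = -Q / 4 * t ^ 2 := by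
    rw [abs_of_nonneg (by positivity), mul_pow, sq_abs]
    field_simp
  rw [h3] at ht1
  nlinarith [pow_pos ht0 2]

end MeanField

/-! ### The mean-field equation -/

section MeanFieldEquation

variable {r β s t : ℝ}

/-- The difference of both sides of the mean-field equation in logarithmic form. -/
def gap (r β s : ℝ) : ℝ := Real.log (1 + (r - 1) * s) - Real.log (1 - s) - β * s

/-- The free energy of the weights `((1 + (r - 1) s) / r, (1 - s) / r, …)`. -/
def rayFree (r β s : ℝ) : ℝ :=
  -β / 2 * ((1 + (r - 1) * s ^ 2) / r) - Real.negMulLog ((1 + (r - 1) * s) / r) -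
    (r - 1) * Real.negMulLog ((1 - s) / r)

/-- The inflection point of `gap`. -/
def inflection (r : ℝ) : ℝ := (r - 2) / (2 * (r - 1))

/-- The derivative of `gap`. -/
def gapSlope (r β s : ℝ) : ℝ := r / ((1 + (r - 1) * s) * (1 - s)) - β

lemma one_add_mul_pos (hr : 2 < r) (hs : 0 ≤ s) : 0 < 1 + (r - 1) * s := by
  have := mul_nonneg (by linarith : 0 ≤ r - 1) hs
  linarith

lemma inflection_pos (hr : 2 < r) : 0 < inflection r :=
  div_pos (by linarith) (by linarith)

lemma two_mul_inflection_mul (hr : 2 < r) : 2 * inflection r * (r - 1) = r - 2 := by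
  have : r - 1 ≠ 0 := by linarith
  rw [inflection]
  field_simp

lemma two_mul_inflection_lt_one (hr : 2 < r) : 2 * inflection r < 1 := by
  have h := two_mul_inflection_mul hr
  by_contra! h1
  nlinarith

lemma inflection_lt_one (hr : 2 < r) : inflection r < 1 := by
  linarith [two_mul_inflection_lt_one hr, inflection_pos hr]

@[simp] lemma gap_zero : gap r β 0 = 0 := by simp [gap]

lemma hasDerivAt_gap (hr : 2 < r) (hs0 : 0 ≤ s) (hs1 : s < 1) :
    HasDerivAt (gap r β) (gapSlope r β s) s := by
  have h1 := one_add_mul_pos hr hs0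
  have h2 : 0 < 1 - s := by linarith
  have hd1 : HasDerivAt (fun s : ℝ => 1 + (r - 1) * s) (r - 1) s := by
    simpa using ((hasDerivAt_id s).const_mul (r - 1)).const_add 1
  have hd2 : HasDerivAt (fun s : ℝ => 1 - s) (-1) s := by
    simpa using (hasDerivAt_id s).const_sub 1
  have hd3 : HasDerivAt (fun s : ℝ => β * s) β s := by
    simpa using (hasDerivAt_id s).const_mul β
  have h := ((hd1.log h1.ne').sub (hd2.log h2.ne')).sub hd3
  have he : (r - 1) / (1 + (r - 1) * s) - -1 / (1 - s) - β = gapSlope r β s := by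
    rw [gapSlope]
    field_simp
    ring
  rw [he] at h
  exact h

/-- This ties the two functions together: roots of `gap` are the critical points of the free energy
along the ray, and the sign of `gap` decides which of them win. -/
lemma hasDerivAt_rayFree (hr : 2 < r) (hs0 : 0 ≤ s) (hs1 : s < 1) :
    HasDerivAt (rayFree r β) ((r - 1) / r * gap r β s) s := by
  have hr0 : 0 < r := by linarith
  have h1 := one_add_mul_pos hr hs0
  have h2 : 0 < 1 - s := by linarith
  have hd1 : HasDerivAt (fun s : ℝ => (1 + (r - 1) * s) / r) ((r - 1) / r) s := by
    simpa using (((hasDerivAt_id s).const_mul (r - 1)).const_add 1).div_const r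
  have hd2 : HasDerivAt (fun s : ℝ => (1 - s) / r) (-1 / r) s := by
    simpa using ((hasDerivAt_id s).const_sub 1).div_const r
  have hd3 : HasDerivAt (fun s : ℝ => (1 + (r - 1) * s ^ 2) / r) ((r - 1) * (2 * s) / r) s := by
    simpa using ((((hasDerivAt_id s).fun_pow 2).const_mul (r - 1)).const_add 1).div_const r
  have hn1 := (Real.hasDerivAt_negMulLog (div_pos h1 hr0).ne').comp s hd1
  have hn2 := (Real.hasDerivAt_negMulLog (div_pos h2 hr0).ne').comp s hd2
  have h := ((hd3.const_mul (-β / 2)).sub hn1).sub (hn2.const_mul (r - 1))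
  refine h.congr_deriv ?_
  rw [Real.log_div h1.ne' hr0.ne', Real.log_div h2.ne' hr0.ne', gap]
  field_simp
  ring

/-- The denominator `(1 + (r - 1) s) (1 - s)` is a concave quadratic with vertex at `inflection r`.
Its increment from `s` to `t` is `(t - s) (r - 2 - (r - 1) (t + s))`, and the sign of the last
factor is what matters here and in the increasing range. -/
lemma strictAntiOn_gapSlope (hr : 2 < r) (β : ℝ) :
    StrictAntiOn (gapSlope r β) (Set.Icc 0 (inflection r)) := by
  intro s hs t ht hst
  have hm := two_mul_inflection_mul hr
  have hm1 := inflection_lt_one hr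
  have h1 := one_add_mul_pos hr hs.1
  have h2 : 0 < 1 - s := by linarith [hs.2]
  refine sub_lt_sub_right (div_lt_div_of_pos_left (by linarith) (mul_pos h1 h2) ?_) _
  have h3 : (r - 1) * (t + s) < r - 2 := by nlinarith [ht.2, hs.2]
  nlinarith [mul_pos (sub_pos.2 hst) (sub_pos.2 h3)]

lemma strictMonoOn_gapSlope (hr : 2 < r) (β : ℝ) :
    StrictMonoOn (gapSlope r β) (Set.Ico (inflection r) 1) := by
  intro s hs t ht hst
  have hm := two_mul_inflection_mul hr
  have hm0 := inflection_pos hr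
  have h1 := one_add_mul_pos hr (hm0.le.trans ht.1)
  have h2 : 0 < 1 - t := by linarith [ht.2]
  refine sub_lt_sub_right (div_lt_div_of_pos_left (by linarith) (mul_pos h1 h2) ?_) _
  have h3 : r - 2 < (r - 1) * (t + s) := by nlinarith [ht.1, hs.1]
  nlinarith [mul_pos (sub_pos.2 hst) (sub_pos.2 h3)]

lemma strictConcaveOn_gap (hr : 2 < r) (β : ℝ) :
    StrictConcaveOn ℝ (Set.Icc 0 (inflection r)) (gap r β) := by
  have hm1 := inflection_lt_one hr
  refine StrictAntiOn.strictConcaveOn_of_deriv (convex_Icc _ _) (fun s hs =>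
    (hasDerivAt_gap hr hs.1 (hs.2.trans_lt hm1)).continuousAt.continuousWithinAt) ?_
  rw [interior_Icc]
  refine ((strictAntiOn_gapSlope hr β).mono Set.Ioo_subset_Icc_self).congr fun s hs => ?_
  exact (hasDerivAt_gap hr hs.1.le (hs.2.trans hm1)).deriv.symm

lemma strictConvexOn_gap (hr : 2 < r) (β : ℝ) :
    StrictConvexOn ℝ (Set.Ico (inflection r) 1) (gap r β) := by
  have hm0 := inflection_pos hr
  refine StrictMonoOn.strictConvexOn_of_deriv (convex_Ico _ _) (fun s hs =>
    (hasDerivAt_gap hr (hm0.le.trans hs.1) hs.2).continuousAt.continuousWithinAt) ?_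
  rw [interior_Ico]
  refine ((strictMonoOn_gapSlope hr β).mono Set.Ioo_subset_Ico_self).congr fun s hs => ?_
  exact (hasDerivAt_gap hr (hm0.le.trans hs.1.le) hs.2).deriv.symm

/-- A strictly concave function vanishing at `0` and `t` is positive in between. -/
lemma gap_pos_of_concave (hr : 2 < r) (hs : 0 < s) (hst : s < t) (ht : t ≤ inflection r)
    (h : gap r β t = 0) : 0 < gap r β s := by
  have hc := (strictConcaveOn_gap hr β).slope_anti_adjacent (x := 0) (y := s) (z := t)
    ⟨le_rfl, (inflection_pos hr).le⟩ ⟨(hs.trans hst).le, ht⟩ hs hst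
  rw [h, gap_zero, sub_zero, sub_zero, zero_sub, div_lt_div_iff₀ (sub_pos.2 hst) hs] at hc
  nlinarith

/-- A strictly convex function that starts at a nonpositive value has increasing slopes, so once it
reaches zero it cannot do so again. -/
lemma gap_root_unique_of_convex (hr : 2 < r) (h0 : gap r β (inflection r) ≤ 0)
    (hs : inflection r < s) (hst : s < t) (ht1 : t < 1) (hgs : gap r β s = 0) :
    gap r β t ≠ 0 := by
  intro hgt
  have hc := (strictConvexOn_gap hr β).slope_strict_mono_adjacent (x := inflection r) (y := s)
    (z := t) ⟨le_rfl, inflection_lt_one hr⟩ ⟨(hs.trans hst).le, ht1⟩ hs hst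
  rw [hgs, hgt, sub_self, zero_div, zero_sub] at hc
  have : 0 ≤ -gap r β (inflection r) / (s - inflection r) :=
    div_nonneg (by linarith) (by linarith)
  linarith

/-- From a nonpositive value up to zero the slope is nonnegative somewhere, and it increases
strictly afterwards. The conclusion is the nondegeneracy of the Hessian at ordered points. -/
lemma gapSlope_pos_of_root (hr : 2 < r) (h0 : gap r β (inflection r) ≤ 0)
    (hs : inflection r < s) (hs1 : s < 1) (hgs : gap r β s = 0) : 0 < gapSlope r β s := by
  have hm0 := inflection_pos hr
  obtain ⟨c, hc, hce⟩ := exists_hasDerivAt_eq_slope (gap r β) (gapSlope r β) hs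
    (fun x hx => (hasDerivAt_gap hr (hm0.le.trans hx.1)
      (hx.2.trans_lt hs1)).continuousAt.continuousWithinAt)
    fun x hx => hasDerivAt_gap hr (hm0.le.trans hx.1.le) (hx.2.trans hs1)
  have h1 : 0 ≤ gapSlope r β c := by
    rw [hce, hgs]
    exact div_nonneg (by linarith) (by linarith)
  exact h1.trans_lt (strictMonoOn_gapSlope hr β ⟨hc.1.le, hc.2.trans hs1⟩ ⟨hs.le, hs1⟩ hc.2)

/-- Before a root in the concave range `gap` is positive, so the free energy increases: such a root
never beats the uniform point. -/
lemma rayFree_le_of_root (hr : 2 < r) (ht0 : 0 ≤ t) (ht : t ≤ inflection r)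
    (h : gap r β t = 0) : rayFree r β 0 ≤ rayFree r β t := by
  have hm1 := inflection_lt_one hr
  refine monotoneOn_of_deriv_nonneg (convex_Icc 0 t) (fun s hs =>
    (hasDerivAt_rayFree hr hs.1 (by linarith [hs.2])).continuousAt.continuousWithinAt)
    (fun s hs => ?_) (fun s hs => ?_) ⟨le_rfl, ht0⟩ ⟨ht0, le_rfl⟩ ht0
  · rw [interior_Icc] at hs
    exact (hasDerivAt_rayFree hr hs.1.le
      (by linarith [hs.2])).differentiableAt.differentiableWithinAt
  · rw [interior_Icc] at hs
    rw [(hasDerivAt_rayFree hr hs.1.le (by linarith [hs.2])).deriv]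
    exact mul_nonneg (div_nonneg (by linarith) (by linarith))
      (gap_pos_of_concave hr hs.1 hs.2 ht h).le

lemma rayFree_lt_of_root (hr : 2 < r) (ht0 : 0 < t) (ht : t ≤ inflection r)
    (h : gap r β t = 0) : rayFree r β 0 < rayFree r β t := by
  have hm1 := inflection_lt_one hr
  refine strictMonoOn_of_deriv_pos (convex_Icc 0 t) (fun s hs =>
    (hasDerivAt_rayFree hr hs.1 (by linarith [hs.2])).continuousAt.continuousWithinAt)
    (fun s hs => ?_) ⟨le_rfl, ht0.le⟩ ⟨ht0.le, le_rfl⟩ ht0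
  rw [interior_Icc] at hs
  rw [(hasDerivAt_rayFree hr hs.1.le (by linarith [hs.2])).deriv]
  exact mul_pos (div_pos (by linarith) (by linarith)) (gap_pos_of_concave hr hs.1 hs.2 ht h)

/-- The critical inverse temperature for a real number of letters. -/
def critBeta (r : ℝ) : ℝ := 2 * (r - 1) * Real.log (r - 1) / (r - 2)

lemma critBeta_mul_inflection (hr : 2 < r) : critBeta r * inflection r = Real.log (r - 1) := by
  have h1 : r - 1 ≠ 0 := by linarith
  have h2 : r - 2 ≠ 0 := by linarith
  rw [critBeta, inflection]
  field_simp

lemma critBeta_pos (hr : 2 < r) : 0 < critBeta r :=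
  div_pos (mul_pos (by linarith) (Real.log_pos (by linarith))) (by linarith)

/-- At the inflection point `1 + (r - 1) s = (r - 1) (1 - s)`, so the logarithms collapse to `log (r
- 1)`. The sign of `gap` there compares `β` with its critical value. -/
lemma gap_inflection (hr : 2 < r) (β : ℝ) :
    gap r β (inflection r) = (critBeta r - β) * inflection r := by
  have hm := two_mul_inflection_mul hr
  have h1 : 1 + (r - 1) * inflection r = (r - 1) * (1 - inflection r) := by linarith
  have h2 : 1 - inflection r ≠ 0 := by linarith [inflection_lt_one hr]
  rw [sub_mul, critBeta_mul_inflection hr, gap, h1, Real.log_mul (by linarith) h2]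
  ring

lemma one_sub_two_mul_inflection (hr : 2 < r) : 1 - 2 * inflection r = 1 / (r - 1) := by
  have h1 : r - 1 ≠ 0 := by linarith
  rw [inflection]
  field_simp
  ring

lemma one_add_two_mul_inflection (hr : 2 < r) : 1 + (r - 1) * (2 * inflection r) = r - 1 := by
  have := two_mul_inflection_mul hr
  linarith

lemma gap_two_mul_inflection (hr : 2 < r) (β : ℝ) :
    gap r β (2 * inflection r) = (critBeta r - β) * (2 * inflection r) := by
  have h := critBeta_mul_inflection hr
  rw [gap, one_sub_two_mul_inflection hr, one_add_two_mul_inflection hr, one_div, Real.log_inv]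
  linarith

/-- Phase coexistence. The critical `gap` is odd about the inflection point, so its integral from
`0` to `2 * inflection r` vanishes; the identity is verified here by direct computation. -/
lemma rayFree_crit_two_mul_inflection (hr : 2 < r) :
    rayFree r (critBeta r) (2 * inflection r) = rayFree r (critBeta r) 0 := by
  have hr0 : r ≠ 0 := by linarith
  have h1 : r - 1 ≠ 0 := by linarith
  have h2 : r - 2 ≠ 0 := by linarith
  rw [rayFree, rayFree, one_sub_two_mul_inflection hr, one_add_two_mul_inflection hr]
  simp only [Real.negMulLog]
  rw [Real.log_div h1 hr0, Real.log_div (one_div_ne_zero h1) hr0, one_div (r - 1), Real.log_inv]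
  simp only [mul_zero, add_zero, sub_zero, ne_eq, OfNat.ofNat_ne_zero, not_false_eq_true, zero_pow,
    one_div, Real.log_inv]
  rw [critBeta, inflection]
  field_simp
  ring

/-- Since `β` enters only through a quadratic term, comparisons at the critical value transfer to
every other temperature with an error of known sign. -/
lemma rayFree_sub (hr : 2 < r) (β γ s : ℝ) : rayFree r β s - rayFree r β 0 =
    rayFree r γ s - rayFree r γ 0 + (γ - β) * ((r - 1) * s ^ 2 / (2 * r)) := by
  have hr0 : r ≠ 0 := by linarith
  simp only [rayFree]
  field_simp
  ring

/-- The roots of the critical mean-field equation. -/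
lemma gap_crit_root (hr : 2 < r) (hs0 : 0 ≤ s) (hs1 : s < 1) (h : gap r (critBeta r) s = 0) :
    s = 0 ∨ s = inflection r ∨ s = 2 * inflection r := by
  have hm0 := inflection_pos hr
  have hgm : gap r (critBeta r) (inflection r) = 0 := by rw [gap_inflection hr]; ring
  have hg2 : gap r (critBeta r) (2 * inflection r) = 0 := by rw [gap_two_mul_inflection hr]; ring
  rcases hs0.eq_or_lt with h0 | h0
  · exact Or.inl h0.symm
  rcases lt_trichotomy s (inflection r) with hlt | heq | hgt
  · exact absurd h (gap_pos_of_concave hr h0 hlt le_rfl hgm).ne'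
  · exact Or.inr (Or.inl heq)
  rcases lt_trichotomy s (2 * inflection r) with hlt | heq | hgt2
  · exact absurd hg2 (gap_root_unique_of_convex hr hgm.le hgt hlt (two_mul_inflection_lt_one hr) h)
  · exact Or.inr (Or.inr heq)
  · exact absurd h (gap_root_unique_of_convex hr hgm.le (by linarith) hgt2 hs1 hg2)

/-- The critical `gap` vanishes at `0` and at the inflection point, so its slope vanishes in
between; the slope is decreasing there and hence positive at `0`, where it equals `r - critBeta r`.
This makes the uniform point nondegenerate up to `β_c`. -/
lemma critBeta_lt (hr : 2 < r) : critBeta r < r := by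
  have hm0 := inflection_pos hr
  have hm1 := inflection_lt_one hr
  have hgm : gap r (critBeta r) (inflection r) = 0 := by rw [gap_inflection hr]; ring
  obtain ⟨c, hc, hce⟩ := exists_hasDerivAt_eq_slope (gap r (critBeta r)) (gapSlope r (critBeta r))
    hm0
    (fun x hx => (hasDerivAt_gap hr hx.1
      (hx.2.trans_lt hm1)).continuousAt.continuousWithinAt)
    fun x hx => hasDerivAt_gap hr hx.1.le (hx.2.trans hm1)
  rw [hgm, gap_zero, sub_zero, zero_div] at hce
  have h := strictAntiOn_gapSlope hr (critBeta r) ⟨le_rfl, hm0.le⟩ ⟨hc.1.le, hc.2.le⟩ hc.1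
  rw [hce, gapSlope] at h
  simp at h
  linarith

lemma mul_lt_one_of_gapSlope_pos (hr : 2 < r) (hs0 : 0 ≤ s) (hs1 : s < 1)
    (h : 0 < gapSlope r β s) : β * ((1 + (r - 1) * s) * (1 - s)) < r := by
  have h1 := mul_pos (one_add_mul_pos hr hs0) (sub_pos.2 hs1)
  rw [gapSlope, sub_pos, lt_div_iff₀ h1] at h
  exact h

end MeanFieldEquation

/-! ### Minimizers of the mean-field energy -/

section Minimizers

variable {q : ℕ} {β s : ℝ} {y : Fin q → ℝ}

/-- The weights with order parameter `s` in direction `k`. -/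
def orderPoint (k : Fin q) (s : ℝ) : Fin q → ℝ :=
  fun i => if i = k then (1 + ((q : ℝ) - 1) * s) / q else (1 - s) / q

lemma sum_ite_eq_add (k : Fin q) (a b : ℝ) :
    ∑ i : Fin q, (if i = k then a else b) = a + ((q : ℝ) - 1) * b := by
  have h1 : ∀ i : Fin q, (if i = k then a else b) = (if i = k then a - b else 0) + b := by
    intro i
    split_ifs <;> ring
  simp_rw [h1]
  rw [Finset.sum_add_distrib]
  simp
  ring

lemma sum_comp_orderPoint (k : Fin q) (s : ℝ) (φ : ℝ → ℝ) :
    ∑ i, φ (orderPoint k s i) =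
      φ ((1 + ((q : ℝ) - 1) * s) / q) + ((q : ℝ) - 1) * φ ((1 - s) / q) := by
  rw [← sum_ite_eq_add k]
  exact Finset.sum_congr rfl fun i _ => apply_ite φ _ _ _

lemma orderPoint_zero (k : Fin q) : orderPoint k 0 = fun _ => 1 / (q : ℝ) := by
  funext i
  simp [orderPoint]

lemma orderPoint_apply_self (k : Fin q) (s : ℝ) :
    orderPoint k s k = (1 + ((q : ℝ) - 1) * s) / q := if_pos rfl

lemma orderPoint_eq_add [NeZero q] (k : Fin q) (s : ℝ) (i : Fin q) :
    orderPoint k s i = (1 - s) / q + if i = k then s else 0 := by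
  have : (q : ℝ) ≠ 0 := by exact_mod_cast NeZero.ne q
  rw [orderPoint]
  split_ifs
  · field_simp
    ring
  · ring

lemma sum_orderPoint [NeZero q] (k : Fin q) (s : ℝ) : ∑ i, orderPoint k s i = 1 := by
  have : (q : ℝ) ≠ 0 := by exact_mod_cast NeZero.ne q
  rw [sum_comp_orderPoint k s fun x => x]
  field_simp
  ring

lemma sum_orderPoint_sq [NeZero q] (k : Fin q) (s : ℝ) :
    ∑ i, orderPoint k s i ^ 2 = (1 + ((q : ℝ) - 1) * s ^ 2) / q := by
  have : (q : ℝ) ≠ 0 := by exact_mod_cast NeZero.ne q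
  rw [sum_comp_orderPoint k s fun x => x ^ 2]
  field_simp
  ring

lemma orderPoint_pos (hq : 2 < q) (k : Fin q) (hs0 : 0 ≤ s) (hs1 : s < 1) (i : Fin q) :
    0 < orderPoint k s i := by
  have hr : (2 : ℝ) < q := by exact_mod_cast hq
  rw [orderPoint]
  split_ifs
  · exact div_pos (one_add_mul_pos hr hs0) (by linarith)
  · exact div_pos (by linarith) (by linarith)

/-- The bridge between the mean-field equation and the equilibrium states with `b = β s`. -/
lemma softmax_orderPoint [NeZero q] (β : ℝ) (k : Fin q) (s : ℝ) :
    softmax β (orderPoint k s) = gibbsWeight k (β * s) := by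
  have hexp : ∀ i, Real.exp (β * orderPoint k s i) =
      Real.exp (β * ((1 - s) / q)) * if i = k then Real.exp (β * s) else 1 := by
    intro i
    rw [orderPoint_eq_add, mul_add, Real.exp_add]
    split_ifs <;> simp
  funext i
  rw [softmax, expSum]
  simp_rw [hexp]
  rw [← Finset.mul_sum, sum_ite_eq_add, mul_div_mul_left _ _ (Real.exp_pos _).ne', gibbsWeight]
  congr 1
  ring

lemma gibbsWeight_eq_orderPoint (hq : 2 < q) (k : Fin q) (hs0 : 0 ≤ s) (hs1 : s < 1)
    (h : gap q β s = 0) : gibbsWeight k (β * s) = orderPoint k s := by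
  have hr : (2 : ℝ) < q := by exact_mod_cast hq
  have h1 := one_add_mul_pos hr hs0
  have h2 : 0 < 1 - s := by linarith
  have hE : Real.exp (β * s) = (1 + ((q : ℝ) - 1) * s) / (1 - s) := by
    rw [← Real.exp_log (div_pos h1 h2), Real.log_div h1.ne' h2.ne']
    congr 1
    rw [gap] at h
    linarith
  have hq0 : (q : ℝ) ≠ 0 := by linarith
  have hden : Real.exp (β * s) + q - 1 = q / (1 - s) := by
    rw [hE]
    field_simp
    ring
  funext i
  rw [gibbsWeight, hden, hE, orderPoint]
  split_ifs
  · field_simp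
  · field_simp

lemma softmax_orderPoint_of_root (hq : 2 < q) [NeZero q] (k : Fin q) (hs0 : 0 ≤ s) (hs1 : s < 1)
    (h : gap q β s = 0) : softmax β (orderPoint k s) = orderPoint k s := by
  rw [softmax_orderPoint, gibbsWeight_eq_orderPoint hq k hs0 hs1 h]

/-- Gibbs inequality against the softmax weights. The bound is an equality at fixed points of
softmax, so `rayFree` gives exact energies at roots and upper bounds elsewhere on the ray. -/
lemma mfEnergy_le_of_simplex [NeZero q] (β : ℝ) (hy : ∀ i, 0 ≤ y i) (hy1 : ∑ i, y i = 1) :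
    mfEnergy β y ≤ -β / 2 * ∑ i, y i ^ 2 - ∑ i, Real.negMulLog (y i) := by
  have h := sum_negMulLog_le (Q := softmax β y) hy (fun i => (softmax_pos β y i).le)
    (fun i h => absurd h (softmax_pos β y i).ne') (by rw [hy1, sum_softmax])
  have h2 : ∑ i, y i * -Real.log (softmax β y i) =
      Real.log (expSum β y) - β * ∑ i, y i ^ 2 := by
    simp_rw [log_softmax]
    have : ∀ i, y i * -(β * y i - Real.log (expSum β y)) =
        y i * Real.log (expSum β y) - β * y i ^ 2 := fun i => by ring
    simp_rw [this]
    rw [Finset.sum_sub_distrib, ← Finset.sum_mul, hy1, ← Finset.mul_sum, one_mul]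
  rw [h2] at h
  rw [mfEnergy]
  linarith

lemma mfEnergy_eq_of_softmax [NeZero q] (h : softmax β y = y) :
    mfEnergy β y = -β / 2 * ∑ i, y i ^ 2 - ∑ i, Real.negMulLog (y i) := by
  have h1 : ∑ i, y i = 1 := by rw [← sum_softmax β y, h]
  have h2 : ∑ i, Real.negMulLog (y i) = Real.log (expSum β y) - β * ∑ i, y i ^ 2 := by
    have : ∀ i, Real.negMulLog (y i) = y i * Real.log (expSum β y) - β * y i ^ 2 := fun i => by
      have hl := log_softmax β y i
      rw [h] at hl
      rw [Real.negMulLog, hl]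
      ring
    simp_rw [this]
    rw [Finset.sum_sub_distrib, ← Finset.sum_mul, h1, ← Finset.mul_sum, one_mul]
  rw [h2, mfEnergy]
  ring

lemma rayFree_eq [NeZero q] (β : ℝ) (k : Fin q) (s : ℝ) :
    rayFree q β s = -β / 2 * ∑ i, orderPoint k s i ^ 2 -
      ∑ i, Real.negMulLog (orderPoint k s i) := by
  rw [sum_orderPoint_sq, sum_comp_orderPoint, rayFree]
  ring

lemma mfEnergy_orderPoint_le (hq : 2 < q) [NeZero q] (β : ℝ) (k : Fin q) (hs0 : 0 ≤ s)
    (hs1 : s < 1) : mfEnergy β (orderPoint k s) ≤ rayFree q β s := by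
  rw [rayFree_eq β k]
  exact mfEnergy_le_of_simplex β (fun i => (orderPoint_pos hq k hs0 hs1 i).le) (sum_orderPoint k s)

lemma mfEnergy_orderPoint_eq (hq : 2 < q) [NeZero q] (k : Fin q) (hs0 : 0 ≤ s) (hs1 : s < 1)
    (h : gap q β s = 0) : mfEnergy β (orderPoint k s) = rayFree q β s := by
  rw [rayFree_eq β k]
  exact mfEnergy_eq_of_softmax (softmax_orderPoint_of_root hq k hs0 hs1 h)

/-- Testing the Hessian on the difference of two coordinate vectors with equal weights kills the
squared mean and leaves `2 β (1 - β y k) ≥ 0`. -/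
lemma mul_le_one_of_tie [NeZero q] (hβ : 0 < β) (hy : IsMinimizer β y) {i k : Fin q} (hik : i ≠ k)
    (h : y i = y k) : β * y k ≤ 1 := by
  have hH := hessian_nonneg_of_minimizer hβ hy (Pi.single i 1 - Pi.single k 1)
  rw [dotProduct_hessian_mulVec] at hH
  have e1 : ∀ c : Fin q → ℝ, ∑ j, c j * (Pi.single i 1 - Pi.single k 1 : Fin q → ℝ) j =
      c i - c k := by
    intro c
    simp [Pi.single_apply, mul_sub, Finset.sum_sub_distrib]
  have e2 : ∀ c : Fin q → ℝ, ∑ j, c j * (Pi.single i 1 - Pi.single k 1 : Fin q → ℝ) j ^ 2 =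
      c i + c k := by
    intro c
    have : ∀ j, c j * (Pi.single i 1 - Pi.single k 1 : Fin q → ℝ) j ^ 2 =
        c j * (Pi.single i 1 : Fin q → ℝ) j + c j * (Pi.single k 1 : Fin q → ℝ) j := by
      intro j
      by_cases h1 : j = i
      · subst h1
        simp [hik]
      · by_cases h2 : j = k
        · subst h2
          simp [h1]
        · simp [h1, h2]
    simp_rw [this]
    rw [Finset.sum_add_distrib]
    simp [Pi.single_apply]
  have e3 := e2 fun _ => 1
  simp only [one_mul] at e3
  rw [e1, e2, e3, h, sub_self] at hH
  have : 0 ≤ 2 * β * (1 - β * y k) := by nlinarith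
  have := nonneg_of_mul_nonneg_right this (by positivity)
  linarith

/-- A global minimizer of the mean-field energy has at most one exceptional coordinate. -/
lemma exists_orderPoint_of_minimizer (hq : 2 < q) [NeZero q] (hβ : 0 < β)
    (hy : IsMinimizer β y) :
    ∃ k s, 0 ≤ s ∧ s < 1 ∧ gap q β s = 0 ∧ y = orderPoint k s := by
  have hr : (2 : ℝ) < q := by exact_mod_cast hq
  have hsm := eq_softmax_of_minimizer hβ hy
  have hpos : ∀ i, 0 < y i := fun i => hsm i ▸ softmax_pos β y i
  have hsum : ∑ i, y i = 1 := by
    rw [← sum_softmax β y]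
    exact Finset.sum_congr rfl fun i _ => (hsm i).symm
  have hlog : ∀ i, Real.log (y i) = β * y i - Real.log (expSum β y) := fun i => by
    rw [← log_softmax, hsm]
  obtain ⟨k, hk⟩ := Finite.exists_max y
  -- If `j` ties with the maximum, `log t < t - 1` would give `β y k > 1`, against the second order
  -- bound. Otherwise `y i < y j < y k` are three collinear points on the graph of `log`, against
  -- strict concavity.
  have hne : ∀ i j, i ≠ k → j ≠ k → y i < y j → False := by
    intro i j hi hj hij
    rcases (hk j).eq_or_lt with hjk | hjk
    · have hle := mul_le_one_of_tie hβ hy hj hjk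
      have h1 := Real.log_lt_sub_one_of_pos (div_pos (hpos i) (hpos k))
        (by rw [← hjk]; exact ((div_lt_one (hpos j)).2 hij).ne)
      rw [Real.log_div (hpos i).ne' (hpos k).ne', hlog i, hlog k] at h1
      have h2 : y i / y k - 1 = (y i - y k) / y k := by
        rw [sub_div, div_self (hpos k).ne']
      rw [h2, lt_div_iff₀ (hpos k)] at h1
      nlinarith
    · have hc := strictConcaveOn_log_Ioi.slope_anti_adjacent (hpos i) (hpos k) hij hjk
      rw [hlog i, hlog j, hlog k] at hc
      have e1 : β * y k - Real.log (expSum β y) - (β * y j - Real.log (expSum β y)) =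
          β * (y k - y j) := by ring
      have e2 : β * y j - Real.log (expSum β y) - (β * y i - Real.log (expSum β y)) =
          β * (y j - y i) := by ring
      rw [e1, e2, mul_div_cancel_right₀ _ (sub_pos.2 hjk).ne',
        mul_div_cancel_right₀ _ (sub_pos.2 hij).ne'] at hc
      exact lt_irrefl _ hc
  have : Nontrivial (Fin q) := Fin.nontrivial_iff_two_le.2 hq.le
  obtain ⟨l, hl⟩ := exists_ne k
  have hform : ∀ i, y i = if i = k then y k else y l := by
    intro i
    split_ifs with hi
    · rw [hi]
    · exact le_antisymm (not_lt.1 fun h => hne l i hl hi h) (not_lt.1 fun h => hne i l hi hl h)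
  have hsum' : y k + ((q : ℝ) - 1) * y l = 1 := by
    rw [← sum_ite_eq_add k, ← hsum]
    exact Finset.sum_congr rfl fun i _ => (hform i).symm
  have ha : 1 + ((q : ℝ) - 1) * (y k - y l) = q * y k := by linarith
  have hb : 1 - (y k - y l) = q * y l := by linarith
  have hq0 : (q : ℝ) ≠ 0 := by linarith
  refine ⟨k, y k - y l, sub_nonneg.2 (hk l), ?_, ?_, ?_⟩
  · nlinarith [hpos l]
  · rw [gap, ha, hb, Real.log_mul hq0 (hpos k).ne', Real.log_mul hq0 (hpos l).ne', hlog k, hlog l]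
    ring
  · funext i
    rw [hform i, orderPoint, ha, hb, mul_div_cancel_left₀ _ hq0, mul_div_cancel_left₀ _ hq0]

lemma gap_crit_two_mul (hq : 2 < q) : gap q (critBeta q) (2 * inflection q) = 0 := by
  rw [gap_two_mul_inflection (by exact_mod_cast hq)]
  ring

/-- A minimizer exists and sits at one of the three critical roots; the middle root is no better
than zero and the largest ties with it. -/
lemma rayFree_crit_le_mfEnergy (hq : 2 < q) [NeZero q] (z : Fin q → ℝ) :
    rayFree q (critBeta q) 0 ≤ mfEnergy (critBeta q) z := by
  have hr : (2 : ℝ) < q := by exact_mod_cast hq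
  obtain ⟨y, hy⟩ := exists_minimizer (q := q) (critBeta_pos hr)
  obtain ⟨k, s, hs0, hs1, hg, rfl⟩ := exists_orderPoint_of_minimizer hq (critBeta_pos hr) hy
  refine le_trans ?_ (hy z)
  rw [mfEnergy_orderPoint_eq hq k hs0 hs1 hg]
  rcases gap_crit_root hr hs0 hs1 hg with rfl | rfl | rfl
  · exact le_rfl
  · exact rayFree_le_of_root hr hs0 le_rfl hg
  · exact (rayFree_crit_two_mul_inflection hr).ge

/-- The minimizers at the critical inverse temperature. -/
lemma isMinimizer_crit_iff (hq : 2 < q) [NeZero q] :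
    IsMinimizer (critBeta q) y ↔
      y = (fun _ => 1 / (q : ℝ)) ∨ ∃ k, y = orderPoint k (2 * inflection q) := by
  have hr : (2 : ℝ) < q := by exact_mod_cast hq
  have hm0 := inflection_pos hr
  constructor
  · intro hy
    obtain ⟨k, s, hs0, hs1, hg, rfl⟩ := exists_orderPoint_of_minimizer hq (critBeta_pos hr) hy
    rcases gap_crit_root hr hs0 hs1 hg with rfl | rfl | rfl
    · exact Or.inl (orderPoint_zero k)
    · have h1 := rayFree_lt_of_root hr hm0 le_rfl hg
      have h2 := hy (orderPoint k 0)
      rw [mfEnergy_orderPoint_eq hq k hs0 hs1 hg,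
        mfEnergy_orderPoint_eq hq k le_rfl one_pos gap_zero] at h2
      linarith
    · exact Or.inr ⟨k, rfl⟩
  · rintro (rfl | ⟨k, rfl⟩) z
    · rw [← orderPoint_zero 0, mfEnergy_orderPoint_eq hq 0 le_rfl one_pos gap_zero]
      exact rayFree_crit_le_mfEnergy hq z
    · rw [mfEnergy_orderPoint_eq hq k (by positivity) (two_mul_inflection_lt_one hr)
        (gap_crit_two_mul hq), rayFree_crit_two_mul_inflection hr]
      exact rayFree_crit_le_mfEnergy hq z

/-- Below the critical inverse temperature the uniform weights are the only minimizer. -/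
lemma isMinimizer_iff_of_lt (hq : 2 < q) [NeZero q] (hβ : 0 < β) (hlt : β < critBeta q) :
    IsMinimizer β y ↔ y = fun _ => 1 / (q : ℝ) := by
  have hr : (2 : ℝ) < q := by exact_mod_cast hq
  have hmp : ∀ {y : Fin q → ℝ}, IsMinimizer β y → y = fun _ => 1 / (q : ℝ) := by
    intro y hy
    obtain ⟨k, s, hs0, hs1, hg, rfl⟩ := exists_orderPoint_of_minimizer hq hβ hy
    rcases hs0.eq_or_lt with rfl | hs
    · exact orderPoint_zero k
    have h2 := hy (orderPoint k 0)
    rw [mfEnergy_orderPoint_eq hq k hs0 hs1 hg,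
      mfEnergy_orderPoint_eq hq k le_rfl one_pos gap_zero] at h2
    -- At `β_c` the point `s` is no better than `0`; lowering `β` adds a strictly positive cost
    -- proportional to `s²`.
    have h3 := rayFree_sub hr β (critBeta q) s
    have h4 : rayFree q (critBeta q) 0 ≤ rayFree q (critBeta q) s :=
      (rayFree_crit_le_mfEnergy hq _).trans (mfEnergy_orderPoint_le hq _ k hs0 hs1)
    have h5 : 0 < (critBeta q - β) * (((q : ℝ) - 1) * s ^ 2 / (2 * q)) :=
      mul_pos (sub_pos.2 hlt)
        (div_pos (mul_pos (by linarith) (pow_pos hs 2)) (by linarith))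
    linarith
  refine ⟨hmp, ?_⟩
  rintro rfl
  obtain ⟨y, hy⟩ := exists_minimizer (q := q) hβ
  exact hmp hy ▸ hy

lemma mfEnergy_orderPoint_congr [NeZero q] (β : ℝ) (k l : Fin q) (s : ℝ) :
    mfEnergy β (orderPoint k s) = mfEnergy β (orderPoint l s) := by
  rw [mfEnergy, mfEnergy, sum_orderPoint_sq, sum_orderPoint_sq, expSum, expSum,
    sum_comp_orderPoint k s fun x => Real.exp (β * x),
    sum_comp_orderPoint l s fun x => Real.exp (β * x)]

/-! ### The largest root of the mean-field equation -/

lemma mem_meanFieldRoots_iff (hq : 2 < q) (hs0 : 0 ≤ s) (hs1 : s < 1) :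
    s ∈ meanFieldRoots q β ↔ gap q β s = 0 := by
  have hr : (2 : ℝ) < q := by exact_mod_cast hq
  have h1 := one_add_mul_pos hr hs0
  have h2 : 0 < 1 - s := by linarith
  have hE := Real.exp_pos (β * s)
  have hden : 0 < Real.exp (β * s) + q - 1 := by linarith
  have : s ∈ meanFieldRoots q β ↔ s = (Real.exp (β * s) - 1) / (Real.exp (β * s) + (q : ℝ) - 1) :=
    Iff.rfl
  rw [this, eq_div_iff hden.ne', gap, ← Real.log_div h1.ne' h2.ne', sub_eq_zero]
  constructor
  · intro h
    have : (1 + ((q : ℝ) - 1) * s) / (1 - s) = Real.exp (β * s) := by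
      rw [div_eq_iff h2.ne']
      linarith
    rw [this, Real.log_exp]
  · intro h
    have h3 : (1 + ((q : ℝ) - 1) * s) / (1 - s) = Real.exp (β * s) := by
      rw [← h, Real.exp_log (div_pos h1 h2)]
    rw [div_eq_iff h2.ne'] at h3
    linarith

lemma isGreatest_sSup_meanFieldRoots (hq : 2 < q) (β : ℝ) :
    IsGreatest (meanFieldRoots q β) (sSup (meanFieldRoots q β)) ∧
      0 ≤ sSup (meanFieldRoots q β) ∧ sSup (meanFieldRoots q β) < 1 := by
  have hr : (2 : ℝ) < q := by exact_mod_cast hq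
  have hden : ∀ s : ℝ, 0 < Real.exp (β * s) + q - 1 := fun s => by
    linarith [Real.exp_pos (β * s)]
  have h0 : (0 : ℝ) ∈ meanFieldRoots q β := by simp [meanFieldRoots]
  have hlt : ∀ s ∈ meanFieldRoots q β, s < 1 := by
    intro s hs
    have hs' : s = (Real.exp (β * s) - 1) / (Real.exp (β * s) + (q : ℝ) - 1) := hs
    rw [hs', div_lt_one (hden s)]
    linarith
  have hclosed : IsClosed (meanFieldRoots q β) :=
    isClosed_eq continuous_id (Continuous.div (by fun_prop) (by fun_prop) fun s => (hden s).ne')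
  have hbdd : BddAbove (meanFieldRoots q β) := ⟨1, fun s hs => (hlt s hs).le⟩
  have hmem := hclosed.csSup_mem ⟨0, h0⟩ hbdd
  exact ⟨⟨hmem, fun s hs => le_csSup hbdd hs⟩, le_csSup hbdd h0, hlt _ hmem⟩

lemma betaC_eq (q : ℕ) : betaC q = critBeta q := rfl

lemma sBeta_of_le (h : betaC q ≤ β) : sBeta q β = sSup (meanFieldRoots q β) := if_neg h.not_gt

lemma isGreatest_sBeta (hq : 2 < q) (h : betaC q ≤ β) :
    IsGreatest (meanFieldRoots q β) (sBeta q β) := by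
  rw [sBeta_of_le h]
  exact (isGreatest_sSup_meanFieldRoots hq β).1

/-- A root of the mean-field equation above the inflection point is the largest one. -/
lemma eq_sBeta_of_root (hq : 2 < q) (h : betaC q ≤ β) (hs : inflection q < s) (hs1 : s < 1)
    (hg : gap q β s = 0) : s = sBeta q β := by
  have hr : (2 : ℝ) < q := by exact_mod_cast hq
  have hm0 := inflection_pos hr
  obtain ⟨⟨hmem, hub⟩, hS0, hS1⟩ := isGreatest_sSup_meanFieldRoots hq β
  rw [sBeta_of_le h]
  have hle := hub ((mem_meanFieldRoots_iff hq (hm0.trans hs).le hs1).2 hg)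
  refine hle.eq_or_lt.resolve_right fun hlt => ?_
  have hgm : gap q β (inflection q) ≤ 0 := by
    rw [gap_inflection hr]
    exact mul_nonpos_of_nonpos_of_nonneg (sub_nonpos.2 h) hm0.le
  exact gap_root_unique_of_convex hr hgm hs hlt hS1 hg
    ((mem_meanFieldRoots_iff hq hS0 hS1).1 hmem)

lemma sBeta_crit (hq : 2 < q) : sBeta q (betaC q) = 2 * inflection q := by
  have hr : (2 : ℝ) < q := by exact_mod_cast hq
  exact (eq_sBeta_of_root hq le_rfl (by linarith [inflection_pos hr])
    (two_mul_inflection_lt_one hr) (gap_crit_two_mul hq)).symm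

lemma exists_minimizer_of_gt (hq : 2 < q) [NeZero q] (hβ : 0 < β) (hlt : betaC q < β)
    (hy : IsMinimizer β y) :
    inflection q < sBeta q β ∧ sBeta q β < 1 ∧ gap q β (sBeta q β) = 0 ∧
      ∃ k, y = orderPoint k (sBeta q β) := by
  have hr : (2 : ℝ) < q := by exact_mod_cast hq
  have hm0 := inflection_pos hr
  obtain ⟨k, s, hs0, hs1, hg, rfl⟩ := exists_orderPoint_of_minimizer hq hβ hy
  have hs : inflection q < s := by
    -- A root up to the inflection point is no better than `0`, whereas `2 * inflection q`, which
    -- ties with `0` at `β_c`, becomes strictly better once `β > β_c`.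
    by_contra! hle
    have h1 := rayFree_le_of_root hr hs0 hle hg
    have h2 := (hy (orderPoint k (2 * inflection q))).trans
      (mfEnergy_orderPoint_le hq β k (by positivity) (two_mul_inflection_lt_one hr))
    rw [mfEnergy_orderPoint_eq hq k hs0 hs1 hg] at h2
    have h3 := rayFree_sub hr β (critBeta q) (2 * inflection q)
    rw [rayFree_crit_two_mul_inflection hr] at h3
    rw [betaC_eq] at hlt
    have h5 : 0 < (β - critBeta q) * (((q : ℝ) - 1) * (2 * inflection q) ^ 2 / (2 * q)) :=
      mul_pos (sub_pos.2 hlt) (div_pos (mul_pos (by linarith) (by positivity)) (by linarith))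
    linarith
  have he := eq_sBeta_of_root hq hlt.le hs hs1 hg
  rw [← he]
  exact ⟨hs, hs1, hg, k, rfl⟩

lemma sBeta_of_gt (hq : 2 < q) [NeZero q] (hβ : 0 < β) (hlt : betaC q < β) :
    inflection q < sBeta q β ∧ sBeta q β < 1 ∧ gap q β (sBeta q β) = 0 := by
  obtain ⟨y, hy⟩ := exists_minimizer (q := q) hβ
  obtain ⟨h1, h2, h3, -⟩ := exists_minimizer_of_gt hq hβ hlt hy
  exact ⟨h1, h2, h3⟩

/-- The minimizers above the critical inverse temperature. -/
lemma isMinimizer_iff_of_gt (hq : 2 < q) [NeZero q] (hβ : 0 < β) (hlt : betaC q < β) :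
    IsMinimizer β y ↔ ∃ k, y = orderPoint k (sBeta q β) := by
  refine ⟨fun hy => (exists_minimizer_of_gt hq hβ hlt hy).2.2.2, ?_⟩
  rintro ⟨k, rfl⟩ z
  obtain ⟨y, hy⟩ := exists_minimizer (q := q) hβ
  obtain ⟨-, -, -, l, rfl⟩ := exists_minimizer_of_gt hq hβ hlt hy
  rw [mfEnergy_orderPoint_congr β k l]
  exact hy z

end Minimizers

/-! ### Gaussian integrals -/

section Gaussian

open Matrix

variable {q : ℕ}

lemma integrable_exp_neg_mul_sum_sq {b : ℝ} (hb : 0 < b) :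
    Integrable fun z : Fin q → ℝ => Real.exp (-(b * ∑ i, z i ^ 2)) := by
  have h := Integrable.fintype_prod (f := fun _ : Fin q => fun x : ℝ => Real.exp (-b * x ^ 2))
    (μ := fun _ => volume) fun _ => integrable_exp_neg_mul_sq hb
  refine h.congr (Eventually.of_forall fun z => ?_)
  simp only
  rw [← Real.exp_sum, Finset.mul_sum, ← Finset.sum_neg_distrib]
  congr 1
  exact Finset.sum_congr rfl fun i _ => by ring

lemma sum_sq_le_mul_norm_sq (z : Fin q → ℝ) : ∑ i, z i ^ 2 ≤ q * ‖z‖ ^ 2 := by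
  calc ∑ i, z i ^ 2 ≤ ∑ _i : Fin q, ‖z‖ ^ 2 := by
        refine Finset.sum_le_sum fun i _ => ?_
        rw [← sq_abs]
        exact pow_le_pow_left₀ (abs_nonneg _) (norm_le_pi_norm z i) 2
    _ = _ := by simp

lemma integrable_exp_neg_mul_norm_sq [NeZero q] {b : ℝ} (hb : 0 < b) :
    Integrable fun z : Fin q → ℝ => Real.exp (-(b * ‖z‖ ^ 2)) := by
  have hq : (0 : ℝ) < q := by exact_mod_cast Nat.pos_of_ne_zero (NeZero.ne q)
  refine (integrable_exp_neg_mul_sum_sq (q := q) (div_pos hb hq)).mono'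
    (by fun_prop) (Eventually.of_forall fun z => ?_)
  rw [Real.norm_eq_abs, abs_of_pos (Real.exp_pos _), Real.exp_le_exp, neg_le_neg_iff]
  calc b / q * ∑ i, z i ^ 2 ≤ b / q * (q * ‖z‖ ^ 2) := by
        gcongr
        exact sum_sq_le_mul_norm_sq z
    _ = b * ‖z‖ ^ 2 := by field_simp

/-- The integral of the standard Gaussian density without normalization. -/
def gaussConst (q : ℕ) : ℝ := ∫ z : Fin q → ℝ, Real.exp (-(1 / 2 * ∑ i, z i ^ 2))

lemma gaussConst_pos (q : ℕ) : 0 < gaussConst q := by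
  refine (integral_pos_iff_support_of_nonneg (fun z => (Real.exp_pos _).le)
    (integrable_exp_neg_mul_sum_sq (by norm_num))).2 ?_
  have : Function.support (fun z : Fin q → ℝ => Real.exp (-(1 / 2 * ∑ i, z i ^ 2))) = Set.univ := by
    ext z
    simp [(Real.exp_pos _).ne']
  rw [this]
  exact isOpen_univ.measure_pos _ Set.univ_nonempty

/-- Writing `S = Bᵀ B` turns the quadratic form into a sum of squares, so that Gaussian integrals
and lower bounds follow from the linear change of variables `B`. -/
lemma exists_factor {S : Matrix (Fin q) (Fin q) ℝ} (hS : S.PosDef) :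
    ∃ B : Matrix (Fin q) (Fin q) ℝ, B.det ≠ 0 ∧ |B.det| = √S.det ∧
      ∀ z, z ⬝ᵥ (S *ᵥ z) = ∑ i, (B *ᵥ z) i ^ 2 := by
  open scoped MatrixOrder in
  obtain ⟨B, hB⟩ := CStarAlgebra.nonneg_iff_eq_star_mul_self.mp hS.posSemidef.nonneg
  have hBt : S = Bᵀ * B := by
    rw [hB, star_eq_conjTranspose, conjTranspose_eq_transpose_of_trivial]
  have hdet : S.det = B.det ^ 2 := by rw [hBt, det_mul, det_transpose, sq]
  refine ⟨B, ?_, ?_, ?_⟩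
  · intro h0
    have := hS.det_pos
    rw [hdet, h0] at this
    simp at this
  · rw [hdet, Real.sqrt_sq_eq_abs]
  · intro z
    rw [hBt, ← mulVec_mulVec, dotProduct_mulVec, vecMul_transpose]
    simp [dotProduct, sq]

lemma integral_gaussian_posDef {S : Matrix (Fin q) (Fin q) ℝ} (hS : S.PosDef) :
    ∫ z : Fin q → ℝ, Real.exp (-((z ⬝ᵥ (S *ᵥ z)) / 2)) = gaussConst q / √S.det := by
  obtain ⟨B, hB0, hBdet, hB⟩ := exists_factor hS
  simp_rw [hB]
  have hmap := Real.map_matrix_volume_pi_eq_smul_volume_pi hB0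
  have hmeas : Measurable (toLin' B) := (LinearMap.continuous_on_pi _).measurable
  have h := integral_map (μ := volume) hmeas.aemeasurable
    (f := fun z : Fin q → ℝ => Real.exp (-(1 / 2 * ∑ i, z i ^ 2)))
    (by fun_prop : Continuous fun z : Fin q → ℝ =>
      Real.exp (-(1 / 2 * ∑ i, z i ^ 2))).aestronglyMeasurable
  rw [hmap, integral_smul_measure, ENNReal.toReal_ofReal (abs_nonneg _), abs_inv, hBdet] at h
  have h2 : ∀ z, Real.exp (-((∑ i, (B *ᵥ z) i ^ 2) / 2)) =
      Real.exp (-(1 / 2 * ∑ i, (toLin' B z) i ^ 2)) := fun z => by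
    rw [toLin'_apply]
    congr 1
    ring
  simp_rw [h2]
  rw [← h, gaussConst, smul_eq_mul]
  field_simp

lemma exists_quadratic_lower_bound {S : Matrix (Fin q) (Fin q) ℝ} (hS : S.PosDef) :
    ∃ κ : ℝ, 0 < κ ∧ ∀ z, κ * ‖z‖ ^ 2 ≤ z ⬝ᵥ (S *ᵥ z) := by
  obtain ⟨B, hB0, -, hB⟩ := exists_factor hS
  let T : (Fin q → ℝ) →L[ℝ] (Fin q → ℝ) := (toLin' B⁻¹).toContinuousLinearMap
  -- From `z = T (B z)` one gets `‖z‖² ≤ ‖T‖² ‖B z‖²`; the `+ 1` spares a proof that `‖T‖` is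
  -- nonzero.
  refine ⟨1 / (‖T‖ ^ 2 + 1), by positivity, fun z => ?_⟩
  have hz : T (B *ᵥ z) = z := by
    change toLin' B⁻¹ (B *ᵥ z) = z
    rw [toLin'_apply, mulVec_mulVec, nonsing_inv_mul _ (isUnit_iff_ne_zero.2 hB0), one_mulVec]
  have h1 : ‖z‖ ≤ ‖T‖ * ‖B *ᵥ z‖ := by
    conv_lhs => rw [← hz]
    exact T.le_opNorm _
  have h2 := norm_sq_le_sum_sq (B *ᵥ z)
  rw [hB, div_mul_eq_mul_div, one_mul, div_le_iff₀ (by positivity)]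
  calc ‖z‖ ^ 2 ≤ (‖T‖ * ‖B *ᵥ z‖) ^ 2 := by gcongr
    _ = ‖T‖ ^ 2 * ‖B *ᵥ z‖ ^ 2 := by ring
    _ ≤ (‖T‖ ^ 2 + 1) * ∑ i, (B *ᵥ z) i ^ 2 := by gcongr; linarith
    _ = _ := by ring

end Gaussian

/-! ### Laplace asymptotics -/

section Laplace

open Matrix

variable {q : ℕ} [NeZero q] {β : ℝ} {y : Fin q → ℝ}

lemma integrable_exp_neg_mul_mfEnergy (hβ : 0 < β) {t : ℝ} (ht : 0 < t) (c : ℝ) :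
    Integrable fun z : Fin q → ℝ => Real.exp (-(t * (mfEnergy β z - c))) := by
  have h := (integrable_exp_neg_mul_sum_sq (q := q) (b := t * (β / 4)) (by positivity)).const_mul
    (Real.exp (t * (β + Real.log q + c)))
  refine h.mono' ?_ (Eventually.of_forall fun z => ?_)
  · have := continuous_mfEnergy (q := q) β
    exact (by fun_prop : Continuous fun z : Fin q → ℝ =>
      Real.exp (-(t * (mfEnergy β z - c)))).aestronglyMeasurable
  · rw [Real.norm_eq_abs, abs_of_pos (Real.exp_pos _), ← Real.exp_add, Real.exp_le_exp]
    have := mul_le_mul_of_nonneg_left (mfEnergy_ge hβ.le z) ht.le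
    linarith

lemma hessian_isHermitian {q : ℕ} (β : ℝ) (y : Fin q → ℝ) : (hessian β y).IsHermitian := by
  ext i j
  simp only [hessian, conjTranspose_apply, Matrix.add_apply, diagonal_apply, vecMulVec_apply, star_trivial]
  by_cases h : i = j
  · subst h
    rfl
  · rw [if_neg h, if_neg (Ne.symm h)]
    ring

lemma hessian_posDef (hβ : 0 < β) (hy : IsMinimizer β y) (hdet : (hessian β y).det ≠ 0) :
    (hessian β y).PosDef := by
  have hps : (hessian β y).PosSemidef :=
    PosSemidef.of_dotProduct_mulVec_nonneg (hessian_isHermitian β y) fun z => by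
      simpa using hessian_nonneg_of_minimizer hβ hy z
  exact hps.posDef_iff_det_ne_zero.2 hdet

lemma exists_local_lower_bound (hβ : 0 < β) (hy : IsMinimizer β y)
    (hdet : (hessian β y).det ≠ 0) :
    ∃ κ δ : ℝ, 0 < κ ∧ 0 < δ ∧
      ∀ z : Fin q → ℝ, ‖z‖ < δ → κ * ‖z‖ ^ 2 ≤ mfEnergy β (y + z) - mfEnergy β y := by
  obtain ⟨κ, hκ, hlow⟩ := exists_quadratic_lower_bound (hessian_posDef hβ hy hdet)
  -- Half the Hessian form is at least `κ ‖z‖² / 2`; a Taylor error of `κ ‖z‖² / 4` leaves `κ ‖z‖² /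
  -- 4`.
  have ht := (mfEnergy_taylor (eq_softmax_of_minimizer hβ hy)).bound (c := κ / 4) (by positivity)
  obtain ⟨δ, hδ, hball⟩ := Metric.eventually_nhds_iff.1 ht
  refine ⟨κ / 4, δ, by positivity, hδ, fun z hz => ?_⟩
  have h1 := hball (y := z) (by simpa using hz)
  have h2 := hlow z
  rw [Real.norm_eq_abs, Real.norm_eq_abs, abs_of_nonneg (by positivity : 0 ≤ ‖z‖ ^ 2)] at h1
  have h3 := (abs_le.1 h1).1
  linarith

lemma tendsto_rescaled_energy (hβ : 0 < β) (hy : IsMinimizer β y) (z : Fin q → ℝ) :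
    Tendsto (fun n : ℕ => (n : ℝ) * (mfEnergy β (y + (√(n : ℝ))⁻¹ • z) - mfEnergy β y)) atTop
      (𝓝 ((z ⬝ᵥ (hessian β y *ᵥ z)) / 2)) := by
  have hs : Tendsto (fun n : ℕ => (√(n : ℝ))⁻¹) atTop (𝓝 0) :=
    tendsto_inv_atTop_zero.comp (Real.tendsto_sqrt_atTop.comp tendsto_natCast_atTop_atTop)
  have hz : Tendsto (fun n : ℕ => (√(n : ℝ))⁻¹ • z) atTop (𝓝 0) := by
    simpa using hs.smul_const z
  have hlo := (mfEnergy_taylor (eq_softmax_of_minimizer hβ hy)).comp_tendsto hz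
  have hbig : ((fun w : Fin q → ℝ => ‖w‖ ^ 2) ∘ fun n : ℕ => (√(n : ℝ))⁻¹ • z) =O[atTop]
      fun n : ℕ => ((n : ℝ))⁻¹ := by
    refine Asymptotics.IsBigO.of_bound (‖z‖ ^ 2) (Eventually.of_forall fun n => ?_)
    simp only [Function.comp, norm_smul, norm_inv, Real.norm_eq_abs, mul_pow, inv_pow]
    rw [abs_of_nonneg (Real.sqrt_nonneg _), Real.sq_sqrt (Nat.cast_nonneg n),
      abs_of_nonneg (by positivity), abs_of_nonneg (by positivity)]
    exact (mul_comm _ _).le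
  have h0 := (hlo.trans_isBigO hbig).tendsto_div_nhds_zero
  have h1 := h0.add_const ((z ⬝ᵥ (hessian β y *ᵥ z)) / 2)
  rw [zero_add] at h1
  refine h1.congr' ?_
  filter_upwards [eventually_ne_atTop 0] with n hn
  have hn0 : (0 : ℝ) < n := by exact_mod_cast Nat.pos_of_ne_zero hn
  simp only [Function.comp, Matrix.mulVec_smul, smul_dotProduct, dotProduct_smul, smul_eq_mul]
  have hsq : (√(n : ℝ))⁻¹ * ((√(n : ℝ))⁻¹ * (z ⬝ᵥ (hessian β y *ᵥ z))) =
      (n : ℝ)⁻¹ * (z ⬝ᵥ (hessian β y *ᵥ z)) := by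
    rw [← mul_assoc, ← mul_inv, Real.mul_self_sqrt hn0.le]
  rw [hsq]
  field_simp
  ring

/-- Laplace asymptotics near a nondegenerate minimizer. -/
lemma tendsto_local_laplace (hβ : 0 < β) (hy : IsMinimizer β y) (hdet : (hessian β y).det ≠ 0)
    {κ δ : ℝ} (hκ : 0 < κ) (hδ : 0 < δ)
    (hlow : ∀ z : Fin q → ℝ, ‖z‖ < δ → κ * ‖z‖ ^ 2 ≤ mfEnergy β (y + z) - mfEnergy β y)
    {h : (Fin q → ℝ) → ℝ} (hc : Continuous h) {K : ℝ} (hK : ∀ z, |h z| ≤ K) :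
    Tendsto (fun n : ℕ => √(n : ℝ) ^ q *
      ∫ z in Metric.ball y δ, h z * Real.exp (-(n * (mfEnergy β z - mfEnergy β y)))) atTop
      (𝓝 (h y * (gaussConst q / √(hessian β y).det))) := by
  have hG := continuous_mfEnergy (q := q) β
  -- The integrand after zooming in at scale `1 / √n` around `y`; the Jacobian accounts for the
  -- prefactor `√n ^ q`. The local lower bound on the energy dominates it by `K exp (-κ ‖z‖²)`
  -- uniformly in `n ≠ 0`.
  let F : ℕ → (Fin q → ℝ) → ℝ := fun n z =>
    (Metric.ball (0 : Fin q → ℝ) δ).indicator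
      (fun w => h (y + w) * Real.exp (-(n * (mfEnergy β (y + w) - mfEnergy β y))))
      ((√(n : ℝ))⁻¹ • z)
  have hrw : ∀ n : ℕ, √(n : ℝ) ^ q *
      ∫ z in Metric.ball y δ, h z * Real.exp (-(n * (mfEnergy β z - mfEnergy β y))) =
      ∫ z, F n z := by
    intro n
    have hi := Measure.integral_comp_inv_smul_of_nonneg (volume : Measure (Fin q → ℝ))
      ((Metric.ball (0 : Fin q → ℝ) δ).indicator
      (fun w => h (y + w) * Real.exp (-(n * (mfEnergy β (y + w) - mfEnergy β y)))))
      (Real.sqrt_nonneg (n : ℝ))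
    rw [Module.finrank_fin_fun, smul_eq_mul] at hi
    change _ = ∫ z, (Metric.ball (0 : Fin q → ℝ) δ).indicator
      (fun w => h (y + w) * Real.exp (-(n * (mfEnergy β (y + w) - mfEnergy β y))))
      ((√(n : ℝ))⁻¹ • z)
    rw [hi, ← integral_indicator measurableSet_ball]
    congr 1
    rw [← integral_add_left_eq_self _ y]
    congr 1
    funext w
    by_cases hw : w ∈ Metric.ball (0 : Fin q → ℝ) δ
    · rw [Set.indicator_of_mem hw, Set.indicator_of_mem (by simpa using hw)]
    · rw [Set.indicator_of_notMem hw, Set.indicator_of_notMem (by simpa using hw)]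
  simp_rw [hrw]
  have hlim : h y * (gaussConst q / √(hessian β y).det) =
      ∫ z : Fin q → ℝ, h y * Real.exp (-((z ⬝ᵥ (hessian β y *ᵥ z)) / 2)) := by
    rw [integral_const_mul, integral_gaussian_posDef (hessian_posDef hβ hy hdet)]
  rw [hlim]
  refine tendsto_integral_filter_of_dominated_convergence
    (fun z => K * Real.exp (-(κ * ‖z‖ ^ 2))) ?_ ?_
    ((integrable_exp_neg_mul_norm_sq hκ).const_mul K) ?_
  · refine Eventually.of_forall fun n => ?_
    have hm : Measurable ((Metric.ball (0 : Fin q → ℝ) δ).indicator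
        (fun w => h (y + w) * Real.exp (-(n * (mfEnergy β (y + w) - mfEnergy β y))))) := by
      refine Measurable.indicator ?_ measurableSet_ball
      exact (by fun_prop : Continuous fun w : Fin q → ℝ =>
        h (y + w) * Real.exp (-(n * (mfEnergy β (y + w) - mfEnergy β y)))).measurable
    exact (hm.comp (measurable_const_smul _)).aestronglyMeasurable
  · filter_upwards [eventually_ne_atTop 0] with n hn
    refine Eventually.of_forall fun z => ?_
    have hn0 : (0 : ℝ) < n := by exact_mod_cast Nat.pos_of_ne_zero hn
    have hK0 : 0 ≤ K := (abs_nonneg _).trans (hK y)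
    simp only [F]
    by_cases hb : (√(n : ℝ))⁻¹ • z ∈ Metric.ball (0 : Fin q → ℝ) δ
    · rw [Set.indicator_of_mem hb, Real.norm_eq_abs, abs_mul, abs_of_pos (Real.exp_pos _)]
      refine mul_le_mul (hK _) (Real.exp_le_exp.2 (neg_le_neg ?_)) (Real.exp_pos _).le hK0
      have h1 := hlow _ (mem_ball_zero_iff.1 hb)
      have h2 := mul_le_mul_of_nonneg_left h1 hn0.le
      refine le_trans (le_of_eq ?_) h2
      rw [norm_smul, norm_inv, Real.norm_eq_abs, abs_of_nonneg (Real.sqrt_nonneg _), mul_pow,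
        inv_pow, Real.sq_sqrt hn0.le]
      field_simp
    · rw [Set.indicator_of_notMem hb, norm_zero]
      positivity
  · refine Eventually.of_forall fun z => ?_
    have hs : Tendsto (fun n : ℕ => (√(n : ℝ))⁻¹) atTop (𝓝 0) :=
      tendsto_inv_atTop_zero.comp (Real.tendsto_sqrt_atTop.comp tendsto_natCast_atTop_atTop)
    have hz : Tendsto (fun n : ℕ => (√(n : ℝ))⁻¹ • z) atTop (𝓝 0) := by
      simpa using hs.smul_const z
    have hh : Tendsto (fun n : ℕ => h (y + (√(n : ℝ))⁻¹ • z)) atTop (𝓝 (h y)) := by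
      have : Continuous fun w => h (y + w) := by fun_prop
      have h0 := (this.tendsto 0).comp hz
      rw [add_zero] at h0
      exact h0
    have he := (Real.continuous_exp.tendsto _).comp (tendsto_rescaled_energy hβ hy z).neg
    refine (hh.mul he).congr' ?_
    filter_upwards [hz (Metric.ball_mem_nhds 0 hδ)] with n hn
    simp only [F]
    rw [Set.indicator_of_mem (Set.mem_preimage.1 hn)]
    rfl

/-- By coercivity the energy attains its infimum on a nonempty closed set, so a pointwise strict
inequality becomes uniform. -/
lemma exists_energy_gap (hβ : 0 < β) {c : ℝ} {s : Set (Fin q → ℝ)} (hs : IsClosed s)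
    (hc : ∀ z ∈ s, c < mfEnergy β z) : ∃ η : ℝ, 0 < η ∧ ∀ z ∈ s, c + η ≤ mfEnergy β z := by
  rcases s.eq_empty_or_nonempty with rfl | ⟨x₀, hx₀⟩
  · exact ⟨1, one_pos, by simp⟩
  obtain ⟨x, hx, hmin⟩ := (continuous_mfEnergy (q := q) β).continuousOn.exists_isMinOn' hs hx₀
    (((tendsto_mfEnergy_cocompact hβ).eventually_ge_atTop _).filter_mono inf_le_left)
  refine ⟨mfEnergy β x - c, sub_pos.2 (hc x hx), fun z hz => ?_⟩
  have := hmin hz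
  simp only [Set.mem_ofPred_eq] at this
  linarith

/-- The contribution away from the minimizers is negligible. -/
lemma tendsto_tail_laplace (hβ : 0 < β) {c : ℝ} {s : Set (Fin q → ℝ)} (hs : IsClosed s)
    (hc : ∀ z ∈ s, c < mfEnergy β z) {h : (Fin q → ℝ) → ℝ} {K : ℝ}
    (hK : ∀ z, |h z| ≤ K) :
    Tendsto (fun n : ℕ => √(n : ℝ) ^ q *
      ∫ z in s, h z * Real.exp (-(n * (mfEnergy β z - c)))) atTop (𝓝 0) := by
  obtain ⟨η, hη, hgap⟩ := exists_energy_gap hβ hs hc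
  have hK0 : 0 ≤ K := (abs_nonneg _).trans (hK 0)
  set I := ∫ z in s, Real.exp (-(1 * (mfEnergy β z - c))) with hI
  have hint := integrable_exp_neg_mul_mfEnergy (q := q) hβ one_pos c
  have hI0 : 0 ≤ I := integral_nonneg fun z => (Real.exp_pos _).le
  have hbound : ∀ n : ℕ, 1 ≤ n → ‖√(n : ℝ) ^ q *
      ∫ z in s, h z * Real.exp (-(n * (mfEnergy β z - c)))‖ ≤
      (n : ℝ) ^ q * Real.exp (-η) ^ n * (K * Real.exp η * I) := by
    intro n hn
    have hn1 : (1 : ℝ) ≤ n := by exact_mod_cast hn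
    -- One of the `n` factors `exp (-(G - c))` is kept for integrability; the other `n - 1` are each
    -- at most `exp (-η)`, an exponential decay that beats the power of `n`.
    have h1 : ‖∫ z in s, h z * Real.exp (-(n * (mfEnergy β z - c)))‖ ≤
        ∫ z in s, K * Real.exp (-((n - 1) * η)) * Real.exp (-(1 * (mfEnergy β z - c))) := by
      refine norm_integral_le_of_norm_le (hint.integrableOn.const_mul _) ?_
      refine (ae_restrict_iff' hs.measurableSet).2 (Eventually.of_forall fun z hz => ?_)
      rw [Real.norm_eq_abs, abs_mul, abs_of_pos (Real.exp_pos _), mul_assoc, ← Real.exp_add]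
      refine mul_le_mul (hK z) (Real.exp_le_exp.2 ?_) (Real.exp_pos _).le hK0
      have := mul_le_mul_of_nonneg_left (sub_nonneg.2 (hgap z hz)) (sub_nonneg.2 hn1)
      linarith
    rw [integral_const_mul] at h1
    rw [norm_mul, norm_pow, Real.norm_eq_abs, abs_of_nonneg (Real.sqrt_nonneg _)]
    have h2 : √(n : ℝ) ≤ n := by
      rw [Real.sqrt_le_left (by linarith)]
      nlinarith
    have h3 : Real.exp (-((n - 1) * η)) = Real.exp (-η) ^ n * Real.exp η := by
      rw [← Real.exp_nat_mul, ← Real.exp_add]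
      congr 1
      ring
    calc √(n : ℝ) ^ q * ‖∫ z in s, h z * Real.exp (-(n * (mfEnergy β z - c)))‖
        ≤ (n : ℝ) ^ q * (K * Real.exp (-((n - 1) * η)) * I) := by gcongr
      _ = _ := by rw [h3]; ring
  have hlt : |Real.exp (-η)| < 1 := by
    rw [abs_of_pos (Real.exp_pos _), Real.exp_lt_one_iff]
    linarith
  have hz := (tendsto_pow_const_mul_const_pow_of_abs_lt_one q hlt).mul_const (K * Real.exp η * I)
  rw [zero_mul] at hz
  refine squeeze_zero_norm' ?_ hz
  filter_upwards [eventually_ge_atTop 1] with n hn using hbound n hn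

/-- Laplace asymptotics for finitely many nondegenerate minimizers. -/
theorem tendsto_laplace (hβ : 0 < β) {ι : Type*} [Fintype ι] [Nonempty ι] {m : ι → Fin q → ℝ}
    (hinj : Function.Injective m) (hm : ∀ y, IsMinimizer β y ↔ ∃ i, y = m i)
    (hdet : ∀ i, (hessian β (m i)).det ≠ 0) {c : ℝ} (hcm : ∀ i, mfEnergy β (m i) = c)
    {h : (Fin q → ℝ) → ℝ} (hc : Continuous h) {K : ℝ} (hK : ∀ z, |h z| ≤ K) :
    Tendsto (fun n : ℕ => √(n : ℝ) ^ q * ∫ z, h z * Real.exp (-(n * (mfEnergy β z - c)))) atTop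
      (𝓝 (∑ i, h (m i) * (gaussConst q / √(hessian β (m i)).det))) := by
  have hG := continuous_mfEnergy (q := q) β
  have hmin : ∀ i, IsMinimizer β (m i) := fun i => (hm _).2 ⟨i, rfl⟩
  choose κ δ hκ hδ hlow using fun i => exists_local_lower_bound hβ (hmin i) (hdet i)
  obtain ⟨ε, hε, hdisj⟩ : ∃ ε : ℝ, 0 < ε ∧ ∀ i j, i ≠ j →
      Disjoint (Metric.ball (m i) ε) (Metric.ball (m j) ε) := by
    have hsep : ∃ ε : ℝ, 0 < ε ∧ ∀ i j, i ≠ j → 2 * ε ≤ dist (m i) (m j) := by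
      classical
      have hev : ∀ᶠ ε : ℝ in 𝓝[>] 0, ∀ p : ι × ι, p.1 ≠ p.2 → 2 * ε ≤ dist (m p.1) (m p.2) := by
        refine eventually_all.2 fun p => ?_
        by_cases hp : p.1 = p.2
        · exact Eventually.of_forall fun ε hne => absurd hp hne
        · have hd : 0 < dist (m p.1) (m p.2) := dist_pos.2 (hinj.ne hp)
          have : ∀ᶠ ε : ℝ in 𝓝 0, ε < dist (m p.1) (m p.2) / 2 :=
            Iio_mem_nhds (by positivity)
          filter_upwards [this.filter_mono nhdsWithin_le_nhds] with ε hε _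
          linarith
      obtain ⟨ε, hε1, hε2⟩ := (hev.and self_mem_nhdsWithin).exists
      exact ⟨ε, hε2, fun i j hij => hε1 (i, j) hij⟩
    obtain ⟨ε, hε, hsep⟩ := hsep
    exact ⟨ε, hε, fun i j hij => Metric.ball_disjoint_ball (by linarith [hsep i j hij])⟩
  let ρ : ι → ℝ := fun i => min (δ i) ε
  have hρ : ∀ i, 0 < ρ i := fun i => lt_min (hδ i) hε
  let B : ι → Set (Fin q → ℝ) := fun i => Metric.ball (m i) (ρ i)
  have hBdisj : Pairwise (Function.onFun Disjoint B) := fun i j hij =>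
    (hdisj i j hij).mono (Metric.ball_subset_ball (min_le_right _ _))
      (Metric.ball_subset_ball (min_le_right _ _))
  have hloc : ∀ i, Tendsto (fun n : ℕ => √(n : ℝ) ^ q *
      ∫ z in B i, h z * Real.exp (-(n * (mfEnergy β z - c)))) atTop
      (𝓝 (h (m i) * (gaussConst q / √(hessian β (m i)).det))) := by
    intro i
    have := tendsto_local_laplace hβ (hmin i) (hdet i) (hκ i) (hρ i)
      (fun z hz => hlow i z (hz.trans_le (min_le_left _ _))) hc hK
    rw [hcm i] at this
    exact this
  have hopen : IsOpen (⋃ i, B i) := isOpen_iUnion fun i => Metric.isOpen_ball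
  -- A point outside the balls with energy `c` would itself be a minimizer, hence the centre of one
  -- of the balls.
  have htail := tendsto_tail_laplace hβ (c := c) hopen.isClosed_compl (fun z hz => by
    obtain ⟨i₀⟩ := ‹Nonempty ι›
    have hle : c ≤ mfEnergy β z := hcm i₀ ▸ hmin i₀ z
    refine hle.lt_of_ne fun heq => hz ?_
    have hzmin : IsMinimizer β z := fun w => by
      rw [← heq, ← hcm i₀]
      exact hmin i₀ w
    obtain ⟨i, rfl⟩ := (hm z).1 hzmin
    exact Set.mem_iUnion.2 ⟨i, Metric.mem_ball_self (hρ i)⟩) hK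
  have hsum := (tendsto_finsetSum Finset.univ fun i _ => hloc i).add htail
  rw [add_zero] at hsum
  refine hsum.congr' ?_
  filter_upwards [eventually_ne_atTop 0] with n hn
  have hn0 : (0 : ℝ) < n := by exact_mod_cast Nat.pos_of_ne_zero hn
  have hint : Integrable fun z : Fin q → ℝ => h z * Real.exp (-(n * (mfEnergy β z - c))) :=
    (integrable_exp_neg_mul_mfEnergy hβ hn0 c).bdd_mul hc.aestronglyMeasurable
      (Eventually.of_forall hK)
  rw [← Finset.mul_sum, ← mul_add, ← integral_iUnion_fintype (fun i => measurableSet_ball) hBdisj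
    fun i => hint.integrableOn, integral_add_compl hopen.measurableSet hint]

end Laplace

/-! ### Determinant of the Hessian at ordered points -/

section HessianDet

open Matrix

variable {q : ℕ}

/-- The determinant of the Hessian at the weights with order parameter `s`. -/
lemma det_hessian_orderPoint (hq : 2 < q) [NeZero q] {β s : ℝ} (hβ : β ≠ 0) (k : Fin q)
    (hne : 1 - β * ((1 - s) / q) ≠ 0) :
    (hessian β (orderPoint k s)).det = β ^ q * (1 - β * ((1 - s) / q)) ^ (q - 2) *
      (1 - β * ((1 + ((q : ℝ) - 1) * s) * (1 - s) / q)) := by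
  have hq0 : (q : ℝ) ≠ 0 := by exact_mod_cast NeZero.ne q
  set b : ℝ := (1 - s) / q with hb
  set p := orderPoint k s with hp
  have hpi : ∀ i, p i = b + if i = k then s else 0 := orderPoint_eq_add k s
  set l : ℝ := β * (1 - β * b) with hl
  have hl0 : l ≠ 0 := mul_ne_zero hβ hne
  -- The Hessian is the scalar matrix `l • 1` plus a rank two perturbation `U * V`: one rank for the
  -- exceptional diagonal entry, one for the outer product of `p`. The matrix determinant lemma
  -- reduces the problem to a 2 × 2 determinant.
  let U : Matrix (Fin q) (Fin 2) ℝ := of fun i => ![if i = k then 1 else 0, p i]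
  let V : Matrix (Fin 2) (Fin q) ℝ :=
    of ![fun j => if j = k then -(β ^ 2 * s) else 0, fun j => β ^ 2 * p j]
  have hdecomp : hessian β p = l • (1 : Matrix (Fin q) (Fin q) ℝ) + U * V := by
    ext i j
    simp only [hessian, Matrix.add_apply, diagonal_apply, vecMulVec_apply, Matrix.smul_apply,
      Matrix.one_apply, mul_apply, Fin.sum_univ_two, U, V, of_apply, cons_val_zero, cons_val_one,
      smul_eq_mul]
    by_cases hij : i = j
    · subst hij
      by_cases hik : i = k
      · simp [hpi, hik, hl]
        ring
      · simp [hpi, hik, hl]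
        ring
    · by_cases hik : i = k
      · have hjk : j ≠ k := fun h => hij (hik.trans h.symm)
        simp [hij, hjk]
        ring
      · simp [hij, hik]
        ring
  have hAdet : (l • (1 : Matrix (Fin q) (Fin q) ℝ)).det = l ^ q := by simp
  have hAinv : (l • (1 : Matrix (Fin q) (Fin q) ℝ))⁻¹ = l⁻¹ • 1 := by
    refine inv_eq_left_inv ?_
    rw [smul_mul_smul_comm, inv_mul_cancel₀ hl0, one_smul, one_mul]
  have hsq : ∑ i, p i * p i = (1 + ((q : ℝ) - 1) * s ^ 2) / q := by
    rw [← sum_orderPoint_sq k s]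
    exact Finset.sum_congr rfl fun i _ => by rw [← hp]; ring
  have hpk : p k = b + s := by rw [hpi, if_pos rfl]
  have hVU : V * U = !![-(β ^ 2 * s), -(β ^ 2 * s) * (b + s); β ^ 2 * (b + s),
      β ^ 2 * ((1 + ((q : ℝ) - 1) * s ^ 2) / q)] := by
    ext i j
    fin_cases i <;> fin_cases j
    · simp [mul_apply, U, V]
    · simp [mul_apply, U, V, hpk]
    · simp [mul_apply, U, V, hpk]
    · simp [mul_apply, U, V, mul_assoc, ← Finset.mul_sum, hsq]
  rw [hdecomp, det_add_mul U V (by rw [hAdet]; exact (isUnit_iff_ne_zero.2 hl0).pow q), hAdet,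
    hAinv, Matrix.mul_smul, Matrix.smul_mul, Matrix.mul_one, hVU]
  have hlq : l ^ q = l ^ (q - 2) * l ^ 2 := by rw [← pow_add]; congr 1; omega
  have hβq : β ^ q = β ^ (q - 2) * β ^ 2 := by rw [← pow_add]; congr 1; omega
  rw [hlq, hβq, det_fin_two]
  simp only [Matrix.add_apply, Matrix.smul_apply, of_apply, cons_val', cons_val_zero, cons_val_one,
    Matrix.one_apply, smul_eq_mul, Fin.isValue, cons_val_fin_one, if_true, zero_ne_one, one_ne_zero,
    if_false]
  have hll : l ^ (q - 2) = β ^ (q - 2) * (1 - β * b) ^ (q - 2) := by rw [hl, mul_pow]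
  have hfin : l ^ 2 * ((1 + l⁻¹ * -(β ^ 2 * s)) *
      (1 + l⁻¹ * (β ^ 2 * ((1 + ((q : ℝ) - 1) * s ^ 2) / q))) -
      (0 + l⁻¹ * (-(β ^ 2 * s) * (b + s))) * (0 + l⁻¹ * (β ^ 2 * (b + s)))) =
      β ^ 2 * (1 - β * ((1 + ((q : ℝ) - 1) * s) * (1 - s) / q)) := by
    have : l ^ 2 * ((1 + l⁻¹ * -(β ^ 2 * s)) *
      (1 + l⁻¹ * (β ^ 2 * ((1 + ((q : ℝ) - 1) * s ^ 2) / q))) -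
      (0 + l⁻¹ * (-(β ^ 2 * s) * (b + s))) * (0 + l⁻¹ * (β ^ 2 * (b + s)))) =
      (l - β ^ 2 * s) * (l + β ^ 2 * ((1 + ((q : ℝ) - 1) * s ^ 2) / q)) +
        β ^ 4 * s * (b + s) ^ 2 := by
      field_simp
      ring
    rw [this, hl, hb]
    field_simp
    ring
  rw [hll, ← mul_assoc]
  calc _ = β ^ (q - 2) * (1 - β * b) ^ (q - 2) * (l ^ 2 * ((1 + l⁻¹ * -(β ^ 2 * s)) *
      (1 + l⁻¹ * (β ^ 2 * ((1 + ((q : ℝ) - 1) * s ^ 2) / q))) -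
      (0 + l⁻¹ * (-(β ^ 2 * s) * (b + s))) * (0 + l⁻¹ * (β ^ 2 * (b + s))))) := by ring
    _ = _ := by rw [hfin]; ring

end HessianDet

/-! ### Hubbard–Stratonovich transform -/

section Hubbard

variable {q : ℕ} {β : ℝ}

/-- The number of occurrences of a letter in a word. -/
def letterCount {n : ℕ} (w : Fin n → Fin q) (c : Fin q) : ℝ := ∑ i, if w i = c then 1 else 0

lemma sum_letterCount_mul {n : ℕ} (w : Fin n → Fin q) (y : Fin q → ℝ) :
    ∑ c, letterCount w c * y c = ∑ i, y (w i) := by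
  simp_rw [letterCount, Finset.sum_mul]
  rw [Finset.sum_comm]
  exact Finset.sum_congr rfl fun i _ => by simp

lemma hamiltonian_eq {n : ℕ} (w : Fin n → Fin q) :
    hamiltonian w = -(1 / (2 * (n : ℝ))) * ∑ c, letterCount w c ^ 2 := by
  rw [hamiltonian]
  congr 1
  simp_rw [sq]
  rw [sum_letterCount_mul w (letterCount w)]
  rfl

/-- The Gaussian weight of a word and a field. -/
def fieldWeight (β : ℝ) {n : ℕ} (w : Fin n → Fin q) (y : Fin q → ℝ) : ℝ :=
  Real.exp (-(n * β / 2 * ∑ c, y c ^ 2) + β * ∑ i, y (w i))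

/-- Completing the square around the empirical letter frequencies; what is left over is exactly the
Boltzmann weight of the word, so integrating out `y` recovers it up to a constant independent of
`w`. -/
lemma fieldWeight_eq {n : ℕ} (hn : n ≠ 0) (w : Fin n → Fin q) (y : Fin q → ℝ) :
    fieldWeight β w y = Real.exp (-β * hamiltonian w) *
      Real.exp (-(n * β / 2 * ∑ c, (y + fun c => -(letterCount w c / n)) c ^ 2)) := by
  have hn0 : (n : ℝ) ≠ 0 := by exact_mod_cast hn
  rw [fieldWeight, ← Real.exp_add, hamiltonian_eq, ← sum_letterCount_mul]
  congr 1
  have h1 : ∀ c, (y + fun c => -(letterCount w c / (n : ℝ))) c ^ 2 =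
      y c ^ 2 - 2 / n * (letterCount w c * y c) + 1 / (n : ℝ) ^ 2 * letterCount w c ^ 2 := by
    intro c
    simp only [Pi.add_apply]
    field_simp
    ring
  simp_rw [h1]
  rw [Finset.sum_add_distrib, Finset.sum_sub_distrib, ← Finset.mul_sum, ← Finset.mul_sum]
  field_simp
  ring

lemma integrable_fieldWeight (hβ : 0 < β) {n : ℕ} (hn : n ≠ 0) (w : Fin n → Fin q) :
    Integrable (fieldWeight β w) := by
  have hn0 : (0 : ℝ) < n := by exact_mod_cast Nat.pos_of_ne_zero hn
  have h := integrable_exp_neg_mul_sum_sq (q := q) (b := n * β / 2) (by positivity)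
  have h2 := (h.comp_add_right fun c => -(letterCount w c / n)).const_mul
    (Real.exp (-β * hamiltonian w))
  exact h2.congr (Eventually.of_forall fun y => (fieldWeight_eq hn w y).symm)

lemma integral_fieldWeight {n : ℕ} (hn : n ≠ 0) (w : Fin n → Fin q) :
    ∫ y, fieldWeight β w y = Real.exp (-β * hamiltonian w) *
      ∫ y : Fin q → ℝ, Real.exp (-(n * β / 2 * ∑ c, y c ^ 2)) := by
  simp_rw [fieldWeight_eq hn w]
  rw [integral_const_mul, integral_add_right_eq_self
    (fun y : Fin q → ℝ => Real.exp (-(n * β / 2 * ∑ c, y c ^ 2)))]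

/-- For a fixed field the weight factorizes over letters. Each suffix letter contributes `expSum β
y`, and normalizing the prefix letters by the same quantity yields the softmax product and `exp (-n
G)`. -/
lemma sum_fieldWeight_append [NeZero q] {m l : ℕ} (u : Fin m → Fin q) (y : Fin q → ℝ) :
    ∑ v : Fin l → Fin q, fieldWeight β (Fin.append u v) y =
      (∏ i, softmax β y (u i)) * Real.exp (-((m + l : ℕ) * mfEnergy β y)) := by
  have hE := expSum_pos β y
  have h1 : ∀ v : Fin l → Fin q, fieldWeight β (Fin.append u v) y =
      Real.exp (-((m + l : ℕ) * β / 2 * ∑ c, y c ^ 2)) * (∏ i, Real.exp (β * y (u i))) *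
        ∏ i, Real.exp (β * y (v i)) := by
    intro v
    rw [fieldWeight, Fin.sum_univ_add, ← Real.exp_sum, ← Real.exp_sum, ← Real.exp_add,
      ← Real.exp_add]
    simp only [Fin.append_left, Fin.append_right]
    rw [mul_add, ← Finset.mul_sum, ← Finset.mul_sum, ← add_assoc]
  have h2 : ∑ v : Fin l → Fin q, ∏ i, Real.exp (β * y (v i)) = expSum β y ^ l := by
    have := (Finset.prod_univ_sum (fun _ : Fin l => (Finset.univ : Finset (Fin q)))
      fun _ a => Real.exp (β * y a)).symm
    rw [Fintype.piFinset_univ] at this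
    rw [this]
    simp [expSum]
  have h3 : Real.exp (-((m + l : ℕ) * mfEnergy β y)) =
      Real.exp (-((m + l : ℕ) * β / 2 * ∑ c, y c ^ 2)) * expSum β y ^ (m + l) := by
    conv_rhs => rw [← Real.exp_log hE, ← Real.exp_nat_mul, ← Real.exp_add]
    rw [mfEnergy]
    congr 1
    ring
  simp_rw [h1]
  rw [← Finset.mul_sum, h2, h3]
  simp_rw [softmax]
  rw [Finset.prod_div_distrib]
  simp only [Finset.prod_const, Finset.card_univ, Fintype.card_fin, pow_add]
  field_simp

/-- The partial partition function of the words with a given prefix. -/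
lemma sum_exp_hamiltonian_append [NeZero q] (hβ : 0 < β) {m l : ℕ} (hml : m + l ≠ 0)
    (u : Fin m → Fin q) :
    (∑ v : Fin l → Fin q, Real.exp (-β * hamiltonian (Fin.append u v))) *
      (∫ y : Fin q → ℝ, Real.exp (-((m + l : ℕ) * β / 2 * ∑ c, y c ^ 2))) =
      ∫ y : Fin q → ℝ, (∏ i, softmax β y (u i)) * Real.exp (-((m + l : ℕ) * mfEnergy β y)) := by
  simp_rw [← sum_fieldWeight_append]
  rw [integral_finsetSum _ fun v _ => integrable_fieldWeight hβ hml _, Finset.sum_mul]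
  exact Finset.sum_congr rfl fun v _ => (integral_fieldWeight hml _).symm

lemma sum_append_eq {m l : ℕ} {α : Type*} [AddCommMonoid α] (φ : (Fin (m + l) → Fin q) → α) :
    ∑ u : Fin m → Fin q, ∑ v : Fin l → Fin q, φ (Fin.append u v) = ∑ w, φ w := by
  rw [← (Fin.appendEquiv m l).sum_comp, Fintype.sum_prod_type]
  rfl

lemma sum_exp_hamiltonian [NeZero q] (hβ : 0 < β) {n : ℕ} (hn : n ≠ 0) :
    (∑ w : Fin n → Fin q, Real.exp (-β * hamiltonian w)) *
      (∫ y : Fin q → ℝ, Real.exp (-(n * β / 2 * ∑ c, y c ^ 2))) =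
      ∫ y : Fin q → ℝ, Real.exp (-(n * mfEnergy β y)) := by
  -- The full partition function is the case of the empty prefix.
  obtain ⟨l, rfl⟩ : ∃ l, n = 0 + l := ⟨n, (zero_add n).symm⟩
  have h := sum_exp_hamiltonian_append (q := q) hβ hn (fun i : Fin 0 => i.elim0)
  rw [← sum_append_eq (m := 0), Fintype.sum_subsingleton _ fun i : Fin 0 => i.elim0]
  simpa only [Finset.univ_eq_empty, Finset.prod_empty, one_mul] using h

lemma lintegral_word (hq : 0 < q) (n : ℕ) (φ : (Fin n → Fin q) → ℝ≥0∞) :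
    ∫⁻ x, φ (word n x) ∂uniformBernoulli q = ∑ w, φ w * ENNReal.ofReal (1 / (q : ℝ) ^ n) := by
  have hq0 : (q : ℝ) ≠ 0 := by exact_mod_cast hq.ne'
  have h1 : ∑ _i : Fin q, 1 / (q : ℝ) = 1 := by simp [hq0]
  rw [← lintegral_map (measurable_of_finite φ) (measurable_word n), lintegral_fintype]
  refine Finset.sum_congr rfl fun w _ => ?_
  rw [Measure.map_apply (measurable_word n) (measurableSet_singleton w), uniformBernoulli_eq hq,
    bernoulli_word (fun _ => by positivity) h1]
  simp

lemma partitionFunction_pos (hq : 0 < q) (n : ℕ) (β : ℝ) : 0 < partitionFunction q n β := by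
  have : NeZero q := ⟨hq.ne'⟩
  have hq0 : (0 : ℝ) < q := by exact_mod_cast hq
  exact mul_pos (by positivity)
    (Finset.sum_pos (fun w _ => Real.exp_pos _) Finset.univ_nonempty)

lemma isProbabilityMeasure_gibbs (hq : 0 < q) (n : ℕ) (β : ℝ) :
    IsProbabilityMeasure (gibbs q n β) := by
  have hZ := partitionFunction_pos hq n β
  constructor
  rw [gibbs, withDensity_apply _ MeasurableSet.univ, Measure.restrict_univ]
  refine (lintegral_word hq n fun w =>
    ENNReal.ofReal (Real.exp (-β * hamiltonian w) / partitionFunction q n β)).trans ?_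
  simp_rw [← ENNReal.ofReal_mul (div_nonneg (Real.exp_pos _).le hZ.le)]
  rw [← ENNReal.ofReal_sum_of_nonneg fun w _ => by positivity, ← Finset.sum_mul, ← Finset.sum_div,
    div_mul_eq_mul_div, mul_comm, ← partitionFunction, div_self hZ.ne', ENNReal.ofReal_one]

lemma gibbs_word (hq : 0 < q) {m l : ℕ} (u : Fin m → Fin q) :
    gibbs q (m + l) β (word m ⁻¹' {u}) =
      ENNReal.ofReal ((∑ v : Fin l → Fin q, Real.exp (-β * hamiltonian (Fin.append u v))) /
        ∑ w : Fin (m + l) → Fin q, Real.exp (-β * hamiltonian w)) := by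
  have hZ := partitionFunction_pos hq (m + l) β
  have hq0 : (0 : ℝ) < q := by exact_mod_cast hq
  have hms : MeasurableSet (word (q := q) m ⁻¹' {u}) := measurable_word m (measurableSet_singleton u)
  rw [gibbs, withDensity_apply _ hms, ← lintegral_indicator hms]
  classical
  let φ : (Fin (m + l) → Fin q) → ℝ≥0∞ := fun w => if (fun i => w (Fin.castAdd l i)) = u then
    ENNReal.ofReal (Real.exp (-β * hamiltonian w) / partitionFunction q (m + l) β) else 0
  have hfun : ∀ x : Shift q, (word m ⁻¹' {u}).indicator (fun x : Shift q =>
      ENNReal.ofReal (Real.exp (-β * hamiltonian (fun i : Fin (m + l) => x i)) /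
        partitionFunction q (m + l) β)) x =
      φ (word (m + l) x) := by
    intro x
    by_cases hx : word m x = u
    · rw [Set.indicator_of_mem (by exact hx)]
      exact (if_pos hx).symm
    · rw [Set.indicator_of_notMem (by exact hx)]
      exact (if_neg hx).symm
  rw [lintegral_congr hfun, lintegral_word hq (m + l) φ, ← sum_append_eq]
  simp only [φ, Fin.append_left]
  rw [Finset.sum_eq_single u]
  · simp only [if_true]
    simp_rw [← ENNReal.ofReal_mul (div_nonneg (Real.exp_pos _).le hZ.le)]
    rw [← ENNReal.ofReal_sum_of_nonneg fun w _ => by positivity, ← Finset.sum_mul, ← Finset.sum_div]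
    congr 1
    rw [partitionFunction]
    have : ∑ w : Fin (m + l) → Fin q, Real.exp (-β * hamiltonian w) ≠ 0 := by
      intro h0
      rw [partitionFunction, h0, mul_zero] at hZ
      exact lt_irrefl _ hZ
    field_simp
  · intro u' _ hne
    exact Finset.sum_eq_zero fun v _ => by simp [hne]
  · simp

/-- The Gaussian normalization and the factor `exp (n c)` cancel in the ratio. The constant `c` will
be the minimal energy, and the factor `1` makes the denominator an instance of `tendsto_laplace`. -/
lemma gibbs_word_eq_integral (hβ : 0 < β) [NeZero q] {m n : ℕ} (hmn : m ≤ n) (hn : n ≠ 0) (c : ℝ)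
    (u : Fin m → Fin q) : gibbs q n β (word m ⁻¹' {u}) =
      ENNReal.ofReal ((∫ y : Fin q → ℝ, (∏ i, softmax β y (u i)) *
        Real.exp (-(n * (mfEnergy β y - c)))) /
        ∫ y : Fin q → ℝ, 1 * Real.exp (-(n * (mfEnergy β y - c)))) := by
  obtain ⟨l, rfl⟩ := Nat.exists_eq_add_of_le hmn
  have hq : 0 < q := Nat.pos_of_ne_zero (NeZero.ne q)
  have hn0 : (0 : ℝ) < (m + l : ℕ) := by exact_mod_cast Nat.pos_of_ne_zero hn
  have hexp : ∀ y : Fin q → ℝ, Real.exp (-((m + l : ℕ) * (mfEnergy β y - c))) =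
      Real.exp (-((m + l : ℕ) * mfEnergy β y)) * Real.exp ((m + l : ℕ) * c) := by
    intro y
    rw [← Real.exp_add]
    congr 1
    ring
  have hK : 0 < ∫ y : Fin q → ℝ, Real.exp (-((m + l : ℕ) * β / 2 * ∑ c, y c ^ 2)) := by
    refine (integral_pos_iff_support_of_nonneg (fun z => (Real.exp_pos _).le)
      (integrable_exp_neg_mul_sum_sq (by positivity))).2 ?_
    have : Function.support (fun y : Fin q → ℝ =>
        Real.exp (-((m + l : ℕ) * β / 2 * ∑ c, y c ^ 2))) = Set.univ := by
      ext z
      simp [(Real.exp_pos _).ne']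
    rw [this]
    exact isOpen_univ.measure_pos _ Set.univ_nonempty
  rw [gibbs_word hq]
  congr 1
  simp_rw [hexp, one_mul, ← mul_assoc]
  rw [integral_mul_const, integral_mul_const, mul_div_mul_right _ _ (Real.exp_pos _).ne',
    ← sum_exp_hamiltonian_append hβ hn, ← sum_exp_hamiltonian hβ hn, mul_div_mul_right _ _ hK.ne']

end Hubbard

/-! ### Weak convergence -/

section WeakConvergence

variable {q : ℕ} {β : ℝ}

lemma exists_word_subset {U : Set (Shift q)} (hU : IsOpen U) {x : Shift q} (hx : x ∈ U) :
    ∃ m, word m ⁻¹' {word m x} ⊆ U := by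
  obtain ⟨I, t, ht, hsub⟩ := isOpen_pi_iff.1 hU x hx
  refine ⟨I.sup id + 1, fun z hz => hsub fun i hi => ?_⟩
  have hlt : i < I.sup id + 1 := Nat.lt_succ_of_le (Finset.le_sup (f := id) hi)
  have hzi : z i = x i := congrFun hz ⟨i, hlt⟩
  rw [hzi]
  exact (ht i hi).2

lemma isOpen_preimage_word (m : ℕ) (S : Set (Fin m → Fin q)) :
    IsOpen (word (q := q) m ⁻¹' S) := by
  have : Continuous (word (q := q) m) := continuous_pi fun i => continuous_apply _
  exact (isOpen_discrete S).preimage this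

/-- Convergence of word frequencies implies weak convergence. -/
lemma weaklyConverges_of_word {P : ℕ → Measure (Shift q)} {Q : Measure (Shift q)}
    (hP : ∀ n, IsProbabilityMeasure (P n)) (hQ : IsProbabilityMeasure Q)
    (h : ∀ m u, Tendsto (fun n => P n (word m ⁻¹' {u})) atTop (𝓝 (Q (word m ⁻¹' {u})))) :
    WeaklyConverges P Q := by
  refine ⟨fun n => ⟨P n, hP n⟩, ⟨Q, hQ⟩, fun _ => rfl, rfl, ?_⟩
  refine IsPiSystem.tendsto_probabilityMeasure_of_tendsto_of_mem
    (isPiSystem_measurableCylinders (α := fun _ : ℕ => Fin q))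
    (fun s hs => MeasurableSet.of_mem_measurableCylinders hs) ?_ ?_
  · intro U hU x hx
    obtain ⟨m, hm⟩ := exists_word_subset hU hx
    exact ⟨_, mem_measurableCylinders_iff.2 ⟨m, {word m x}, rfl⟩,
      (isOpen_preimage_word m _).mem_nhds rfl, hm⟩
  · intro s hs
    obtain ⟨m, S, rfl⟩ := mem_measurableCylinders_iff.1 hs
    have hE : Tendsto (fun n => P n (word m ⁻¹' S)) atTop (𝓝 (Q (word m ⁻¹' S))) := by
      simp_rw [measure_preimage_word _ m S]
      exact tendsto_finsetSum _ fun u _ => h m u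
    exact (ENNReal.tendsto_toNNReal (measure_ne_top Q _)).comp hE

/-- Weak convergence of the Gibbs measures to a mixture of Bernoulli measures. -/
theorem weaklyConverges_gibbs [NeZero q] (hβ : 0 < β) {ι : Type*} [Fintype ι] [Nonempty ι]
    {p : ι → Fin q → ℝ} (hinj : Function.Injective p)
    (hp : ∀ y, IsMinimizer β y ↔ ∃ i, y = p i) (hdet : ∀ i, (hessian β (p i)).det ≠ 0) :
    WeaklyConverges (fun n => gibbs q n β)
      (∑ i, ENNReal.ofReal ((√(hessian β (p i)).det)⁻¹ / ∑ j, (√(hessian β (p j)).det)⁻¹) •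
        bernoulli (p i)) := by
  have hq : 0 < q := Nat.pos_of_ne_zero (NeZero.ne q)
  have hmin : ∀ i, IsMinimizer β (p i) := fun i => (hp _).2 ⟨i, rfl⟩
  have hsm : ∀ i a, softmax β (p i) a = p i a := fun i => eq_softmax_of_minimizer hβ (hmin i)
  have hpos : ∀ i a, 0 ≤ p i a := fun i a => hsm i a ▸ (softmax_pos β (p i) a).le
  have hsum1 : ∀ i, ∑ a, p i a = 1 := fun i => by
    rw [← sum_softmax β (p i)]
    exact Finset.sum_congr rfl fun a _ => (hsm i a).symm
  obtain ⟨i₀⟩ := ‹Nonempty ι›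
  have hcm : ∀ i, mfEnergy β (p i) = mfEnergy β (p i₀) := fun i =>
    le_antisymm (hmin i _) (hmin i₀ _)
  set d : ι → ℝ := fun i => (√(hessian β (p i)).det)⁻¹ with hd
  have hd0 : ∀ i, 0 < d i := fun i =>
    inv_pos.2 (Real.sqrt_pos.2 (hessian_posDef hβ (hmin i) (hdet i)).det_pos)
  have hD : 0 < ∑ i, d i := Finset.sum_pos (fun i _ => hd0 i) ⟨i₀, Finset.mem_univ _⟩
  have hprob : ∀ i, IsProbabilityMeasure (bernoulli (p i)) := fun i =>
    isProbabilityMeasure_bernoulli (hpos i) (hsum1 i)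
  have hQ : IsProbabilityMeasure
      (∑ i, ENNReal.ofReal (d i / ∑ j, d j) • bernoulli (p i)) := by
    constructor
    rw [Measure.finsetSum_apply]
    simp only [Measure.smul_apply, measure_univ, smul_eq_mul, mul_one]
    rw [← ENNReal.ofReal_sum_of_nonneg fun i _ => (div_pos (hd0 i) hD).le, ← Finset.sum_div,
      div_self hD.ne', ENNReal.ofReal_one]
  refine weaklyConverges_of_word (fun n => isProbabilityMeasure_gibbs hq n β) hQ fun m u => ?_
  have hbd : ∀ y : Fin q → ℝ, |∏ i, softmax β y (u i)| ≤ 1 := fun y => by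
    rw [abs_of_nonneg (Finset.prod_nonneg fun i _ => (softmax_pos β y _).le)]
    refine Finset.prod_le_one (fun i _ => (softmax_pos β y _).le) fun i _ => ?_
    rw [← sum_softmax β y]
    exact Finset.single_le_sum (f := softmax β y) (fun a _ => (softmax_pos β y a).le)
      (Finset.mem_univ _)
  have : Nonempty ι := ⟨i₀⟩
  have hnum := tendsto_laplace hβ hinj hp hdet hcm
    (h := fun y => ∏ i, softmax β y (u i))
    (continuous_finsetProd _ fun i _ => continuous_softmax β (u i)) hbd
  have hden := tendsto_laplace hβ hinj hp hdet hcm (h := fun _ => 1) continuous_const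
    (K := 1) fun _ => by simp
  have hg := gaussConst_pos q
  have hden' : ∑ i, 1 * (gaussConst q / √(hessian β (p i)).det) = gaussConst q * ∑ i, d i := by
    rw [Finset.mul_sum]
    exact Finset.sum_congr rfl fun i _ => by rw [one_mul, div_eq_mul_inv]
  have hnum' : ∑ i, (∏ j, softmax β (p i) (u j)) * (gaussConst q / √(hessian β (p i)).det) =
      gaussConst q * ∑ i, (∏ j, p i (u j)) * d i := by
    rw [Finset.mul_sum]
    refine Finset.sum_congr rfl fun i _ => ?_
    simp_rw [hsm, hd]
    ring
  rw [hden'] at hden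
  rw [hnum'] at hnum
  -- Numerator and denominator have the same Laplace scaling, so `√n ^ q` and `gaussConst q` drop
  -- out and only the Hessian weights remain.
  have hratio := hnum.div hden (mul_pos hg hD).ne'
  rw [mul_div_mul_left _ _ hg.ne'] at hratio
  have hval : (∑ i, ENNReal.ofReal (d i / ∑ j, d j) • bernoulli (p i)) (word m ⁻¹' {u}) =
      ENNReal.ofReal ((∑ i, (∏ j, p i (u j)) * d i) / ∑ i, d i) := by
    rw [Measure.finsetSum_apply, Finset.sum_div, ENNReal.ofReal_sum_of_nonneg fun i _ =>
      div_nonneg (mul_nonneg (Finset.prod_nonneg fun j _ => hpos i _) (hd0 i).le) hD.le]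
    refine Finset.sum_congr rfl fun i _ => ?_
    rw [Measure.smul_apply, smul_eq_mul, bernoulli_word (hpos i) (hsum1 i),
      ← ENNReal.ofReal_mul (div_pos (hd0 i) hD).le]
    congr 1
    ring
  rw [hval]
  refine ((ENNReal.continuous_ofReal.tendsto _).comp hratio).congr' ?_
  filter_upwards [eventually_ge_atTop m, eventually_ne_atTop 0] with n hmn hn
  have hn0 : (0 : ℝ) < n := by exact_mod_cast Nat.pos_of_ne_zero hn
  rw [gibbs_word_eq_integral hβ hmn hn (mfEnergy β (p i₀)) u, Function.comp_apply,
    Pi.div_apply, mul_div_mul_left _ _ (pow_pos (Real.sqrt_pos.2 hn0) q).ne']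

end WeakConvergence

/-! ### The three temperature regimes -/

section Phases

variable {q : ℕ} {β : ℝ}

lemma gibbsWeight_zero (k : Fin q) : gibbsWeight k 0 = fun _ => 1 / (q : ℝ) := by
  funext i
  simp [gibbsWeight]

lemma orderPoint_injective (hq : 2 < q) {s : ℝ} (hs : s ≠ 0) :
    Function.Injective fun k : Fin q => orderPoint k s := by
  have : NeZero q := ⟨by omega⟩
  intro k l hkl
  by_contra hne
  have h := congrFun hkl k
  simp only [orderPoint_eq_add, if_true, if_neg hne] at h
  exact hs (by linarith)

lemma orderPoint_ne_uniform (hq : 2 < q) {s : ℝ} (hs : s ≠ 0) (k : Fin q) :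
    orderPoint k s ≠ fun _ => 1 / (q : ℝ) := by
  have hr : (2 : ℝ) < q := by exact_mod_cast hq
  intro h
  have h1 := congrFun h k
  rw [orderPoint_apply_self, div_left_inj' (by linarith)] at h1
  have h2 : ((q : ℝ) - 1) * s = 0 := by linarith
  rcases mul_eq_zero.1 h2 with h3 | h3
  · linarith
  · exact hs h3

/-- These are the two factors of the Hessian determinant. The second is the smaller one because `1 +
(q - 1) s ≥ 1`, so a single inequality controls both. -/
lemma order_root_nondegenerate (hq : 2 < q) {s : ℝ} (hβ : 0 < β) (hs0 : 0 ≤ s) (hs1 : s < 1)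
    (h : β * ((1 + ((q : ℝ) - 1) * s) * (1 - s)) < q) :
    0 < 1 - β * ((1 - s) / q) ∧ 0 < 1 - β * ((1 + ((q : ℝ) - 1) * s) * (1 - s) / q) := by
  have hr : (2 : ℝ) < q := by exact_mod_cast hq
  have h2 : β * ((1 + ((q : ℝ) - 1) * s) * (1 - s) / q) < 1 := by
    rw [← mul_div_assoc, div_lt_one (by linarith)]
    exact h
  refine ⟨?_, by linarith⟩
  have h3 : (1 - s) / q ≤ (1 + ((q : ℝ) - 1) * s) * (1 - s) / q := by
    gcongr
    have := mul_nonneg (mul_nonneg (by linarith : 0 ≤ (q : ℝ) - 1) hs0) (sub_nonneg.2 hs1.le)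
    nlinarith
  have := mul_le_mul_of_nonneg_left h3 hβ.le
  linarith

lemma det_hessian_ne_zero (hq : 2 < q) [NeZero q] {s : ℝ} (hβ : 0 < β) (hs0 : 0 ≤ s) (hs1 : s < 1)
    (h : β * ((1 + ((q : ℝ) - 1) * s) * (1 - s)) < q) (k : Fin q) :
    (hessian β (orderPoint k s)).det ≠ 0 := by
  obtain ⟨h1, h2⟩ := order_root_nondegenerate hq hβ hs0 hs1 h
  rw [det_hessian_orderPoint hq hβ.ne' k h1.ne']
  positivity

lemma mul_lt_of_root (hq : 2 < q) {s : ℝ} (hle : betaC q ≤ β) (hs : inflection q < s)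
    (hs1 : s < 1) (hg : gap q β s = 0) : β * ((1 + ((q : ℝ) - 1) * s) * (1 - s)) < q := by
  have hr : (2 : ℝ) < q := by exact_mod_cast hq
  have hm0 := inflection_pos hr
  refine mul_lt_one_of_gapSlope_pos hr (hm0.trans hs).le hs1 (gapSlope_pos_of_root hr ?_ hs hs1 hg)
  rw [gap_inflection hr]
  exact mul_nonpos_of_nonpos_of_nonneg (sub_nonpos.2 hle) hm0.le

lemma weaklyConverges_subcritical (hq : 2 < q) (hβ : 0 < β) (hlt : β < betaC q) :
    WeaklyConverges (fun n => gibbs q n β) (uniformBernoulli q) := by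
  have : NeZero q := ⟨by omega⟩
  have hr : (2 : ℝ) < q := by exact_mod_cast hq
  have hdet : (hessian β (fun _ : Fin q => 1 / (q : ℝ))).det ≠ 0 := by
    rw [← orderPoint_zero 0]
    refine det_hessian_ne_zero hq hβ le_rfl one_pos ?_ 0
    have := critBeta_lt hr
    rw [betaC_eq] at hlt
    linarith
  have h := weaklyConverges_gibbs hβ (ι := Unit) (p := fun _ _ => 1 / (q : ℝ))
    (fun _ _ _ => rfl) (fun y => by rw [isMinimizer_iff_of_lt hq hβ hlt]; simp)
    fun _ => hdet
  have hpd := hessian_posDef hβ ((isMinimizer_iff_of_lt hq hβ hlt).2 rfl) hdet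
  rw [Fintype.sum_unique, Fintype.sum_unique,
    div_self (inv_pos.2 (Real.sqrt_pos.2 hpd.det_pos)).ne', ENNReal.ofReal_one, one_smul,
    ← uniformBernoulli_eq (by omega)] at h
  exact h

lemma weaklyConverges_supercritical (hq : 2 < q) (hβ : 0 < β) (hlt : betaC q < β) :
    WeaklyConverges (fun n => gibbs q n β)
      ((q : ℝ≥0∞)⁻¹ • ∑ k, bernoulli (gibbsWeight k (β * sBeta q β))) := by
  have : NeZero q := ⟨by omega⟩
  have hr : (2 : ℝ) < q := by exact_mod_cast hq
  obtain ⟨hs, hs1, hg⟩ := sBeta_of_gt hq hβ hlt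
  have hs0 : 0 < sBeta q β := (inflection_pos hr).trans hs
  have hnd := mul_lt_of_root hq hlt.le hs hs1 hg
  obtain ⟨h1, h2⟩ := order_root_nondegenerate hq hβ hs0.le hs1 hnd
  have h := weaklyConverges_gibbs hβ (orderPoint_injective hq hs0.ne')
    (fun y => isMinimizer_iff_of_gt hq hβ hlt) fun k => det_hessian_ne_zero hq hβ hs0.le hs1 hnd k
  simp_rw [det_hessian_orderPoint hq hβ.ne' _ h1.ne'] at h
  convert! h using 1
  rw [Finset.smul_sum]
  refine Finset.sum_congr rfl fun k _ => ?_
  rw [gibbsWeight_eq_orderPoint hq k hs0.le hs1 hg]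
  congr 1
  simp only [Finset.sum_const, Finset.card_univ, Fintype.card_fin, nsmul_eq_mul]
  have hd : √(β ^ q * (1 - β * ((1 - sBeta q β) / q)) ^ (q - 2) *
      (1 - β * ((1 + ((q : ℝ) - 1) * sBeta q β) * (1 - sBeta q β) / q))) ≠ 0 :=
    (Real.sqrt_pos.2 (by positivity)).ne'
  rw [div_mul_cancel_right₀ (inv_ne_zero hd), ENNReal.ofReal_inv_of_pos (by linarith),
    ENNReal.ofReal_natCast]

lemma sqrt_pow_eq_rpow (hq : 2 < q) {x : ℝ} (hx : 0 ≤ x) :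
    √(x ^ (q - 2)) = x ^ (((q : ℝ) - 2) / 2) := by
  rw [Real.sqrt_eq_rpow, ← Real.rpow_natCast, ← Real.rpow_mul hx, Nat.cast_sub hq.le]
  congr 1
  push_cast
  ring

/-- The square roots of the Hessian determinants are `C A` at the ordered points and `C B` at the
uniform point, with a common factor `C`. The Laplace weights are their inverses, so clearing
denominators gives `A` to the uniform phase and `B` to each ordered phase. -/
lemma weaklyConverges_critical (hq : 2 < q) (k₀ : Fin q) :
    WeaklyConverges (fun n => gibbs q n (betaC q))
      ((ENNReal.ofReal (weightA q + q * weightB q))⁻¹ •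
        (ENNReal.ofReal (weightA q) • bernoulli (gibbsWeight k₀ 0) +
          ENNReal.ofReal (weightB q) •
            ∑ k, bernoulli (gibbsWeight k (betaC q * sBeta q (betaC q))))) := by
  have : NeZero q := ⟨by omega⟩
  have hr : (2 : ℝ) < q := by exact_mod_cast hq
  have hq0 : (q : ℝ) ≠ 0 := by linarith
  have hq1 : (q : ℝ) - 1 ≠ 0 := by linarith
  have hβ : 0 < betaC q := critBeta_pos hr
  have hm0 := inflection_pos hr
  have hg := gap_crit_two_mul hq
  rw [sBeta_crit hq]
  set s := 2 * inflection (q : ℝ) with hsdef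
  have hs : inflection (q : ℝ) < s := by rw [hsdef]; linarith
  have hs0 : 0 < s := hm0.trans hs
  have hs1 : s < 1 := two_mul_inflection_lt_one hr
  have hnd := mul_lt_of_root hq le_rfl hs hs1 hg
  have hnd0 : betaC q * ((1 + ((q : ℝ) - 1) * 0) * (1 - 0)) < q := by
    have := critBeta_lt hr
    rw [← betaC_eq] at this
    linarith
  obtain ⟨h1, h2⟩ := order_root_nondegenerate hq hβ hs0.le hs1 hnd
  obtain ⟨h3, h4⟩ := order_root_nondegenerate hq hβ le_rfl one_pos hnd0
  have h := weaklyConverges_gibbs hβ (ι := Option (Fin q))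
    (p := fun o => o.elim (fun _ => 1 / (q : ℝ)) fun k => orderPoint k s)
    (by
      rintro (_ | k) (_ | l) hkl
      · rfl
      · exact absurd hkl.symm (orderPoint_ne_uniform hq hs0.ne' l)
      · exact absurd hkl (orderPoint_ne_uniform hq hs0.ne' k)
      · exact congrArg some (orderPoint_injective hq hs0.ne' hkl))
    (fun y => by rw [betaC_eq, isMinimizer_crit_iff hq, Option.exists]; rfl)
    (by
      rintro (_ | k)
      · change (hessian (betaC q) fun _ : Fin q => 1 / (q : ℝ)).det ≠ 0
        rw [← orderPoint_zero 0]
        exact det_hessian_ne_zero hq hβ le_rfl one_pos hnd0 0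
      · exact det_hessian_ne_zero hq hβ hs0.le hs1 hnd k)
  set x : ℝ := 1 - betaC q / ((q : ℝ) * ((q : ℝ) - 1)) with hx
  set z : ℝ := 1 - betaC q / (q : ℝ) with hz
  have ex : 1 - betaC q * ((1 - s) / q) = x := by
    rw [hsdef, one_sub_two_mul_inflection hr, hx]
    field_simp
  have ez : 1 - betaC q * ((1 + ((q : ℝ) - 1) * s) * (1 - s) / q) = z := by
    rw [hsdef, one_sub_two_mul_inflection hr, one_add_two_mul_inflection hr, hz]
    field_simp
  have ez0 : 1 - betaC q * ((1 - 0) / q) = z := by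
    rw [hz]
    ring
  have ez0' : 1 - betaC q * ((1 + ((q : ℝ) - 1) * 0) * (1 - 0) / q) = z := by
    rw [hz]
    ring
  have hx0 : 0 < x := ex ▸ h1
  have hz0 : 0 < z := ez ▸ h2
  have hA : √(x ^ (q - 2)) = weightA q := sqrt_pow_eq_rpow hq hx0.le
  have hB : √(z ^ (q - 2)) = weightB q := sqrt_pow_eq_rpow hq hz0.le
  have hA0 : 0 < weightA q := Real.rpow_pos_of_pos hx0 _
  have hB0 : 0 < weightB q := Real.rpow_pos_of_pos hz0 _
  set C : ℝ := √(betaC q ^ q * z) with hC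
  have hC0 : 0 < C := Real.sqrt_pos.2 (by positivity)
  have hd1 : ∀ k : Fin q, √(hessian (betaC q) (orderPoint k s)).det = C * weightA q := by
    intro k
    rw [det_hessian_orderPoint hq hβ.ne' k h1.ne', ex, ez, ← hA, hC,
      ← Real.sqrt_mul (by positivity)]
    congr 1
    ring
  have hd0 : √(hessian (betaC q) fun _ : Fin q => 1 / (q : ℝ)).det = C * weightB q := by
    rw [← orderPoint_zero 0, det_hessian_orderPoint hq hβ.ne' 0 h3.ne', ez0, ez0', ← hB, hC,
      ← Real.sqrt_mul (by positivity)]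
    congr 1
    ring
  simp only [Fintype.sum_option, Option.elim_none, Option.elim_some, hd1, hd0, Finset.sum_const,
    Finset.card_univ, Fintype.card_fin, nsmul_eq_mul] at h
  convert! h using 1
  have hsum : 0 < weightA q + q * weightB q := by positivity
  have hw0 : (C * weightB q)⁻¹ / ((C * weightB q)⁻¹ + q * (C * weightA q)⁻¹) =
      (weightA q + q * weightB q)⁻¹ * weightA q := by
    field_simp
  have hw1 : (C * weightA q)⁻¹ / ((C * weightB q)⁻¹ + q * (C * weightA q)⁻¹) =
      (weightA q + q * weightB q)⁻¹ * weightB q := by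
    field_simp
  rw [hw0, hw1, ENNReal.ofReal_mul (by positivity), ENNReal.ofReal_mul (by positivity),
    ENNReal.ofReal_inv_of_pos hsum, gibbsWeight_zero, smul_add, smul_smul, smul_smul,
    Finset.smul_sum]
  congr 1
  refine Finset.sum_congr rfl fun k _ => ?_
  rw [betaC_eq, gibbsWeight_eq_orderPoint hq k hs0.le hs1 hg]

end Phases

end CWP

end

theorem theorem1p3 (q : ℕ) (hq : 2 < q) :
    -- the dynamical Gibbs measures exist (and, by definition, are unique)
    (∀ (k : Fin q) (b : ℝ), ∃ μ : Measure (CWP.Shift q),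
      CWP.IsDynamicalGibbs CWP.shift (CWP.potential k b) μ) ∧
    -- `s_β` really is the largest solution
    (∀ β : ℝ, CWP.betaC q ≤ β → IsGreatest (CWP.meanFieldRoots q β) (CWP.sBeta q β)) ∧
    -- the weak limits
    ∀ μt : Fin q → ℝ → Measure (CWP.Shift q),
      (∀ k b, CWP.IsDynamicalGibbs CWP.shift (CWP.potential k b) (μt k b)) →
      ∀ β : ℝ, 0 < β →
        (β < CWP.betaC q →
          CWP.WeaklyConverges (fun n => CWP.gibbs q n β) (CWP.uniformBernoulli q)) ∧
        (CWP.betaC q < β →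
          CWP.WeaklyConverges (fun n => CWP.gibbs q n β)
            ((q : ℝ≥0∞)⁻¹ • ∑ k, μt k (β * CWP.sBeta q β))) ∧
        (β = CWP.betaC q →
          CWP.WeaklyConverges (fun n => CWP.gibbs q n β)
            ((ENNReal.ofReal (CWP.weightA q + q * CWP.weightB q))⁻¹ •
              (ENNReal.ofReal (CWP.weightA q) • μt ⟨0, by omega⟩ 0 +
                ENNReal.ofReal (CWP.weightB q) •
                  ∑ k, μt k (CWP.betaC q * CWP.sBeta q (CWP.betaC q))))) := by
  refine ⟨fun k b => ⟨_, CWP.isDynamicalGibbs_bernoulli k b⟩,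
    fun β h => CWP.isGreatest_sBeta hq h, fun μt hμt β hβ => ?_⟩
  -- Uniqueness of the equilibrium state makes the given family explicit.
  have hμ : ∀ k b, μt k b = CWP.bernoulli (CWP.gibbsWeight k b) := fun k b =>
    (CWP.isDynamicalGibbs_bernoulli k b).2 _ (hμt k b).1
  simp_rw [hμ]
  refine ⟨CWP.weaklyConverges_subcritical hq hβ, CWP.weaklyConverges_supercritical hq hβ, ?_⟩
  rintro rfl
  exact CWP.weaklyConverges_critical hq _
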